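/- **Setting (SMBMM).** Let $\mathbb F$ be a finite field. Two sources independently generate (with arbitrary laws) batches $\mathbf A=(\mathbf A^{(1)},\dots,\mathbf A^{(L)})$, $\mathbf A^{(i)}\in\mathbb F^{\lambda\times\kappa}$, and $\mathbf B=(\mathbf B^{(1)},\dots,\mathbf B^{(L)})$, $\mathbf B^{(i)}\in\mathbb F^{\kappa\times\mu}$, with $\lambda,\kappa,\mu\ge 1$. Using private randomness, they send shares $\widetilde A^s,\widetilde B^s$ to $S$ servers. The servers exchange messages $\mathcal M$ ($\mathcal M_s$ being those received by server $s$). Server $s$ sends to the master an answer $Y_s$, computed from its shares, $\mathcal M_s$ and what it has kept from the communication phase. The master applies decoding functions $d_{\mathcal R}$, $\mathcal R\subseteq[S]$, to the answers $Y_{\mathcal R}$ in order to recover $\mathbf{AB}=(\mathbf A^{(i)}\mathbf B^{(i)})_{i}$. The scheme is a *code* with $X$-security if * (correctness) $\mathbf{AB}=d_{\mathcal R}(Y_{\mathcal R})$ for some $\mathcal R$; * (security) $I(\mathbf A,\mathbf B;\widetilde A^{\mathcal X},\widetilde B^{\mathcal X},\mathcal M_{\mathcal X})=0$ for all $\mathcal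 X\subseteq[S]$ with $|\mathcal X|\le X$, even when the randomness generated by the servers in $\mathcal X$ is added to their observations; * (strong security) $I(\mathbf A,\mathbf B,\widetilde A^{[S]},\widetilde B^{[S]};\mathcal M)=0$; * (privacy) $I(\mathbf A,\mathbf B;Y_1,\dots,Y_S\mid\mathbf{AB})=0$. Its recovery threshold is the least $r$ such that $d_{\mathcal R}(Y_{\mathcal R})=\mathbf{AB}$ for all $\mathcal R\subseteq[S]$ with $|\mathcal R|=r$ and all realizations. Upload costs $U_A,U_B$ are the numbers of field symbols in all shares of $\mathbf A$, $\mathbf B$, divided by $L\lambda\kappa$, $L\kappa\mu$; the server communication cost $CC$ is the number of symbols sent between distinct servers, and the download cost $D$ the largest number of symbols in the answers of $R$ servers, both divided by $L\lambda\mu$. Complexities are numbers of field operations ($+,-,\times$, constants of $\mathbb F$ being free) of straight-line programs, divided by $L$: for computing all shares of $\mathbf A$ ($\mathcal C_{eA}$), all shares of $\mathbf B$ ($\mathcal C_{eB}$), the answer of a server from its shares and messages (including what it has kept) ($\mathcal C_s$), and $d_{\mathcal R}$ for any $|\mathcal R|=R$ ($\mathcal C_d$). Here $\widetilde{\mathcal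 O}(a\log^2 b)$ means $\mathcal O(a\log^2 b)$ if $\mathbb F$ supports the FFT (it has a primitive $2^r$-th root of unity for some $2^r\ge b$) and $\mathcal O(a\log^2 b\,\log\log b)$ otherwise. **The GCSA-NA scheme.** Let $X,\ell,K_c,p,m,n$ be positive integers with $m\mid\lambda$, $p\mid\kappa$, $n\mid\mu$, and let $L=\ell K_c$, $R'=pmn$, $D_E=\max(pm,pmn-pm+p)-1$, $\mathcal E=\{p+p(m'-1)+pm(n''-1): m'\in[m],n''\in[n]\}$. Let $f_{l,k}$ ($l\in[\ell],k\in[K_c]$) and $\alpha_1,\dots,\alpha_S$ be $L+S$ distinct elements of $\mathbb F$, and let $c_{l,k,i}$ be the coefficient of $\alpha^i$ in $\prod_{k'\ne k}(\alpha+f_{l,k'}-f_{l,k})^{R'}$. Put $\mathbf A^{l,k}=\mathbf A^{(K_c(l-1)+k)}$, $\mathbf B^{l,k}=\mathbf B^{(K_c(l-1)+k)}$, split into $m\times p$ and $p\times n$ equal blocks, and $$P^{l,k}_s=\sum_{m',p'}\mathbf A^{l,k}_{m',p'}(f_{l,k}-\alpha_s)^{p'-1+p(m'-1)},\qquad Q^{l,k}_s=\sum_{p'',n''}\mathbf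 B^{l,k}_{p'',n''}(f_{l,k}-\alpha_s)^{p-p''+pm(n''-1)}.$$ With independent uniform noise matrices $\mathbf Z^A_{l,x},\mathbf Z^B_{l,x}$ ($x\in[X]$), the shares are, for $l\in[\ell]$, $$\widetilde A^s_l=\prod_{k}(f_{l,k}-\alpha_s)^{R'}\Big(\sum_k\frac{P^{l,k}_s}{(f_{l,k}-\alpha_s)^{R'}}+\sum_x\alpha_s^{x-1}\mathbf Z^A_{l,x}\Big),\qquad \widetilde B^s_l=\sum_k\frac{Q^{l,k}_s}{(f_{l,k}-\alpha_s)^{R'}}+\sum_x\alpha_s^{x-1}\mathbf Z^B_{l,x}.$$ One server generates independent uniform $\frac\lambda m\times\frac\mu n$ matrices $\mathbf Z'_x$, $1\le x\le R'(K_c-1)+X+D_E$, and $\mathbf Z''_{l,k,i}$, $i\in[R']\setminus\mathcal E$, sets $\mathbf Z''_{l,k,i}=0$ for $i\in\mathcal E$, and sends to every other server $s$ (keeping its own) $$\widetilde M_s=\sum_x\alpha_s^{x-1}\mathbf Z'_x+\sum_{l,k}\sum_{i=0}^{R'-1}\frac{\sum_{i'=0}^i c_{l,k,i-i'}\mathbf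 Z''_{l,k,i'+1}}{(f_{l,k}-\alpha_s)^{R'-i}}.$$ The answers are $Y_s=\sum_l\widetilde A^s_l\widetilde B^s_l+\widetilde M_s$. **Theorem.** Let $R=pmn(\ell+1)K_c+2X-1$, and suppose $R\le S$ and $L=\ell K_c\le|\mathbb F|-S$. Then $L+S$ distinct points $f_{l,k},\alpha_s$ exist, and for every choice of them and of the generating server, the GCSA-NA scheme, with suitable decoding functions, is a strongly secure SMBMM code with $X$-security, with recovery threshold $R$ and $$(U_A,U_B)=\Big(\tfrac{S}{K_cpm},\tfrac{S}{K_cpn}\Big),\qquad CC=\tfrac{S-1}{\ell K_cmn},\qquad D=\tfrac{R}{\ell K_cmn},$$ $$\mathcal C_{eA}=\widetilde{\mathcal O}\Big(\tfrac{\lambda\kappa S\log^2S}{K_cpm}\Big),\quad \mathcal C_{eB}=\widetilde{\mathcal O}\Big(\tfrac{\kappa\mu S\log^2S}{K_cpn}\Big),\quad \mathcal C_s=\mathcal O\Big(\tfrac{\lambda\kappa\mu}{K_cpmn}\Big),\quad \mathcal C_d=\widetilde{\mathcal O}(\lambda\mu p\log^2R).$$ The implied constants are absolute (in particular they do not depend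 on $\mathbb F$), except that for $\mathcal C_d$ the constant depends on an upper bound $c$ for $X/(pmn\ell K_c)$ (so it is uniform for $X$ bounded). -/

import Mathlib

universe u

/-! ### Shannon information of finitely-valued random variables -/

/-- Shannon entropy (in nats) of the finitely-valued random variable `V` on the discrete
probability space `(Ω, P)`. -/
noncomputable def entropy {Ω α : Type*} [Finite α] (P : PMF Ω) (V : Ω → α) : ℝ :=
  ∑' a : α, Real.negMulLog ((P.map V) a).toReal

/-- Mutual information `I(V ; W) = H(V) + H(W) - H(V, W)`. -/
noncomputable def mutualInfo {Ω α β : Type*} [Finite α] [Finite β] (P : PMF Ω)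
    (V : Ω → α) (W : Ω → β) : ℝ :=
  entropy P V + entropy P W - entropy P (fun ω => (V ω, W ω))

/-- Conditional mutual information
`I(V ; W | Z) = H(V, Z) + H(W, Z) - H(V, W, Z) - H(Z)`. -/
noncomputable def condMutualInfo {Ω α β γ : Type*} [Finite α] [Finite β] [Finite γ] (P : PMF Ω)
    (V : Ω → α) (W : Ω → β) (Z : Ω → γ) : ℝ :=
  entropy P (fun ω => (V ω, Z ω)) + entropy P (fun ω => (W ω, Z ω))
    - entropy P (fun ω => (V ω, W ω, Z ω)) - entropy P Z

/-! ### Counting arithmetic operations: straight-line programs -/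

/-- An operand of an arithmetic instruction: a constant of the field, an input symbol, or the
result of the `j`-th instruction. -/
inductive Operand (F : Type*) (ι : Type*) where
  | const (c : F)
  | input (i : ι)
  | reg (j : ℕ)

/-- One arithmetic operation of the field. (Division by a constant is a multiplication.) -/
inductive Instr (F : Type*) (ι : Type*) where
  | add (a b : Operand F ι)
  | sub (a b : Operand F ι)
  | mul (a b : Operand F ι)

/-- The value of an operand, given the inputs `x` and the results `r` computed so far. -/
def Operand.value {F ι : Type*} [Field F] (x : ι → F) (r : List F) : Operand F ι → F
  | .const c => c
  | .input i => x i
  | .reg j => r.getD j 0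

/-- The result of an instruction. -/
def Instr.value {F ι : Type*} [Field F] (x : ι → F) (r : List F) : Instr F ι → F
  | .add a b => a.value x r + b.value x r
  | .sub a b => a.value x r - b.value x r
  | .mul a b => a.value x r * b.value x r

/-- The list of results of all instructions of a straight-line program on the inputs `x`. -/
def runProgram {F ι : Type*} [Field F] (x : ι → F) (prog : List (Instr F ι)) : List F :=
  prog.foldl (fun r c => r ++ [c.value x r]) []

/-- `G` can be computed with at most `N` arithmetic operations: some straight-line program with at
most `N` instructions produces all coordinates of `G x`, for every input `x`. -/
def ComputableWithin {F ι o : Type*} [Field F] (N : ℝ) (G : (ι → F) → (o → F)) : Prop :=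
  ∃ (prog : List (Instr F ι)) (out : o → Operand F ι), (prog.length : ℝ) ≤ N ∧
    ∀ x j, (out j).value x (runProgram x prog) = G x j

/-- `F` supports the (radix-2) fast Fourier transform of some length at least `b`. -/
def SupportsFFT (F : Type*) [Field F] (b : ℕ) : Prop :=
  ∃ (r : ℕ) (ζ : F), b ≤ 2 ^ r ∧ IsPrimitiveRoot ζ (2 ^ r)

open Classical in
/-- The factor that stands for `log² b` under a soft-O: it is `log² b` when the field supports the
FFT, and `log² b · log log b` when it does not. (It is used for `b ≥ 3` only, where it is
positive.) -/
noncomputable def softLogSq (F : Type*) [Field F] (b : ℕ) : ℝ :=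
  if SupportsFFT F b then Real.log b ^ 2 else Real.log b ^ 2 * Real.log (Real.log b)

/-! ### Secure coded multi-party batch matrix multiplication -/

/-- A scheme for the multiplication of batches of `L` matrices of sizes `lam × kap` and
`kap × mu` over `F` with `S` servers. Private randomness consists of independent uniform symbols of
`F`; shares, messages and answers are vectors of symbols of `F` with arbitrary index sets. -/
structure Scheme (F : Type u) (S L lam kap mu : ℕ) where
  /-- index set of the random symbols of source `A` -/
  νA : Type
  /-- index set of the random symbols of source `B` -/
  νB : Type
  /-- index set of the random symbols generated by each server -/
  νS : Fin S → Type
  /-- index set of the symbols of each share of `A` -/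
  ιA : Fin S → Type
  /-- index set of the symbols of each share of `B` -/
  ιB : Fin S → Type
  /-- index set of the symbols of the message from one server to another -/
  ιM : Fin S → Fin S → Type
  /-- index set of the symbols of each answer -/
  ιY : Fin S → Type
  fνA : Fintype νA
  fνB : Fintype νB
  fνS : ∀ s, Fintype (νS s)
  fιA : ∀ s, Fintype (ιA s)
  fιB : ∀ s, Fintype (ιB s)
  fιM : ∀ s s', Fintype (ιM s s')
  fιY : ∀ s, Fintype (ιY s)
  /-- the encoding functions of source `A` -/
  encA : ∀ s, (Fin L → Matrix (Fin lam) (Fin kap) F) → (νA → F) → (ιA s → F)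
  /-- the encoding functions of source `B` -/
  encB : ∀ s, (Fin L → Matrix (Fin kap) (Fin mu) F) → (νB → F) → (ιB s → F)
  /-- the message from server `s` to server `s'`, computed from the shares and the random symbols of
  server `s`; the "message" from `s` to `s` is what `s` keeps for itself (it is not transmitted) -/
  msg : ∀ s s', (ιA s → F) → (ιB s → F) → (νS s → F) → (ιM s s' → F)
  /-- the answer of server `s`, from its shares, the messages it received and what it has kept -/
  ans : ∀ s, (ιA s → F) → (ιB s → F) → (∀ s', ιM s' s → F) → (ιY s → F)
  /-- the decoding functions of the master, one for each set of responsive servers -/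
  dec : ∀ T : Finset (Fin S), (∀ s : T, ιY s → F) → (Fin L → Matrix (Fin lam) (Fin mu) F)

namespace Scheme

attribute [instance] Scheme.fνA Scheme.fνB Scheme.fνS Scheme.fιA Scheme.fιB Scheme.fιM Scheme.fιY

variable {F : Type u} [Field F] {S L lam kap mu : ℕ} (P : Scheme F S L lam kap mu)

/-- A realization of the input data and of all private randomness. -/
structure Realization where
  A : Fin L → Matrix (Fin lam) (Fin kap) F
  B : Fin L → Matrix (Fin kap) (Fin mu) F
  ZA : P.νA → F
  ZB : P.νB → F
  W : ∀ s, P.νS s → F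

variable {P}

/-- The batch of desired products. -/
def Realization.AB (ω : P.Realization) : Fin L → Matrix (Fin lam) (Fin mu) F :=
  fun l => ω.A l * ω.B l

/-- The share of `A` at server `s`. -/
def Realization.shareA (ω : P.Realization) (s : Fin S) : P.ιA s → F := P.encA s ω.A ω.ZA

/-- The share of `B` at server `s`. -/
def Realization.shareB (ω : P.Realization) (s : Fin S) : P.ιB s → F := P.encB s ω.B ω.ZB

/-- The message from server `s` to server `s'`. -/
def Realization.message (ω : P.Realization) (s s' : Fin S) : P.ιM s s' → F :=
  P.msg s s' (ω.shareA s) (ω.shareB s) (ω.W s)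

/-- The messages that server `s` receives from the other servers. -/
def Realization.received (ω : P.Realization) (s : Fin S) (s' : {s' : Fin S // s' ≠ s}) :
    P.ιM s' s → F :=
  ω.message s' s

/-- All messages exchanged between servers. -/
def Realization.allMessages (ω : P.Realization) (s : Fin S) (s' : {s' : Fin S // s' ≠ s}) :
    P.ιM s' s → F :=
  ω.received s s'

/-- The answer of server `s`. -/
def Realization.answer (ω : P.Realization) (s : Fin S) : P.ιY s → F :=
  P.ans s (ω.shareA s) (ω.shareB s) (fun s' => ω.message s' s)

variable (P)

open Classical in
/-- The joint law when the sources generate `A` and `B` independently with laws `pA` and `pB`, and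
all random symbols are uniform, independent of each other and of the data. -/
noncomputable def law [Fintype F] (pA : PMF (Fin L → Matrix (Fin lam) (Fin kap) F))
    (pB : PMF (Fin L → Matrix (Fin kap) (Fin mu) F)) : PMF P.Realization :=
  pA.bind fun A => pB.bind fun B =>
    (PMF.uniformOfFintype ((P.νA → F) × (P.νB → F) × (∀ s, P.νS s → F))).map
      fun z => ⟨A, B, z.1, z.2.1, z.2.2⟩

/-- The master recovers the products from the answers of the servers in `T`, whatever the data and
the randomness are. -/
def RecoversFrom (T : Finset (Fin S)) : Prop :=
  ∀ ω : P.Realization, P.dec T (fun s => ω.answer s) = ω.AB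

/-- Correctness: the products are recovered from the answers of some set of servers. -/
def IsCorrect : Prop := ∃ T : Finset (Fin S), P.RecoversFrom T

/-- The products are recovered from the answers of any `r` servers. -/
def IsRecoverable (r : ℕ) : Prop := ∀ T : Finset (Fin S), T.card = r → P.RecoversFrom T

/-- `R` is the recovery threshold: the minimum `r` such that the scheme is `r`-recoverable. -/
def IsRecoveryThreshold (R : ℕ) : Prop := IsLeast {r : ℕ | P.IsRecoverable r} R

/-- Security against any `X` colluding servers, each of which knows its shares, the messages that it
received, and the random symbols that it has generated itself. -/
def IsSecure [Fintype F] (X : ℕ) : Prop :=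
  ∀ pA pB, ∀ T : Finset (Fin S), T.card ≤ X →
    mutualInfo (P.law pA pB) (fun ω => (ω.A, ω.B))
      (fun ω => ((fun s : T => ω.shareA s), (fun s : T => ω.shareB s),
        (fun s : T => ω.received s), (fun s : T => ω.W s))) = 0

/-- Strong security: the inter-server messages are independent of the data and of all shares. -/
def IsStronglySecure [Fintype F] : Prop :=
  ∀ pA pB, mutualInfo (P.law pA pB) (fun ω => (ω.A, ω.B, ω.shareA, ω.shareB))
    (fun ω => ω.allMessages) = 0

/-- Privacy: the answers of all servers reveal nothing about the data beyond the products. -/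
def IsPrivate [Fintype F] : Prop :=
  ∀ pA pB, condMutualInfo (P.law pA pB) (fun ω => (ω.A, ω.B)) (fun ω => ω.answer)
    (fun ω => ω.AB) = 0

/-- The scheme is a (strongly secure) code for secure coded multi-party batch matrix
multiplication with `X`-security. -/
structure IsSMBMMCode [Fintype F] (X : ℕ) : Prop where
  correct : P.IsCorrect
  secure : P.IsSecure X
  stronglySecure : P.IsStronglySecure
  isPrivate : P.IsPrivate

/-- Upload cost of source `A`, normalized by the number of entries of the matrices `A`. -/
def uploadCostA : ℚ := ((∑ s, Fintype.card (P.ιA s) : ℕ) : ℚ) / (L * lam * kap)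

/-- Upload cost of source `B`, normalized by the number of entries of the matrices `B`. -/
def uploadCostB : ℚ := ((∑ s, Fintype.card (P.ιB s) : ℕ) : ℚ) / (L * kap * mu)

/-- Server communication cost: the number of symbols sent from servers to other servers, normalized
by the number of entries of the products. -/
def serverCommCost : ℚ :=
  ((∑ s, ∑ s' ∈ Finset.univ.erase s, Fintype.card (P.ιM s' s) : ℕ) : ℚ) / (L * lam * mu)

/-- Download cost when the master uses the answers of `R` servers, normalized by the number of
entries of the products. -/
def downloadCost (R : ℕ) : ℚ :=
  (((Finset.univ.powersetCard R).sup
    fun T : Finset (Fin S) => ∑ s ∈ T, Fintype.card (P.ιY s) : ℕ) : ℚ) / (L * lam * mu)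

/-- The encoding functions of source `A` can be computed for all servers together with at most `L * c`
operations, i.e. with normalized complexity at most `c`. -/
def EncodesAWithin (c : ℝ) : Prop :=
  ComputableWithin (L * c)
    (fun (x : (Fin L × Fin lam × Fin kap) ⊕ P.νA → F) (o : (s : Fin S) × P.ιA s) =>
      P.encA o.1 (fun l => Matrix.of fun i j => x (.inl (l, i, j))) (fun v => x (.inr v)) o.2)

/-- The same for source `B`. -/
def EncodesBWithin (c : ℝ) : Prop :=
  ComputableWithin (L * c)
    (fun (x : (Fin L × Fin kap × Fin mu) ⊕ P.νB → F) (o : (s : Fin S) × P.ιB s) =>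
      P.encB o.1 (fun l => Matrix.of fun i j => x (.inl (l, i, j))) (fun v => x (.inr v)) o.2)

/-- Every server computes its answer with normalized complexity at most `c`. -/
def AnswersWithin (c : ℝ) : Prop :=
  ∀ s, ComputableWithin (L * c)
    (fun (x : P.ιA s ⊕ P.ιB s ⊕ ((s' : Fin S) × P.ιM s' s) → F) (o : P.ιY s) =>
      P.ans s (fun i => x (.inl i)) (fun i => x (.inr (.inl i)))
        (fun s' i => x (.inr (.inr ⟨s', i⟩))) o)

/-- The master decodes from the answers of any `R` servers with normalized complexity at most `c`. -/
def DecodesWithin (R : ℕ) (c : ℝ) : Prop :=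
  ∀ T : Finset (Fin S), T.card = R → ComputableWithin (L * c)
    (fun (x : ((s : T) × P.ιY s) → F) (o : Fin L × Fin lam × Fin mu) =>
      P.dec T (fun s i => x ⟨s, i⟩) o.1 o.2.1 o.2.2)

end Scheme

/-! ### The GCSA-NA scheme -/

namespace GCSA

/-- The index, among `N` rows or columns split into `q` consecutive blocks, of the `j`-th row or
column of the `i`-th block. -/
def blockIdx {N q : ℕ} (i : Fin q) (j : Fin (N / q)) : Fin N :=
  ⟨i * (N / q) + j, by
    calc (i : ℕ) * (N / q) + j < i * (N / q) + N / q := Nat.add_lt_add_left j.isLt _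
      _ = (i + 1) * (N / q) := by ring
      _ ≤ q * (N / q) := Nat.mul_le_mul_right _ i.isLt
      _ ≤ N := Nat.mul_div_le N q⟩

variable {F : Type u} [Field F]

/-- Entangled polynomial encoding of a matrix `A` split into `m × p` blocks, evaluated at `u`:
the sum of `A_{m',p'} u^{(p'-1) + p (m'-1)}` (here `m'` and `p'` are counted from zero). -/
def epA {lam kap : ℕ} (p m : ℕ) (A : Matrix (Fin lam) (Fin kap) F) (u : F) :
    Matrix (Fin (lam / m)) (Fin (kap / p)) F :=
  ∑ m' : Fin m, ∑ p' : Fin p, u ^ ((p' : ℕ) + p * m') • A.submatrix (blockIdx m') (blockIdx p')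

/-- Entangled polynomial encoding of a matrix `B` split into `p × n` blocks, evaluated at `u`:
the sum of `B_{p'',n''} u^{(p - p'') + p m (n''-1)}` (here `p''` and `n''` are counted from zero). -/
def epB {kap mu : ℕ} (p m n : ℕ) (B : Matrix (Fin kap) (Fin mu) F) (u : F) :
    Matrix (Fin (kap / p)) (Fin (mu / n)) F :=
  ∑ p' : Fin p, ∑ n' : Fin n,
    u ^ ((p - 1 - p') + p * m * n') • B.submatrix (blockIdx p') (blockIdx n')

/-- The coefficient of degree `i` of the polynomial
`∏_{k' ≠ k} (α + (f_{l,k'} - f_{l,k})) ^ (p m n)` in `α`. -/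
noncomputable def coef {ℓ Kc : ℕ} (p m n : ℕ) (f : Fin ℓ × Fin Kc → F) (l : Fin ℓ) (k : Fin Kc)
    (i : ℕ) : F :=
  (∏ k' ∈ Finset.univ.erase k,
    (Polynomial.X + Polynomial.C (f (l, k') - f (l, k))) ^ (p * m * n)).coeff i

/-- `D_E = max(pm, pmn - pm + p) - 1`. -/
def degE (p m n : ℕ) : ℕ := max (p * m) (p * m * n - p * m + p) - 1

/-- The number of noise matrices that protect the polynomial part of the answers. -/
def numPolyNoise (X Kc p m n : ℕ) : ℕ := p * m * n * (Kc - 1) + X + degE p m n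

/-- The positions (in `{1, …, pmn}`) of the desired blocks, where no noise is added. -/
def desired (p m n : ℕ) : Set ℕ :=
  {e | ∃ (m' : Fin m) (n' : Fin n), e = p + p * m' + p * m * n'}

/-- Labels of the random matrices of the generating server: those of the polynomial part, and those
at the undesired positions `(l, k, i)` (with `i` counted from zero). -/
abbrev NoiseLabel (X ℓ Kc p m n : ℕ) : Type :=
  Fin (numPolyNoise X Kc p m n) ⊕
    {x : Fin ℓ × Fin Kc × Fin (p * m * n) // (x.2.2 : ℕ) + 1 ∉ desired p m n}

open Classical in
/-- The aligned noise for the server at the evaluation point `a`, made from the matrices `Z`. -/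
noncomputable def alignedNoise {r c X ℓ Kc : ℕ} (p m n : ℕ) (f : Fin ℓ × Fin Kc → F) (a : F)
    (Z : NoiseLabel X ℓ Kc p m n → Matrix (Fin r) (Fin c) F) : Matrix (Fin r) (Fin c) F :=
  ∑ x : Fin (numPolyNoise X Kc p m n), a ^ (x : ℕ) • Z (.inl x) +
    ∑ l : Fin ℓ, ∑ k : Fin Kc, ∑ i : Fin (p * m * n),
      ((f (l, k) - a) ^ (p * m * n - (i : ℕ)))⁻¹ •
        ∑ i' ∈ Finset.Iic i, coef p m n f l k ((i : ℕ) - i') •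
          (if h : (i' : ℕ) + 1 ∉ desired p m n then Z (.inr ⟨(l, k, i'), h⟩) else 0)

/-- The share of `A` for group `l` at the evaluation point `a`, with noise matrices `Z`. -/
def shareA {lam kap X ℓ Kc : ℕ} (p m n : ℕ) (f : Fin ℓ × Fin Kc → F) (a : F)
    (A : Fin (ℓ * Kc) → Matrix (Fin lam) (Fin kap) F)
    (Z : Fin ℓ → Fin X → Matrix (Fin (lam / m)) (Fin (kap / p)) F) (l : Fin ℓ) :
    Matrix (Fin (lam / m)) (Fin (kap / p)) F :=
  (∏ k : Fin Kc, (f (l, k) - a) ^ (p * m * n)) •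
    (∑ k : Fin Kc, ((f (l, k) - a) ^ (p * m * n))⁻¹ •
        epA p m (A (finProdFinEquiv (l, k))) (f (l, k) - a) +
      ∑ x : Fin X, a ^ (x : ℕ) • Z l x)

/-- The share of `B` for group `l` at the evaluation point `a`, with noise matrices `Z`. -/
def shareB {kap mu X ℓ Kc : ℕ} (p m n : ℕ) (f : Fin ℓ × Fin Kc → F) (a : F)
    (B : Fin (ℓ * Kc) → Matrix (Fin kap) (Fin mu) F)
    (Z : Fin ℓ → Fin X → Matrix (Fin (kap / p)) (Fin (mu / n)) F) (l : Fin ℓ) :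
    Matrix (Fin (kap / p)) (Fin (mu / n)) F :=
  ∑ k : Fin Kc, ((f (l, k) - a) ^ (p * m * n))⁻¹ •
      epB p m n (B (finProdFinEquiv (l, k))) (f (l, k) - a) +
    ∑ x : Fin X, a ^ (x : ℕ) • Z l x

end GCSA

open GCSA in
open Classical in
/-- The GCSA-NA scheme with parameters `(ℓ, Kc, p, m, n)`, points `f` and `α`, and decoding functions
`dec`; server `g` generates the aligned noise. The batch of `ℓ * Kc` matrices is split into `ℓ`
groups, the `k`-th matrix of group `l` being number `Kc * l + k` (counted from zero). -/
noncomputable def gcsaNA {F : Type u} [Field F] {S : ℕ} (X ℓ Kc p m n lam kap mu : ℕ)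
    (f : Fin ℓ × Fin Kc → F) (α : Fin S → F) (g : Fin S)
    (dec : ∀ T : Finset (Fin S), (T → Fin (lam / m) × Fin (mu / n) → F) →
      (Fin (ℓ * Kc) → Matrix (Fin lam) (Fin mu) F)) :
    Scheme F S (ℓ * Kc) lam kap mu where
  νA := Fin ℓ × Fin X × Fin (lam / m) × Fin (kap / p)
  νB := Fin ℓ × Fin X × Fin (kap / p) × Fin (mu / n)
  νS s := {_v : NoiseLabel X ℓ Kc p m n × Fin (lam / m) × Fin (mu / n) // s = g}
  ιA _ := Fin ℓ × Fin (lam / m) × Fin (kap / p)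
  ιB _ := Fin ℓ × Fin (kap / p) × Fin (mu / n)
  ιM s _ := {_e : Fin (lam / m) × Fin (mu / n) // s = g}
  ιY _ := Fin (lam / m) × Fin (mu / n)
  fνA := inferInstance
  fνB := inferInstance
  fνS _ := inferInstance
  fιA _ := inferInstance
  fιB _ := inferInstance
  fιM _ _ := inferInstance
  fιY _ := inferInstance
  encA s A z := fun e =>
    shareA p m n f (α s) A (fun l x => Matrix.of fun i j => z (l, x, i, j)) e.1 e.2.1 e.2.2
  encB s B z := fun e =>
    shareB p m n f (α s) B (fun l x => Matrix.of fun i j => z (l, x, i, j)) e.1 e.2.1 e.2.2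
  msg _ s' _ _ w := fun e =>
    alignedNoise p m n f (α s') (fun v => Matrix.of fun i j => w ⟨(v, i, j), e.2⟩) e.1.1 e.1.2
  ans _ a b M := fun e =>
    ∑ l : Fin ℓ, ∑ t : Fin (kap / p), a (l, e.1, t) * b (l, t, e.2) + M g ⟨e, rfl⟩
  dec := dec

/-! Write `r = p * m * n` and `L = ℓ * Kc`. Everything about data rests on one structural fact. As a
function of `α`, the sum of the products of the shares is a principal part with poles of order at
most `r` at the points `f (l, k)`, plus a polynomial of degree below `numPolyNoise`, plus products
of two noise polynomials multiplied by `∏ k, (f (l, k) - α) ^ r` (`exists_polynomial_part`,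
`GCSA.exists_sum_share_mul`). In the variable `u = f (l, k) - α`, the principal part at `f (l, k)`
is given by the first `r` coefficients of `coefPoly * W`, where `W` is a sum of products of
entangled polynomial encodings. The coefficients of `W` at the desired exponents are the entries of
the product of the data (`GCSA.coeff_sum_entryPoly_mul`). The aligned noise has the same shape, with
a `W` that vanishes at the desired exponents (`GCSA.alignedNoise_apply`).

Recovery: multiplied by all the factors `(f (l, k) - α) ^ r`, the answers become values of a
polynomial of degree less than `R`, since the polynomial part has degree at most `r * Kc + 2 * X -
2` and the denominator has degree `L * r`. So `R` values determine it. Its Taylor expansion at `f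
(l, k)`, multiplied by the inverse of a known unit modulo `u ^ r`, gives `W` modulo `u ^ r`
(`coeff_localExpansion`).

Security and privacy: an observation is independent of the data if any change of the data can be
compensated by a bijection of the uniform randomness (`mutualInfo_eq_zero_of_equiv` and its
conditional form). For at most `X` servers, Lagrange interpolation yields a translation of the
source noise. The messages involve only the randomness of the generating server. For privacy, data
with equal products give sums of share products that differ by an aligned noise, hence by a
translation of the server noise.

Complexity: the points are fixed, so all polynomials built from them are constants of the programs,
and only multiplication by a fixed polynomial has to be fast. This is done by the FFT if the field
has the roots of unity, and otherwise by the method of Schönhage and Strassen, in radix `3` if the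
characteristic is `2` (`exists_polyMulCost`). Divide and conquer then gives substitution of linear
polynomials, interpolation and simultaneous remainders, at the price of one more logarithm. A family
of shares is a numerator evaluated at all `α s`; decoding is an interpolation, reductions modulo the
`(X - f (l, k)) ^ r`, shifts, and multiplications by the correcting units. -/

/-! ### A calculus of straight-line programs -/

namespace Operand

variable {F ι κ : Type*}

/-- Substitute operands for the inputs, and shift the registers by `N`. -/
def subst (N : ℕ) (σ : κ → Operand F ι) : Operand F κ → Operand F ι
  | .const c => .const c
  | .input i => σ i
  | .reg j => .reg (N + j)

/-- Replace the registers from the `N`-th on, which are not yet filled, by zero. -/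
def clip [Field F] (N : ℕ) : Operand F ι → Operand F ι
  | .const c => .const c
  | .input i => .input i
  | .reg j => if j < N then .reg j else .const 0

/-- An unfilled register reads as zero. Once a second program is appended, the same number may
denote a filled register, so the operands of the first program must be clipped before they are
reused. -/
theorem value_clip [Field F] (x : ι → F) (r r' : List F) (a : Operand F ι) :
    (a.clip r.length).value x (r ++ r') = a.value x r := by
  cases a with
  | const c => rfl
  | input i => rfl
  | reg j =>
    by_cases h : j < r.length
    · simp [clip, h, value, List.getElem?_append_left h]
    · simp [clip, h, value]

theorem value_subst [Field F] (x : ι → F) (r r' : List F) (σ : κ → Operand F ι) (y : κ → F)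
    (hσ : ∀ k, (σ k).value x (r ++ r') = y k) (a : Operand F κ) :
    (a.subst r.length σ).value x (r ++ r') = a.value y r' := by
  cases a with
  | const c => rfl
  | input i => exact hσ i
  | reg j => simp [subst, value, List.getElem?_append_right]

end Operand

namespace Instr

variable {F ι κ : Type*}

/-- Substitute operands for the inputs, and shift the registers by `N`. -/
def subst (N : ℕ) (σ : κ → Operand F ι) : Instr F κ → Instr F ι
  | .add a b => .add (a.subst N σ) (b.subst N σ)
  | .sub a b => .sub (a.subst N σ) (b.subst N σ)
  | .mul a b => .mul (a.subst N σ) (b.subst N σ)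

theorem value_subst [Field F] (x : ι → F) (r r' : List F) (σ : κ → Operand F ι) (y : κ → F)
    (hσ : ∀ k, (σ k).value x (r ++ r') = y k) (a : Instr F κ) :
    (a.subst r.length σ).value x (r ++ r') = a.value y r' := by
  cases a <;> simp [subst, value, Operand.value_subst x r r' σ y hσ]

end Instr

section Programs

variable {F ι κ o : Type*} [Field F]

theorem runProgram_append_singleton (x : ι → F) (p : List (Instr F ι)) (c : Instr F ι) :
    runProgram x (p ++ [c]) = runProgram x p ++ [c.value x (runProgram x p)] := by
  simp [runProgram]

theorem length_runProgram (x : ι → F) (p : List (Instr F ι)) :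
    (runProgram x p).length = p.length := by
  induction p using List.reverseRecOn with
  | nil => rfl
  | append_singleton p c ih => simp [runProgram_append_singleton, ih]

/-- The registers of `q` are moved behind those of `p`, and the inputs of `q` become operands that
read only the results of `p`. This is the composition of programs. -/
theorem runProgram_append_subst (x : ι → F) (p : List (Instr F ι)) (q : List (Instr F κ))
    (σ : κ → Operand F ι) :
    runProgram x (p ++ q.map (Instr.subst p.length fun k => (σ k).clip p.length)) =
      runProgram x p ++ runProgram (fun k => (σ k).value x (runProgram x p)) q := by
  induction q using List.reverseRecOn with
  | nil => simp [runProgram]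
  | append_singleton q c ih =>
    rw [List.map_append, List.map_singleton, ← List.append_assoc, runProgram_append_singleton, ih,
      runProgram_append_singleton, List.append_assoc, ← length_runProgram x p]
    congr 3
    exact Instr.value_subst x _ _ _ _ (fun k => Operand.value_clip _ _ _ _) c

/-- `G` can be computed with at most `N` arithmetic operations, with a natural number `N`. -/
def CostLE (N : ℕ) (G : (ι → F) → (o → F)) : Prop := ComputableWithin (N : ℝ) G

theorem costLE_iff {N : ℕ} {G : (ι → F) → (o → F)} :
    CostLE N G ↔ ∃ (prog : List (Instr F ι)) (out : o → Operand F ι), prog.length ≤ N ∧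
      ∀ x j, (out j).value x (runProgram x prog) = G x j := by
  simp [CostLE, ComputableWithin]

theorem CostLE.computableWithin {N : ℕ} {G : (ι → F) → (o → F)} (h : CostLE N G) {c : ℝ}
    (hc : (N : ℝ) ≤ c) : ComputableWithin c G := by
  obtain ⟨p, out, hp, h⟩ := h
  exact ⟨p, out, hp.trans hc, h⟩

theorem CostLE.mono {N M : ℕ} {G : (ι → F) → (o → F)} (h : CostLE N G) (hNM : N ≤ M) :
    CostLE M G :=
  h.computableWithin (by exact_mod_cast hNM)

theorem CostLE.congr {N : ℕ} {G H : (ι → F) → (o → F)} (h : CostLE N G)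
    (e : ∀ x j, G x j = H x j) : CostLE N H := by
  have : G = H := by
    funext x j
    exact e x j
  exact this ▸ h

/-- The outputs of `G` stay addressable after `H` has run, so a result can be used several times
without being paid for again. -/
theorem CostLE.comp_keep {N M : ℕ} {G : (ι → F) → (κ → F)} {H : (κ → F) → (o → F)}
    (hG : CostLE N G) (hH : CostLE M H) :
    CostLE (N + M) fun x => Sum.elim (H (G x)) (G x) := by
  rw [costLE_iff] at *
  obtain ⟨p, σ, hp, hG⟩ := hG
  obtain ⟨q, τ, hq, hH⟩ := hH
  have hG' : ∀ x, (fun k => (σ k).value x (runProgram x p)) = G x := fun x => funext (hG x)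
  refine ⟨p ++ q.map (Instr.subst p.length fun k => (σ k).clip p.length),
    Sum.elim (fun j => (τ j).subst p.length fun k => (σ k).clip p.length)
      (fun k => (σ k).clip p.length), by simp; omega, ?_⟩
  rintro x (j | k)
  · rw [runProgram_append_subst, Sum.elim_inl, ← length_runProgram x p,
      Operand.value_subst x _ _ _ _ (fun k => Operand.value_clip _ _ _ _), hG', hH]
    rfl
  · rw [runProgram_append_subst, Sum.elim_inr, ← length_runProgram x p, Operand.value_clip, hG]
    rfl

theorem CostLE.reindex {N : ℕ} {G : (ι → F) → (κ → F)} (h : CostLE N G) (σ : o → κ) :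
    CostLE N fun x j => G x (σ j) := by
  obtain ⟨p, out, hp, h⟩ := h
  exact ⟨p, out ∘ σ, hp, fun x j => h x (σ j)⟩

theorem CostLE.comp {N M : ℕ} {G : (ι → F) → (κ → F)} {H : (κ → F) → (o → F)}
    (hH : CostLE M H) (hG : CostLE N G) : CostLE (N + M) fun x => H (G x) :=
  (hG.comp_keep hH).reindex Sum.inl

theorem CostLE.keep {N : ℕ} {G : (ι → F) → (κ → F)} (h : CostLE N G) :
    CostLE N fun x => Sum.elim (G x) x := by
  obtain ⟨p, out, hp, h⟩ := h
  refine ⟨p, Sum.elim out .input, hp, ?_⟩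
  rintro x (j | j)
  · exact h x j
  · rfl

theorem costLE_reindex (σ : o → ι) : CostLE 0 fun (x : ι → F) j => x (σ j) :=
  costLE_iff.2 ⟨[], fun j => .input (σ j), le_rfl, fun _ _ => rfl⟩

theorem costLE_reindex_or (p : o → Prop) [DecidablePred p] (σ : o → ι) (c : F) :
    CostLE 0 fun (x : ι → F) j => if p j then x (σ j) else c := by
  refine costLE_iff.2 ⟨[], fun j => if p j then .input (σ j) else .const c, le_rfl, fun x j => ?_⟩
  by_cases h : p j <;> simp [h, Operand.value]

theorem costLE_const (c : o → F) : CostLE 0 fun (_ : ι → F) j => c j :=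
  costLE_iff.2 ⟨[], fun j => .const (c j), le_rfl, fun _ _ => rfl⟩

theorem CostLE.reindex_or_zero {N : ℕ} {G : (ι → F) → (κ → F)} (h : CostLE N G) (p : o → Prop)
    [DecidablePred p] (σ : o → κ) : CostLE N fun x j => if p j then G x (σ j) else 0 := by
  simpa using (costLE_reindex_or p σ (0 : F)).comp h

theorem CostLE.pair {N M : ℕ} {G : (ι → F) → (κ → F)} {H : (ι → F) → (o → F)}
    (hG : CostLE N G) (hH : CostLE M H) : CostLE (N + M) fun x => Sum.elim (G x) (H x) := by
  have h := hG.keep.comp_keep (hH.comp (costLE_reindex (Sum.inr : ι → κ ⊕ ι)))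
  refine ((h.reindex (Sum.elim (fun k => Sum.inr (Sum.inl k)) Sum.inl : κ ⊕ o → _)).mono
    (by omega)).congr ?_
  rintro x (j | j) <;> rfl

theorem costLE_instr (c : Instr F ι) : CostLE 1 fun (x : ι → F) (_ : Unit) => c.value x [] := by
  refine costLE_iff.2 ⟨[c], fun _ => .reg 0, le_rfl, fun x j => ?_⟩
  simp [Operand.value, runProgram]

/-- Outputs are often indexed by all of `ℕ`, as coefficients of polynomials. Only the indices in the
finite set `s` cost an instruction; elsewhere the output is an operand, which is free. For this
reason the rules below carry a support. -/
theorem costLE_pointwise (c : o → Instr F ι) (b : o → Operand F ι) (s : Finset o)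
    [DecidableEq o] :
    CostLE s.card fun (x : ι → F) j => if j ∈ s then (c j).value x [] else (b j).value x [] := by
  induction s using Finset.induction_on with
  | empty => exact costLE_iff.2 ⟨[], b, le_rfl, fun x j => by simp [runProgram]⟩
  | insert a s ha ih =>
    refine (((ih.pair (costLE_instr (c a))).reindex
      fun j => if j = a then Sum.inr () else Sum.inl j).mono ?_).congr ?_
    · rw [Finset.card_insert_of_notMem ha]
    · intro x j
      by_cases h : j = a
      · simp [h]
      · simp [h]

theorem CostLE.add_of_support {N M : ℕ} {G H : (ι → F) → (o → F)} (hG : CostLE N G)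
    (hH : CostLE M H) (s : Finset o) (hs : ∀ j ∉ s, ∀ x, H x j = 0) :
    CostLE (N + M + s.card) fun x j => G x j + H x j := by
  classical
  refine ((costLE_pointwise (F := F) (fun j => .add (.input (.inl j)) (.input (.inr j)))
    (fun j => .input (.inl j)) s).comp (hG.pair hH)).congr fun x j => ?_
  by_cases h : j ∈ s
  · simp [h, Instr.value, Operand.value]
  · simp [h, Operand.value, hs j h]

theorem CostLE.sub_of_support {N M : ℕ} {G H : (ι → F) → (o → F)} (hG : CostLE N G)
    (hH : CostLE M H) (s : Finset o) (hs : ∀ j ∉ s, ∀ x, H x j = 0) :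
    CostLE (N + M + s.card) fun x j => G x j - H x j := by
  classical
  refine ((costLE_pointwise (F := F) (fun j => .sub (.input (.inl j)) (.input (.inr j)))
    (fun j => .input (.inl j)) s).comp (hG.pair hH)).congr fun x j => ?_
  by_cases h : j ∈ s
  · simp [h, Instr.value, Operand.value]
  · simp [h, Operand.value, hs j h]

theorem CostLE.const_mul_of_support {N : ℕ} {G : (ι → F) → (o → F)} (hG : CostLE N G) (c : o → F)
    (s : Finset o) (hs : ∀ j ∉ s, ∀ x, G x j = 0) :
    CostLE (N + s.card) fun x j => c j * G x j := by
  classical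
  refine ((costLE_pointwise (F := F) (fun j => .mul (.const (c j)) (.input j))
    (fun j => .input j) s).comp hG).congr fun x j => ?_
  by_cases h : j ∈ s
  · simp [h, Instr.value, Operand.value]
  · simp [h, Operand.value, hs j h]

theorem costLE_mul [Fintype o] (σ τ : o → ι) :
    CostLE (Fintype.card o) fun (x : ι → F) j => x (σ j) * x (τ j) := by
  classical
  refine (costLE_pointwise (F := F) (fun j => .mul (.input (σ j)) (.input (τ j)))
    (fun j => .const 0) Finset.univ).congr fun x j => ?_
  simp [Instr.value, Operand.value]

theorem CostLE.sum_of_support {N : κ → ℕ} {G : κ → (ι → F) → (o → F)} (I : Finset κ)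
    (hG : ∀ i ∈ I, CostLE (N i) (G i)) (s : Finset o) (hs : ∀ i ∈ I, ∀ j ∉ s, ∀ x, G i x j = 0) :
    CostLE (∑ i ∈ I, N i + I.card * s.card) fun x j => ∑ i ∈ I, G i x j := by
  classical
  induction I using Finset.induction_on with
  | empty => simpa using costLE_const fun _ => 0
  | insert a I ha ih =>
    refine (((ih (fun i hi => hG i (by simp [hi])) fun i hi => hs i (by simp [hi])).add_of_support
      (hG a (by simp)) s (hs a (by simp))).mono ?_).congr fun x j => ?_
    · rw [Finset.card_insert_of_notMem ha, Finset.sum_insert ha]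
      ring_nf
      omega
    · rw [Finset.sum_insert ha, add_comm]

theorem costLE_family_finset [DecidableEq κ] {N : κ → ℕ} {G : κ → (ι → F) → (o → F)}
    (I : Finset κ) (hG : ∀ i ∈ I, CostLE (N i) (G i)) :
    CostLE (∑ i ∈ I, N i) fun x (p : κ × o) => if p.1 ∈ I then G p.1 x p.2 else 0 := by
  induction I using Finset.induction_on with
  | empty => simpa using costLE_const fun _ => 0
  | insert a I ha ih =>
    refine ((((ih fun i hi => hG i (by simp [hi])).pair (hG a (by simp))).reindex
      fun p => if p.1 = a then Sum.inr p.2 else Sum.inl p).mono ?_).congr ?_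
    · rw [Finset.sum_insert ha, add_comm]
    · rintro x ⟨k, j⟩
      by_cases h : k = a
      · subst h; simp
      · simp [h]

theorem costLE_family [Fintype κ] {N : κ → ℕ} {G : κ → (ι → F) → (o → F)}
    (hG : ∀ i, CostLE (N i) (G i)) :
    CostLE (∑ i, N i) fun x (p : κ × o) => G p.1 x p.2 := by
  classical
  simpa using costLE_family_finset Finset.univ fun i _ => hG i

/-- Each output in `s` is a combination of `|I|` inputs. -/
theorem costLE_sparse {I : Type*} [Fintype I] (s : Finset o) (c : I → o → F) (σ : I → o → ι)
    (p : I → o → Prop) [∀ i, DecidablePred (p i)] (hs : ∀ i, ∀ j ∉ s, ¬ p i j) :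
    CostLE (2 * Fintype.card I * s.card)
      fun (x : ι → F) j => ∑ i, if p i j then c i j * x (σ i j) else 0 := by
  have h : ∀ i ∈ (Finset.univ : Finset I), CostLE (0 + s.card)
      fun (x : ι → F) j => c i j * if p i j then x (σ i j) else 0 := fun i _ =>
    (costLE_reindex_or (p i) (σ i) (0 : F)).const_mul_of_support (c i) s
      fun j hj x => by simp [hs i j hj]
  refine ((CostLE.sum_of_support _ h s fun i _ j hj x => by simp [hs i j hj]).mono ?_).congr ?_
  · simp; ring_nf; omega
  · intro x j
    simp

end Programs

/-! ### Twisted convolutions over an algebra with coordinates -/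

section PolyOf

open Polynomial

variable {R : Type*} [CommRing R]

/-- The polynomial with the coefficients `f 0, …, f (n - 1)`. -/
noncomputable def polyOf (n : ℕ) (f : ℕ → R) : R[X] := ∑ i ∈ Finset.range n, C (f i) * X ^ i

theorem coeff_polyOf (n : ℕ) (f : ℕ → R) (j : ℕ) :
    (polyOf n f).coeff j = if j < n then f j else 0 := by
  simp [polyOf, coeff_C_mul, coeff_X_pow]

theorem degree_polyOf_lt (n : ℕ) (f : ℕ → R) : (polyOf n f).degree < n := by
  rw [degree_lt_iff_coeff_zero]
  intro m hm
  rw [coeff_polyOf, if_neg (by omega)]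

theorem polyOf_coeff_self {n : ℕ} {P : R[X]} (h : P.degree < n) : polyOf n P.coeff = P := by
  ext j
  rw [coeff_polyOf]
  split_ifs with hj
  · rfl
  · exact (coeff_eq_zero_of_degree_lt (h.trans_le (by exact_mod_cast not_lt.1 hj))).symm

theorem polyOf_congr {n : ℕ} {f g : ℕ → R} (h : ∀ i < n, f i = g i) : polyOf n f = polyOf n g :=
  Finset.sum_congr rfl fun i hi => by rw [h i (Finset.mem_range.1 hi)]

theorem polyOf_add_length (n m : ℕ) (f : ℕ → R) :
    polyOf (n + m) f = polyOf n f + X ^ n * polyOf m fun j => f (n + j) := by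
  simp only [polyOf, Finset.sum_range_add, Finset.mul_sum]
  congr 1
  exact Finset.sum_congr rfl fun i _ => by ring

theorem polyOf_mul_length (d N : ℕ) (f : ℕ → R) :
    polyOf (d * N) f = ∑ i ∈ Finset.range d, X ^ (i * N) * polyOf N fun j => f (i * N + j) := by
  induction d with
  | zero => simp [polyOf]
  | succ d ih => rw [Nat.succ_mul, polyOf_add_length, ih, Finset.sum_range_succ]

theorem polyOf_sum {ι : Type*} (s : Finset ι) (N : ℕ) (c : ι → R) (f : ι → ℕ → R) :
    polyOf N (fun j => ∑ i ∈ s, c i * f i j) = ∑ i ∈ s, C (c i) * polyOf N (f i) := by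
  ext j
  simp only [coeff_polyOf, finsetSum_coeff, coeff_C_mul]
  split_ifs <;> simp

theorem polyOf_one (f : ℕ → R) : polyOf 1 f = C (f 0) := by simp [polyOf]

theorem modByMonic_eq_of_dvd {P Q r : R[X]} (hQ : Q.Monic) (h : Q ∣ P - r)
    (hr : r.degree < Q.degree) : P %ₘ Q = r := by
  nontriviality R
  rw [Polynomial.modByMonic_eq_of_dvd_sub hQ h, (modByMonic_eq_self_iff hQ).2 hr]

theorem polyOf_modByMonic_X_pow_sub_C [Nontrivial R] (d : ℕ) {N : ℕ} (hN : N ≠ 0) (θ : R)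
    (f : ℕ → R) :
    polyOf (d * N) f %ₘ (X ^ N - C θ) =
      polyOf N fun j => ∑ i ∈ Finset.range d, θ ^ i * f (i * N + j) := by
  apply modByMonic_eq_of_dvd (monic_X_pow_sub_C θ hN)
  · rw [polyOf_mul_length, polyOf_sum, ← Finset.sum_sub_distrib]
    refine Finset.dvd_sum fun i _ => ?_
    rw [← sub_mul, mul_comm i N, pow_mul, C_pow]
    exact (sub_dvd_pow_sub_pow _ _ i).mul_right _
  · rw [degree_X_pow_sub_C (Nat.pos_of_ne_zero hN)]
    exact degree_polyOf_lt _ _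

end PolyOf

/-- A linear system of coordinates, indexed by `κ`, on the `F`-algebra `R`. Coordinates outside the
finite set `supp` vanish; `dec` may accept other representatives. -/
structure Coordinates (F R κ : Type*) [Field F] [CommRing R] [Algebra F R] where
  enc : R →ₗ[F] κ → F
  dec : (κ → F) → R
  dec_enc : ∀ r, dec (enc r) = r
  supp : Finset κ
  enc_eq_zero : ∀ k ∉ supp, ∀ r, enc r k = 0

section RCost

variable {F R κ ι ι' o : Type*} [Field F] [CommRing R] [Algebra F R] (b : Coordinates F R κ)

/-- The cost of a map between families of elements of `R`, in coordinates. -/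
def RCost (N : ℕ) (φ : (ι → R) → (o → R)) : Prop :=
  CostLE N fun (x : ι × κ → F) (j : o × κ) => b.enc (φ (fun i => b.dec fun k => x (i, k)) j.1) j.2

/-- The cost of the multiplication by a fixed element of `R`. -/
def MulCost (N : ℕ) (c : R) : Prop := CostLE N fun (x : κ → F) => b.enc (c * b.dec x)

variable {b}

theorem RCost.mono {N M : ℕ} {φ : (ι → R) → (o → R)} (h : RCost b N φ) (hNM : N ≤ M) :
    RCost b M φ := CostLE.mono h hNM

theorem RCost.congr {N : ℕ} {φ ψ : (ι → R) → (o → R)} (h : RCost b N φ)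
    (e : ∀ x j, φ x j = ψ x j) : RCost b N ψ := by
  have : φ = ψ := by
    funext x j
    exact e x j
  exact this ▸ h

theorem RCost.comp {N M : ℕ} {φ : (ι → R) → (ι' → R)} {ψ : (ι' → R) → (o → R)}
    (hψ : RCost b M ψ) (hφ : RCost b N φ) : RCost b (N + M) fun x => ψ (φ x) := by
  refine (CostLE.comp hψ hφ).congr fun x j => ?_
  have e : (fun i => b.dec fun k => b.enc (φ (fun i => b.dec fun k => x (i, k)) i) k) =
      φ fun i => b.dec fun k => x (i, k) := funext fun i => b.dec_enc _
  simp only [e]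

theorem RCost.parallel [Fintype ι'] {N : ι' → ℕ} {φ : ι' → (ι → R) → (o → R)}
    (h : ∀ t, RCost b (N t) (φ t)) :
    RCost b (∑ t, N t) fun (x : ι' × ι → R) (p : ι' × o) => φ p.1 (fun i => x (p.1, i)) p.2 := by
  have h' : ∀ t, CostLE (0 + N t) _ := fun t =>
    CostLE.comp (h t) (costLE_reindex fun p : ι × κ => ((t, p.1), p.2))
  refine (((costLE_family h').mono (by simp)).reindex
    fun j : (ι' × o) × κ => (j.1.1, (j.1.2, j.2))).congr fun x j => rfl

/-- Each output in `s` is a combination of `|I|` inputs, with coefficients by which one can multiply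
at cost `m`. -/
theorem RCost.sparse {I : Type*} [Fintype I] (s : Finset o) (c : I → o → R) (σ : I → o → ι)
    {m : ℕ} (hc : ∀ i, ∀ j ∈ s, MulCost b m (c i j)) [DecidablePred (· ∈ s)] :
    RCost b (s.card * Fintype.card I * (m + b.supp.card))
      fun f j => if j ∈ s then ∑ i, c i j * f (σ i j) else 0 := by
  classical
  have h1 : ∀ i ∈ (Finset.univ : Finset I), ∀ j ∈ s, CostLE (0 + m) _ := fun i _ j hj =>
    (hc i j hj).comp (costLE_reindex fun k : κ => (σ i j, k))
  have h2 := fun i hi => costLE_family_finset s (h1 i hi)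
  refine ((CostLE.sum_of_support _ h2 (s ×ˢ b.supp) ?_).mono ?_).congr ?_
  · rintro i - ⟨j, k⟩ hk x
    simp only [Finset.mem_product, not_and] at hk
    by_cases hj : j ∈ s
    · simp [b.enc_eq_zero _ (hk hj)]
    · simp [hj]
  · simp only [Finset.sum_const, Finset.card_univ, Finset.card_product, smul_eq_mul, zero_add]
    exact le_of_eq (by ring)
  · rintro x ⟨j, k⟩
    by_cases hj : j ∈ s <;> simp [hj]

end RCost

section TwistedMul

open Polynomial

variable {F R κ : Type*} [Field F] [CommRing R] [Algebra F R] (b : Coordinates F R κ)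

/-- Multiplication by a fixed polynomial modulo `Q` of polynomials with `n` coefficients in `R`. -/
def ModMulCost (Q : R[X]) (n K : ℕ) : Prop :=
  ∀ g : R[X], RCost b K fun (f : ℕ → R) (j : ℕ) => ((polyOf n f * g) %ₘ Q).coeff j

variable {b}

/-- If `Q` is divisible by the polynomials `X ^ N - θ t`, and the Vandermonde matrix of the `θ t` has
the inverse `W`, then multiplication modulo `Q` reduces to multiplications modulo `X ^ N - θ t`. -/
theorem ModMulCost.of_factors [Nontrivial R] {d N m : ℕ} (hN : N ≠ 0) {Q : R[X]} (hQ : Q.Monic)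
    (hdeg : Q.natDegree = d * N) (θ : Fin d → R) (W : ℕ → Fin d → R)
    (hdvd : ∀ t, X ^ N - C (θ t) ∣ Q)
    (hW : ∀ i < d, ∀ i' < d, ∑ t, W i t * θ t ^ i' = if i = i' then 1 else 0)
    (hθm : ∀ t, ∀ i < d, MulCost b m (θ t ^ i)) (hWm : ∀ i < d, ∀ t, MulCost b m (W i t))
    {K : ℕ} (hK : ∀ t, ModMulCost b (X ^ N - C (θ t)) N K) :
    ModMulCost b Q (d * N) (d * K + 2 * d ^ 2 * N * (m + b.supp.card)) := by
  classical
  intro g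
  -- Reduction modulo all factors, multiplication modulo each of them, and recombination by the
  -- inverse Vandermonde matrix `W`. The index `j` stands for place `j % N` of block `j / N`.
  have h1 : RCost b _ _ := RCost.sparse (b := b) (m := m) (ι := ℕ)
    ((Finset.univ : Finset (Fin d)) ×ˢ Finset.range N)
    (fun (i : Fin d) (j : Fin d × ℕ) => θ j.1 ^ (i : ℕ)) (fun i j => i * N + j.2)
    fun i j _ => hθm _ _ i.2
  have h2 := RCost.parallel fun t => hK t g
  have h3 : RCost b _ _ := RCost.sparse (b := b) (m := m) (ι := Fin d × ℕ) (Finset.range (d * N))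
    (fun (t : Fin d) (j : ℕ) => W (j / N) t) (fun t j => (t, j % N))
    fun t j hj => hWm _ (Nat.div_lt_of_lt_mul (by rwa [mul_comm, ← Finset.mem_range])) _
  refine ((h3.comp (h2.comp h1)).mono ?_).congr ?_
  · simp only [Finset.card_product, Finset.card_univ, Fintype.card_fin, Finset.card_range,
      Finset.sum_const, smul_eq_mul]
    exact le_of_eq (by ring)
  · intro f j
    set h := (polyOf (d * N) f * g) %ₘ Q with hh
    have hdegh : h.degree < (d * N : ℕ) := by
      rw [← hdeg, ← degree_eq_natDegree hQ.ne_zero]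
      exact degree_modByMonic_lt _ hQ
    have key : ∀ t, (polyOf N (fun j => if j < N then
        ∑ i : Fin d, θ t ^ (i : ℕ) * f (i * N + j) else 0) * g) %ₘ (X ^ N - C (θ t)) =
        polyOf N fun j => ∑ i ∈ Finset.range d, θ t ^ i * h.coeff (i * N + j) := by
      intro t
      have hm := monic_X_pow_sub_C (θ t) hN
      rw [← polyOf_modByMonic_X_pow_sub_C d hN, polyOf_coeff_self hdegh]
      have e : polyOf N (fun j => if j < N then
          ∑ i : Fin d, θ t ^ (i : ℕ) * f (i * N + j) else 0) =
          polyOf (d * N) f %ₘ (X ^ N - C (θ t)) := by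
        rw [polyOf_modByMonic_X_pow_sub_C d hN]
        refine polyOf_congr fun j hj => ?_
        rw [if_pos hj, Finset.sum_range]
      rw [e]
      apply Polynomial.modByMonic_eq_of_dvd_sub hm
      have d1 : X ^ N - C (θ t) ∣ polyOf (d * N) f - polyOf (d * N) f %ₘ (X ^ N - C (θ t)) := by
        rw [modByMonic_eq_sub_mul_div, sub_sub_cancel]
        exact dvd_mul_right _ _
      have d2 : X ^ N - C (θ t) ∣ polyOf (d * N) f * g - h := by
        rw [hh, modByMonic_eq_sub_mul_div, sub_sub_cancel]
        exact (hdvd t).mul_right _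
      convert dvd_sub d2 (d1.mul_right g) using 1
      ring
    by_cases hj : j < d * N
    · have hN' : 0 < N := Nat.pos_of_ne_zero hN
      have hjd : j / N < d := Nat.div_lt_of_lt_mul (by rwa [mul_comm])
      rw [if_pos (Finset.mem_range.2 hj)]
      simp only [Finset.mem_product, Finset.mem_univ, true_and, Finset.mem_range, key,
        coeff_polyOf, if_pos (Nat.mod_lt j hN')]
      simp only [Finset.mul_sum]
      rw [Finset.sum_comm]
      have : ∀ i ∈ Finset.range d, ∑ t, W (j / N) t * (θ t ^ i * h.coeff (i * N + j % N)) =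
          if j / N = i then h.coeff (i * N + j % N) else 0 := by
        intro i hi
        simp only [← mul_assoc]
        rw [← Finset.sum_mul, hW _ hjd _ (Finset.mem_range.1 hi)]
        simp
      rw [Finset.sum_congr rfl this, Finset.sum_ite_eq, if_pos (Finset.mem_range.2 hjd)]
      congr 1
      exact Nat.div_add_mod' j N
    · rw [if_neg (by simpa using hj)]
      exact (coeff_eq_zero_of_degree_lt
        (hdegh.trans_le (by exact_mod_cast not_lt.1 hj))).symm

/-- Modulo `X - θ` only the value of `g` at `θ` matters, so a single multiplication by a fixed
element remains. The exponent `1` keeps the shape `X ^ N - C θ` of the recursion. -/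
theorem modMulCost_X_sub_C [Nontrivial R] {K : ℕ} (hK : ∀ r, MulCost b K r) (θ : R) :
    ModMulCost b (X ^ 1 - C θ) 1 K := by
  classical
  intro g
  have h : CostLE (0 + K) _ := (hK (g.eval θ)).comp (costLE_reindex fun k : κ => ((0 : ℕ), k))
  refine ((h.reindex_or_zero (fun j : ℕ × κ => j.1 = 0) fun j => j.2).mono (by omega)).congr ?_
  rintro x ⟨j, k⟩
  simp only [polyOf_one, pow_one, modByMonic_X_sub_C_eq_C_eval, eval_mul, eval_C, coeff_C]
  split_ifs with hj
  · rw [mul_comm]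
  · simp

/-- Multiplication modulo `X ^ (ρ ^ j) - ω ^ (ρ ^ j * e)`, where `ω` is a root of unity of order `M`,
and `ω ^ z` is a principal root of unity of order `ρ`. -/
theorem modMulCost_root [Nontrivial R] {ρ M z m K : ℕ} {ω : R} (hρ : 0 < ρ) (hM : ω ^ M = 1)
    (hM0 : 0 < M) (hρM : ρ ∣ M) (hz : ω ^ (z * ρ) = 1)
    (hsum : ∀ E, ¬ ρ ∣ E → ∑ t ∈ Finset.range ρ, ω ^ (z * E * t) = 0) (hρF : (ρ : F) ≠ 0)
    (hω : ∀ (a : F) (i : ℕ), MulCost b m (a • ω ^ i)) (hK : ∀ r, MulCost b K r) (j : ℕ)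
    (hj : ρ ^ j ∣ ρ * z) (e : ℕ) :
    ModMulCost b (X ^ ρ ^ j - C (ω ^ (ρ ^ j * e))) (ρ ^ j)
      (ρ ^ j * K + j * (2 * ρ * ρ ^ j * (m + b.supp.card))) := by
  induction j generalizing e with
  | zero => simpa using modMulCost_X_sub_C hK (ω ^ e)
  | succ j ih =>
    have hjz : ρ ^ j ∣ z := by
      rw [pow_succ'] at hj
      exact Nat.dvd_of_mul_dvd_mul_left hρ hj
    obtain ⟨z', hz'⟩ := hjz
    have hN : ρ ^ j ≠ 0 := (pow_pos hρ j).ne'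
    -- The `ω ^ a t` are `ρ`-th roots of `ω ^ (ρ ^ (j + 1) * e)` that differ by powers of `ω ^ z`.
    -- Since `ρ ^ j ∣ z`, their exponents are again multiples of `ρ ^ j`, as the induction
    -- hypothesis requires.
    set a : Fin ρ → ℕ := fun t => ρ ^ j * e + z * t with ha
    have ha' : ∀ t, a t = ρ ^ j * (e + z' * t) := fun t => by rw [ha, hz']; ring
    have hpow : ∀ t, (ω ^ a t) ^ ρ = ω ^ (ρ ^ (j + 1) * e) := fun t => by
      have : a t * ρ = ρ ^ (j + 1) * e + z * ρ * t := by
        rw [ha]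
        ring
      rw [← pow_mul, this, pow_add ω (ρ ^ (j + 1) * e), pow_mul ω (z * ρ), hz, one_pow, mul_one]
    have hdvd : ∀ t, X ^ ρ ^ j - C (ω ^ a t) ∣ X ^ ρ ^ (j + 1) - C (ω ^ (ρ ^ (j + 1) * e)) :=
      fun t => by
        have h := sub_dvd_pow_sub_pow (X ^ ρ ^ j) (C (ω ^ a t)) ρ
        rwa [← pow_mul, ← C_pow, hpow, ← pow_succ] at h
    -- The inverse Vandermonde matrix has the entries `ω ^ (-(a t * i)) / ρ`; the exponent `M - 1`
    -- replaces `-1` because `ω ^ M = 1`. Off the diagonal the sums vanish by `hsum`.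
    have hW : ∀ i < ρ, ∀ i' < ρ, ∑ t, ((ρ : F)⁻¹ • ω ^ (a t * i * (M - 1))) * (ω ^ a t) ^ i' =
        if i = i' then 1 else 0 := by
      intro i hi i' hi'
      have e1 : ∀ t : Fin ρ, (ρ : F)⁻¹ • ω ^ (a t * i * (M - 1)) * (ω ^ a t) ^ i' =
          ((ρ : F)⁻¹ • ω ^ (ρ ^ j * e * (i * (M - 1) + i'))) *
            ω ^ (z * (i * (M - 1) + i') * t) := fun t => by
        rw [smul_mul_assoc, smul_mul_assoc, ← pow_mul, ← pow_add, ← pow_add]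
        congr 2
        simp only [ha]
        ring
      rw [Finset.sum_congr rfl fun t _ => e1 t, ← Finset.mul_sum,
        ← Finset.sum_range fun t => ω ^ (z * (i * (M - 1) + i') * t)]
      have hiM : i * (M - 1) + i = M * i := by
        obtain ⟨M', rfl⟩ : ∃ M', M = M' + 1 := ⟨M - 1, by omega⟩
        simp
        ring
      split_ifs with hii
      · subst hii
        have e2 : ∀ x, ω ^ (x * (M * i)) = 1 := fun x => by
          rw [show x * (M * i) = M * (x * i) by ring, pow_mul, hM, one_pow]
        have e3 : ∀ t, ω ^ (z * (M * i) * t) = 1 := fun t => by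
          rw [show z * (M * i) * t = M * (z * i * t) by ring, pow_mul, hM, one_pow]
        rw [hiM, e2, Finset.sum_congr rfl fun t _ => e3 t, Finset.sum_const, Finset.card_range,
          smul_mul_assoc, one_mul, nsmul_one, ← map_natCast (algebraMap F R), Algebra.smul_def,
          ← map_mul, inv_mul_cancel₀ hρF, map_one]
      · rw [hsum, mul_zero]
        intro hd
        apply hii
        have h1 : ρ ∣ (i * (M - 1) + i) := hiM ▸ hρM.mul_right _
        have h2 : (i : ℤ) ≡ i' [ZMOD ρ] := by
          rw [Int.modEq_iff_dvd]
          have h1' : (ρ : ℤ) ∣ ((i * (M - 1) + i : ℕ) : ℤ) := by exact_mod_cast h1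
          have h2' : (ρ : ℤ) ∣ ((i * (M - 1) + i' : ℕ) : ℤ) := by exact_mod_cast hd
          have := dvd_sub h2' h1'
          push_cast at this
          simpa using this
        have := (Int.natCast_modEq_iff.1 h2)
        rwa [Nat.ModEq, Nat.mod_eq_of_lt hi, Nat.mod_eq_of_lt hi'] at this
    have hK' : ∀ t, ModMulCost b (X ^ ρ ^ j - C (ω ^ a t)) (ρ ^ j)
        (ρ ^ j * K + j * (2 * ρ * ρ ^ j * (m + b.supp.card))) := fun t => by
      rw [ha']
      exact ih (Dvd.dvd.trans (pow_dvd_pow _ (Nat.le_succ j)) hj) _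
    have hθm : ∀ t : Fin ρ, ∀ i < ρ, MulCost b m ((ω ^ a t) ^ i) := fun t i _ => by
      rw [← pow_mul]
      simpa using hω 1 (a t * i)
    have h := ModMulCost.of_factors hN (monic_X_pow_sub_C _ (pow_pos hρ _).ne')
      (by rw [natDegree_X_pow_sub_C, pow_succ']) (fun t => ω ^ a t)
      (fun i t => (ρ : F)⁻¹ • ω ^ (a t * i * (M - 1))) hdvd hW hθm (fun i _ t => hω _ _) hK'
    rw [← pow_succ'] at h
    convert h using 1
    ring

end TwistedMul

section MulCostLemmas

variable {F R κ : Type*} [Field F] [CommRing R] [Algebra F R] {b : Coordinates F R κ}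

theorem MulCost.mono {N M : ℕ} {c : R} (h : MulCost b N c) (hNM : N ≤ M) : MulCost b M c :=
  CostLE.mono h hNM

theorem MulCost.add {N M : ℕ} {c d : R} (hc : MulCost b N c) (hd : MulCost b M d) :
    MulCost b (N + M + b.supp.card) (c + d) :=
  (CostLE.add_of_support hc hd b.supp fun j hj x => b.enc_eq_zero j hj _).congr fun x j => by
    simp [add_mul]

theorem MulCost.smul {N : ℕ} {c : R} (hc : MulCost b N c) (a : F) :
    MulCost b (N + b.supp.card) (a • c) :=
  (CostLE.const_mul_of_support hc (fun _ => a) b.supp fun j hj x => b.enc_eq_zero j hj _).congr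
    fun x j => by simp

end MulCostLemmas

/-! ### Residues modulo `X ^ (2 * n) + s * X ^ n + 1`, and cheap multiplication by powers of the
root. -/

section Trinomial

open Polynomial

variable {F : Type*} [Field F]

/-- The cost of multiplying by a fixed polynomial modulo `Q` a polynomial with `n` coefficients. -/
def PolyModCost (Q : F[X]) (n K : ℕ) : Prop :=
  ∀ G : F[X], CostLE K fun (x : ℕ → F) (j : ℕ) => ((polyOf n x * G) %ₘ Q).coeff j

/-- The polynomial `X ^ (2 * n) + s * X ^ n + 1`. -/
noncomputable def trinomialPow (R : Type*) [CommRing R] (s : R) (n : ℕ) : R[X] :=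
  X ^ (2 * n) + (C s * X ^ n + 1)

theorem degree_trinomialPow_aux {R : Type*} [CommRing R] [Nontrivial R] (s : R) {n : ℕ}
    (hn : n ≠ 0) : (C s * X ^ n + 1 : R[X]).degree < ((2 * n : ℕ) : WithBot ℕ) := by
  refine (degree_add_le _ _).trans_lt (max_lt ?_ ?_)
  · exact (degree_C_mul_X_pow_le _ _).trans_lt (by exact_mod_cast (by omega))
  · rw [degree_one]
    exact_mod_cast (by omega)

theorem monic_trinomialPow {R : Type*} [CommRing R] [Nontrivial R] (s : R) {n : ℕ} (hn : n ≠ 0) :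
    (trinomialPow R s n).Monic :=
  monic_X_pow_add (degree_trinomialPow_aux s hn)

theorem natDegree_trinomialPow {R : Type*} [CommRing R] [Nontrivial R] (s : R) {n : ℕ}
    (hn : n ≠ 0) : (trinomialPow R s n).natDegree = 2 * n := by
  rw [trinomialPow, natDegree_add_eq_left_of_degree_lt, natDegree_X_pow]
  rw [degree_X_pow]
  exact degree_trinomialPow_aux s hn

theorem degree_trinomialPow {R : Type*} [CommRing R] [Nontrivial R] (s : R) {n : ℕ}
    (hn : n ≠ 0) : (trinomialPow R s n).degree = (2 * n : ℕ) := by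
  rw [degree_eq_natDegree (monic_trinomialPow s hn).ne_zero, natDegree_trinomialPow s hn]

theorem map_trinomialPow {R S : Type*} [CommRing R] [CommRing S] (φ : R →+* S) (s : R) (n : ℕ) :
    (trinomialPow R s n).map φ = trinomialPow S (φ s) n := by
  simp [trinomialPow]

/-- Reduction modulo the trinomial. -/
theorem polyOf_modByMonic_trinomialPow (s : F) {n : ℕ} (hn : n ≠ 0) (y : ℕ → F) :
    polyOf (4 * n) y %ₘ trinomialPow F s n = polyOf (2 * n) fun j =>
      if j < n then y j - y (2 * n + j) + s * y (3 * n + j)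
      else y j - s * y (n + j) + (s ^ 2 - 1) * y (2 * n + j) := by
  have e1 : polyOf (4 * n) y = polyOf n y + X ^ n * polyOf n (fun j => y (n + j)) +
      X ^ (2 * n) * polyOf n (fun j => y (2 * n + j)) +
      X ^ (3 * n) * polyOf n (fun j => y (3 * n + j)) := by
    rw [polyOf_mul_length]
    simp [Finset.sum_range_succ]
  have e2 : (polyOf (2 * n) fun j =>
      if j < n then y j - y (2 * n + j) + s * y (3 * n + j)
      else y j - s * y (n + j) + (s ^ 2 - 1) * y (2 * n + j)) =
      (polyOf n y - polyOf n (fun j => y (2 * n + j)) +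
        C s * polyOf n (fun j => y (3 * n + j))) +
      X ^ n * (polyOf n (fun j => y (n + j)) - C s * polyOf n (fun j => y (2 * n + j)) +
        C (s ^ 2 - 1) * polyOf n (fun j => y (3 * n + j))) := by
    rw [two_mul, polyOf_add_length]
    congr 1
    · ext j
      simp only [coeff_add, coeff_sub, coeff_C_mul, coeff_polyOf]
      split_ifs <;> simp
    · congr 1
      ext j
      simp only [coeff_add, coeff_sub, coeff_C_mul, coeff_polyOf]
      split_ifs with h1 h2
      · omega
      · rw [show n + n + j = n + (n + j) by ring, show 3 * n + j = n + n + (n + j) by ring]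
      · simp
  -- Modulo the trinomial, `X ^ (2 * n)` is `-s * X ^ n - 1` and `X ^ (3 * n)` is `(s ^ 2 - 1) * X ^
  -- n + s`; the quotient is explicit.
  apply modByMonic_eq_of_dvd (monic_trinomialPow s hn)
  · refine ⟨polyOf n (fun j => y (2 * n + j)) +
      polyOf n (fun j => y (3 * n + j)) * (X ^ n - C s), ?_⟩
    rw [e1, e2, trinomialPow]
    simp only [C_sub, C_pow, C_1]
    ring
  · rw [degree_trinomialPow s hn]
    exact degree_polyOf_lt _ _

theorem costLE_mod_trinomialPow (s : F) {n : ℕ} (hn : n ≠ 0) :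
    CostLE (16 * n) fun (y : ℕ → F) (j : ℕ) => (polyOf (4 * n) y %ₘ trinomialPow F s n).coeff j := by
  have h := costLE_sparse (F := F) (I := Fin 3) (Finset.range (2 * n))
    (fun i j => if j < n then ![1, -1, s] i else ![1, -s, s ^ 2 - 1] i)
    (fun i j => if j < n then ![j, 2 * n + j, 3 * n + j] i else ![j, n + j, 2 * n + j] i)
    (fun _ j => j < 2 * n) (by simp)
  refine (h.mono ?_).congr ?_
  · simp only [Fintype.card_fin, Finset.card_range]
    omega
  · intro y j
    rw [polyOf_modByMonic_trinomialPow s hn, coeff_polyOf]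
    by_cases h1 : j < 2 * n
    · by_cases h2 : j < n
      · simp only [h1, h2, if_true, Fin.sum_univ_three]
        simp
        ring
      · simp only [h1, h2, if_true, if_false, Fin.sum_univ_three]
        simp
        ring
    · simp [h1]

/-- The coordinates of the residue classes modulo the trinomial are the coefficients of the reduced
representative. -/
noncomputable def trinomialCoordinates (s : F) {n : ℕ} (hn : n ≠ 0) :
    Coordinates F (AdjoinRoot (trinomialPow F s n)) ℕ where
  enc :=
    { toFun := fun r j => (AdjoinRoot.modByMonicHom (monic_trinomialPow s hn) r).coeff j
      map_add' := fun r r' => by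
        funext j
        simp
      map_smul' := fun a r => by
        funext j
        simp }
  dec x := AdjoinRoot.mk _ (polyOf (2 * n) x)
  dec_enc r := by
    have h : (AdjoinRoot.modByMonicHom (monic_trinomialPow s hn) r).degree < (2 * n : ℕ) := by
      obtain ⟨P, rfl⟩ := AdjoinRoot.mk_surjective r
      rw [AdjoinRoot.modByMonicHom_mk, ← degree_trinomialPow s hn]
      exact degree_modByMonic_lt _ (monic_trinomialPow s hn)
    change AdjoinRoot.mk _ (polyOf (2 * n)
      (AdjoinRoot.modByMonicHom (monic_trinomialPow s hn) r).coeff) = r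
    rw [polyOf_coeff_self h]
    exact AdjoinRoot.mk_leftInverse _ r
  supp := Finset.range (2 * n)
  enc_eq_zero k hk r := by
    obtain ⟨P, rfl⟩ := AdjoinRoot.mk_surjective r
    change (P %ₘ trinomialPow F s n).coeff k = 0
    refine coeff_eq_zero_of_degree_lt ?_
    refine (degree_modByMonic_lt _ (monic_trinomialPow s hn)).trans_le ?_
    rw [degree_trinomialPow s hn]
    exact_mod_cast not_lt.1 (by simpa using hk)

variable (s : F) {n : ℕ} (hn : n ≠ 0)

theorem trinomialCoordinates_enc_mk (P : F[X]) (j : ℕ) :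
    (trinomialCoordinates s hn).enc (AdjoinRoot.mk _ P) j = (P %ₘ trinomialPow F s n).coeff j := rfl

theorem card_supp_trinomialCoordinates : (trinomialCoordinates s hn).supp.card = 2 * n := by
  simp [trinomialCoordinates]

theorem nontrivial_adjoinRoot_trinomialPow (hn : n ≠ 0) :
    Nontrivial (AdjoinRoot (trinomialPow F s n)) :=
  AdjoinRoot.nontrivial _ (by
    rw [degree_trinomialPow s hn]
    exact_mod_cast (by omega))

theorem mulCost_of_polyModCost {K : ℕ} (h : PolyModCost (trinomialPow F s n) (2 * n) K)
    (r : AdjoinRoot (trinomialPow F s n)) : MulCost (trinomialCoordinates s hn) K r := by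
  obtain ⟨G, rfl⟩ := AdjoinRoot.mk_surjective r
  refine (h G).congr fun x j => ?_
  change _ = (trinomialCoordinates s hn).enc (AdjoinRoot.mk _ G * AdjoinRoot.mk _ _) j
  rw [← map_mul, trinomialCoordinates_enc_mk, mul_comm]

/-- Multiplication by `X ^ e` is a free shift of the coefficients. The shifted polynomial has at
most `4 * n` of them, so one application of `costLE_mod_trinomialPow` is enough. -/
theorem mulCost_root_pow_of_lt {e : ℕ} (he : e < 2 * n) :
    MulCost (trinomialCoordinates s hn) (16 * n) (AdjoinRoot.root (trinomialPow F s n) ^ e) := by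
  have h := (costLE_mod_trinomialPow s hn).comp
    (costLE_reindex_or (fun j => e ≤ j ∧ j < e + 2 * n) (fun j => j - e) (0 : F))
  refine (h.mono (by omega)).congr fun x j => ?_
  change _ = (trinomialCoordinates s hn).enc (_ * AdjoinRoot.mk _ _) j
  rw [← AdjoinRoot.mk_X, ← map_pow, ← map_mul, trinomialCoordinates_enc_mk]
  congr 2
  ext j
  rw [coeff_X_pow_mul', coeff_polyOf, coeff_polyOf]
  split_ifs <;> first | rfl | omega

theorem root_relation :
    (AdjoinRoot.root (trinomialPow F s n) ^ n) ^ 2 =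
      -(algebraMap F _ s) * AdjoinRoot.root (trinomialPow F s n) ^ n - 1 := by
  have h := AdjoinRoot.mk_self (f := trinomialPow F s n)
  rw [show AdjoinRoot.mk (trinomialPow F s n) (trinomialPow F s n) =
    AdjoinRoot.mk (trinomialPow F s n) (X ^ (2 * n) + (C s * X ^ n + 1)) from rfl] at h
  simp only [map_add, map_mul, map_pow, AdjoinRoot.mk_X, map_one, AdjoinRoot.mk_C] at h
  rw [← pow_mul, mul_comm n 2, AdjoinRoot.algebraMap_eq]
  linear_combination h

/-- The `n`-th power of the root satisfies a quadratic equation over `F`, so its powers stay in the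
span of `1` and itself. Hence any power of the root combines two powers with exponents below `2 *
n`, and multiplying by it has linear cost. -/
theorem root_pow_eq (q : ℕ) : ∃ A B : F, (AdjoinRoot.root (trinomialPow F s n) ^ n) ^ q =
    algebraMap F _ A + algebraMap F _ B * AdjoinRoot.root (trinomialPow F s n) ^ n := by
  induction q with
  | zero => exact ⟨1, 0, by simp⟩
  | succ q ih =>
    obtain ⟨A, B, h⟩ := ih
    refine ⟨-B, A - s * B, ?_⟩
    rw [pow_succ, h]
    simp only [map_neg, map_sub, map_mul]
    linear_combination algebraMap F _ B * root_relation s (n := n)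

theorem mulCost_smul_root_pow (a : F) (i : ℕ) :
    MulCost (trinomialCoordinates s hn) (38 * n)
      (a • AdjoinRoot.root (trinomialPow F s n) ^ i) := by
  obtain ⟨A, B, h⟩ := root_pow_eq s (n := n) (i / n)
  have hi : i % n < n := Nat.mod_lt _ (Nat.pos_of_ne_zero hn)
  have e : a • AdjoinRoot.root (trinomialPow F s n) ^ i =
      (a * A) • AdjoinRoot.root (trinomialPow F s n) ^ (i % n) +
        (a * B) • AdjoinRoot.root (trinomialPow F s n) ^ (n + i % n) := by
    conv_lhs => rw [← Nat.div_add_mod i n, pow_add, pow_mul, h]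
    simp only [Algebra.smul_def, map_mul, pow_add]
    ring
  rw [e]
  refine (((mulCost_root_pow_of_lt s hn (by omega : i % n < 2 * n)).smul _).add
    ((mulCost_root_pow_of_lt s hn (by omega : n + i % n < 2 * n)).smul _)).mono ?_
  rw [card_supp_trinomialCoordinates]
  omega

/-- Scaled differences of powers of the root are the entries of the inverse Vandermonde matrix in
`ModMulCost.trinomialPow`. -/
theorem mulCost_smul_root_pow_sub (a : F) (i j : ℕ) :
    MulCost (trinomialCoordinates s hn) (78 * n)
      (a • (AdjoinRoot.root (trinomialPow F s n) ^ i - AdjoinRoot.root (trinomialPow F s n) ^ j)) := by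
  have e : a • (AdjoinRoot.root (trinomialPow F s n) ^ i - AdjoinRoot.root (trinomialPow F s n) ^ j) =
      a • AdjoinRoot.root (trinomialPow F s n) ^ i +
        (-a) • AdjoinRoot.root (trinomialPow F s n) ^ j := by
    rw [smul_sub, neg_smul, sub_eq_add_neg]
  rw [e]
  refine ((mulCost_smul_root_pow s hn _ _).add (mulCost_smul_root_pow s hn _ _)).mono ?_
  rw [card_supp_trinomialCoordinates]
  omega

end Trinomial

/-! ### The recursion of Schönhage and Strassen, in radix `2` and in radix `3`. -/

section SchonhageStrassen

open Polynomial

variable {F : Type*} [Field F]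

/-- The roots of unity used for the multiplication of polynomials: fourth roots for the radix `2`, and
third roots for the radix `3`. -/
theorem principal_root_relations {R : Type*} [CommRing R] {ρ : ℕ} {s : R} {η : R}
    (hρ : (ρ = 2 ∧ s = 0) ∨ (ρ = 3 ∧ s = 1)) (hη : η ^ 2 = -s * η - 1) :
    ∃ z, 0 < z ∧ η ^ (ρ * z) = 1 ∧ η ^ (ρ * z - 1) = -s - η ∧
      ∀ E, ¬ ρ ∣ E → ∑ t ∈ Finset.range ρ, η ^ (z * E * t) = 0 := by
  -- For `ρ = 2`, `η ^ 2 = -1` and `z = 2`; for `ρ = 3`, `η ^ 3 = 1` and `z = 1`. In both cases `η ^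
  -- (ρ * z - 1)` is the inverse of `η`, which is the second root `-s - η` of the quadratic
  -- equation.
  rcases hρ with ⟨rfl, rfl⟩ | ⟨rfl, rfl⟩
  · have h2 : η ^ 2 = -1 := by linear_combination hη
    refine ⟨2, by norm_num, ?_, ?_, fun E hE => ?_⟩
    · linear_combination (η ^ 2 - 1) * h2
    · norm_num
      linear_combination η * h2
    · have h : η ^ (2 * E) = -1 := by
        rw [pow_mul, h2, Odd.neg_one_pow ((Nat.even_or_odd E).resolve_left
          (fun h => hE h.two_dvd))]
      simp [Finset.sum_range_succ, h]
  · have h3 : η ^ 3 = 1 := by linear_combination (η - 1) * hη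
    refine ⟨1, by norm_num, ?_, ?_, fun E hE => ?_⟩
    · linear_combination h3
    · norm_num
      linear_combination hη
    · have hE' : E % 3 = 1 ∨ E % 3 = 2 := by omega
      have h : η ^ E = η ^ (E % 3) := by
        conv_lhs => rw [← Nat.div_add_mod E 3, pow_add, pow_mul, h3, one_pow, one_mul]
      have h' : ∑ t ∈ Finset.range 3, η ^ (1 * E * t) = 1 + η ^ (E % 3) + (η ^ (E % 3)) ^ 2 := by
        simp [Finset.sum_range_succ, pow_mul, h]
      rw [h']
      rcases hE' with hE' | hE' <;> rw [hE']
      · linear_combination hη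
      · linear_combination (η ^ 2 - η + 1) * hη

/-- The trinomial splits as `(X ^ N - η) * (X ^ N - η')` with `η + η' = -s` and `η * η' = 1`. The
squared difference of the roots is the scalar `s ^ 2 - 4`, so the Vandermonde matrix of the two
roots is invertible and its inverse has cheap entries. -/
theorem ModMulCost.trinomialPow {R κ : Type*} [CommRing R] [Nontrivial R] [Algebra F R]
    {b : Coordinates F R κ} {N m K : ℕ} (hN : N ≠ 0) {s : F} (hs : s ^ 2 - 4 ≠ 0) {η η' : R}
    (hη : η ^ 2 = -(algebraMap F R s) * η - 1) (hη' : η' = -(algebraMap F R s) - η)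
    (hm : ∀ i < 2, MulCost b m (η ^ i)) (hm' : ∀ i < 2, MulCost b m (η' ^ i))
    (hm2 : ∀ A : F, MulCost b m (A • (η ^ 2 - 1))) (hm2' : ∀ A : F, MulCost b m (A • (η' ^ 2 - 1)))
    (hd : ∀ A : F, MulCost b m (A • (η - η'))) (hd' : ∀ A : F, MulCost b m (A • (η' - η)))
    (hK : ModMulCost b (X ^ N - C η) N K) (hK' : ModMulCost b (X ^ N - C η') N K) :
    ModMulCost b (trinomialPow R (algebraMap F R s) N) (2 * N)
      (2 * K + 8 * N * (m + b.supp.card)) := by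
  have hδ : algebraMap F R (s ^ 2 - 4)⁻¹ * (algebraMap F R s ^ 2 - 4) = 1 := by
    rw [← map_pow, ← map_ofNat (algebraMap F R), ← map_sub, ← map_mul, inv_mul_cancel₀ hs,
      map_one]
  have hfac : _root_.trinomialPow R (algebraMap F R s) N = (X ^ N - C η) * (X ^ N - C η') := by
    have e1 : C (algebraMap F R s) = -(C η + C η') := by
      rw [hη', ← C_add, ← C_neg]
      congr 1
      ring
    have e2 : C η * C η' = 1 := by
      rw [hη', ← C_mul, ← C_1]
      congr 1
      linear_combination -hη
    rw [_root_.trinomialPow, e1]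
    linear_combination -e2
  have hW : ∀ i < 2, ∀ i' < 2, ∑ t : Fin 2,
      (if i = 0 then ![(s ^ 2 - 4)⁻¹ • (η' ^ 2 - 1), (s ^ 2 - 4)⁻¹ • (η ^ 2 - 1)] t
      else ![(s ^ 2 - 4)⁻¹ • (η - η'), (s ^ 2 - 4)⁻¹ • (η' - η)] t) * ![η, η'] t ^ i' =
      if i = i' then 1 else 0 := by
    intro i hi i' hi'
    interval_cases i <;> interval_cases i' <;>
      simp only [Fin.sum_univ_two, Matrix.cons_val_zero, Matrix.cons_val_one, Algebra.smul_def,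
        if_true, one_ne_zero, if_false, pow_zero, pow_one, zero_ne_one, mul_one, hη']
    · linear_combination hδ + 2 * algebraMap F R (s ^ 2 - 4)⁻¹ * hη
    · linear_combination algebraMap F R (s ^ 2 - 4)⁻¹ * algebraMap F R s * hη
    · ring
    · linear_combination hδ + 4 * algebraMap F R (s ^ 2 - 4)⁻¹ * hη
  have h := ModMulCost.of_factors (b := b) hN (monic_trinomialPow (algebraMap F R s) hN)
    (natDegree_trinomialPow (algebraMap F R s) hN) ![η, η'] _ ?_ hW (m := m) ?_ ?_ (K := K) ?_
  · exact fun g => (h g).mono (le_of_eq (by ring))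
  · intro t
    rw [hfac]
    fin_cases t
    · exact dvd_mul_right _ _
    · exact dvd_mul_left _ _
  · intro t i hi
    fin_cases t
    · exact hm i hi
    · exact hm' i hi
  · intro i _ t
    by_cases hi : i = 0
    · simp only [hi, if_true]
      fin_cases t
      · exact hm2' _
      · exact hm2 _
    · simp only [hi, if_false]
      fin_cases t
      · exact hd _
      · exact hd' _
  · intro t
    fin_cases t
    · exact hK
    · exact hK'

variable {ρ : ℕ} {s : F}

/-- The outer trinomial splits into linear factors over the inner residue ring, because for `a ≤ c`
the inner root supplies all the roots of unity needed. What remains is `2 * ρ ^ a` multiplications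
in the ring, and `O(a)` layers of multiplications by powers of the root. -/
theorem modMulCost_trinomialPow (hρ : (ρ = 2 ∧ s = 0) ∨ (ρ = 3 ∧ s = 1)) (hρF : (ρ : F) ≠ 0)
    {a c K n : ℕ} (hac : a ≤ c) (hn : n ≠ 0) (hnc : n = ρ ^ c)
    (hK : PolyModCost (trinomialPow F s n) (2 * n) K) :
    ModMulCost (trinomialCoordinates s hn)
      (trinomialPow (AdjoinRoot (trinomialPow F s n)) (algebraMap F _ s) (ρ ^ a)) (2 * ρ ^ a)
      (2 * ρ ^ a * K + (960 * a + 640) * (ρ ^ a * n)) := by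
  have := nontrivial_adjoinRoot_trinomialPow s hn
  have hρ0 : 0 < ρ := by rcases hρ with ⟨h, -⟩ | ⟨h, -⟩ <;> omega
  have hρ3 : ρ ≤ 3 := by rcases hρ with ⟨h, -⟩ | ⟨h, -⟩ <;> omega
  have hs4 : s ^ 2 - 4 ≠ 0 := by
    rcases hρ with ⟨rfl, rfl⟩ | ⟨rfl, rfl⟩
    · have := pow_ne_zero 2 hρF
      norm_num at this ⊢
      exact this
    · have := neg_ne_zero.2 hρF
      norm_num at this ⊢
      exact this
  have hsρ : (ρ = 2 ∧ algebraMap F (AdjoinRoot (trinomialPow F s n)) s = 0) ∨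
      (ρ = 3 ∧ algebraMap F (AdjoinRoot (trinomialPow F s n)) s = 1) :=
    hρ.imp (fun h => ⟨h.1, by simp [h.2]⟩) fun h => ⟨h.1, by simp [h.2]⟩
  have hη := root_relation s (n := n)
  obtain ⟨z, hz0, h1, h2, h3⟩ := principal_root_relations hsρ hη
  have hcard := card_supp_trinomialCoordinates s hn
  have hroot := modMulCost_root (b := trinomialCoordinates s hn)
    (ω := AdjoinRoot.root (trinomialPow F s n)) (M := ρ * z * n)
    (z := z * n) (m := 78 * n) (K := K) hρ0 (by rw [mul_comm, pow_mul, h1])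
    (by positivity) ⟨z * n, by ring⟩ (by rw [show z * n * ρ = n * (ρ * z) by ring, pow_mul, h1])
    (fun E hE => by
      rw [← h3 E hE]
      exact Finset.sum_congr rfl fun t _ => by rw [← pow_mul]; ring_nf) hρF
    (fun a i => (mulCost_smul_root_pow s hn a i).mono (by omega))
    (mulCost_of_polyModCost s hn hK) a
    ((pow_dvd_pow ρ hac).trans ⟨ρ * z, by rw [hnc]; ring⟩)
  have hsplit : n = ρ ^ a * ρ ^ (c - a) := by rw [← pow_add, hnc]; congr 1; omega
  have hsub : ∀ (A : F) (i j : ℕ), MulCost (trinomialCoordinates s hn) (78 * n)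
      (A • (AdjoinRoot.root (trinomialPow F s n) ^ i - AdjoinRoot.root (trinomialPow F s n) ^ j)) :=
    mulCost_smul_root_pow_sub s hn
  have hpow : ∀ i : ℕ, MulCost (trinomialCoordinates s hn) (78 * n)
      (AdjoinRoot.root (trinomialPow F s n) ^ i) := fun i => by
    simpa using (mulCost_smul_root_pow s hn 1 i).mono (by omega : 38 * n ≤ 78 * n)
  -- The exponent `ρ ^ a * ρ ^ (c - a)` equals `n`, so the modulus is `X ^ ρ ^ a - η`. The second
  -- instance raises `η` to `ρ * z - 1`, which gives the conjugate root.
  have hroot1 := hroot (ρ ^ (c - a))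
  have hroot2 := hroot (ρ ^ (c - a) * (ρ * z - 1))
  rw [← mul_assoc] at hroot2
  rw [← hsplit] at hroot1 hroot2
  have h := ModMulCost.trinomialPow (pow_pos hρ0 a).ne' hs4 hη rfl (m := 78 * n)
    (fun i _ => by rw [← pow_mul]; exact hpow _)
    (fun i _ => by rw [← h2, ← pow_mul, ← pow_mul]; exact hpow _)
    (fun A => by rw [← pow_mul]; simpa using hsub A (n * 2) 0)
    (fun A => by rw [← h2, ← pow_mul, ← pow_mul]; simpa using hsub A (n * ((ρ * z - 1) * 2)) 0)
    (fun A => by rw [← h2, ← pow_mul]; exact hsub _ _ _)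
    (fun A => by rw [← h2, ← pow_mul]; exact hsub _ _ _) hroot1
    (by rw [← h2, ← pow_mul]; exact hroot2)
  refine fun g => (h g).mono ?_
  rw [hcard]
  have : ρ * (a * (ρ ^ a * n)) ≤ 3 * (a * (ρ ^ a * n)) := Nat.mul_le_mul_right _ hρ3
  nlinarith

/-- The coefficients of the remainder by a polynomial with scalar coefficients have bounded degree if
the dividend has such coefficients. -/
theorem degree_coeff_modByMonic_map_C_lt {A : F[X][X]} {Q : F[X]} (hQ : Q.Monic) {d : ℕ}
    (hA : ∀ i, (A.coeff i).degree < d) (j : ℕ) : ((A %ₘ Q.map C).coeff j).degree < d := by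
  rw [← mem_degreeLT]
  have e : A %ₘ Q.map C = ∑ i ∈ A.support, A.coeff i • ((X ^ i %ₘ Q).map C) := by
    conv_lhs => rw [A.as_sum_support_C_mul_X_pow]
    rw [← modByMonicHom_apply, map_sum]
    refine Finset.sum_congr rfl fun i _ => ?_
    rw [modByMonicHom_apply, ← smul_eq_C_mul, smul_modByMonic, map_modByMonic _ hQ]
    simp
  rw [e, finsetSum_coeff]
  refine Submodule.sum_mem _ fun i _ => ?_
  rw [coeff_smul, coeff_map, smul_eq_mul, mul_comm, ← smul_eq_C_mul]
  exact Submodule.smul_mem _ _ (mem_degreeLT.2 (hA i))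

end SchonhageStrassen

section SchonhageStrassenStep

open Polynomial

variable {F : Type*} [Field F]

/-- Blocks of length `n` have products of degree below `2 * n`, the degree of the inner trinomial.
Therefore computing in the residue ring loses nothing. -/
theorem degree_polyOf_mul_polyOf_coeff_lt (n N M : ℕ) (x y : ℕ → ℕ → F)
    (i : ℕ) :
    ((polyOf N (fun j => polyOf n (x j)) * polyOf M (fun j => polyOf n (y j))).coeff i).degree <
      (2 * n : ℕ) := by
  rw [coeff_mul, ← mem_degreeLT]
  refine Submodule.sum_mem _ fun p _ => ?_
  rw [coeff_polyOf, coeff_polyOf, mem_degreeLT, two_mul, Nat.cast_add]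
  have hbot : (⊥ : WithBot ℕ) < (n : WithBot ℕ) + n := by
    rw [← Nat.cast_add]
    exact WithBot.bot_lt_coe _
  split_ifs
  · rw [degree_mul]
    have h1 := degree_polyOf_lt n (x p.1)
    have h2 := degree_polyOf_lt n (y p.2)
    by_cases h0 : (polyOf n (y p.2)).degree = ⊥
    · rw [h0, WithBot.add_bot]
      exact hbot
    · exact WithBot.add_lt_add_of_lt_of_le h0 h1 h2.le
  all_goals simp

theorem eval_polyOf {R : Type*} [CommRing R] (N : ℕ) (f : ℕ → R) (r : R) :
    (polyOf N f).eval r = ∑ i ∈ Finset.range N, f i * r ^ i := by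
  simp [polyOf, eval_finsetSum]

theorem eval_polyOf_polyOf (N n : ℕ) (x : ℕ → F) :
    (polyOf N (fun j => polyOf n fun i => x (j * n + i))).eval (X ^ n) = polyOf (N * n) x := by
  rw [eval_polyOf, polyOf_mul_length]
  exact Finset.sum_congr rfl fun i _ => by rw [← pow_mul, mul_comm n i, mul_comm]

/-- Collecting the powers of `X` in a polynomial in `X ^ n` whose coefficients have degree less than
`2 * n`. -/
theorem eval_X_pow_of_degree_coeff_lt {n N : ℕ} (hn : n ≠ 0) (hN : N ≠ 0) {H : F[X][X]}
    (hdeg : H.degree < (2 * N : ℕ)) (hc : ∀ j, (H.coeff j).degree < (2 * n : ℕ)) :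
    H.eval (X ^ n) = polyOf (4 * (N * n)) fun t =>
      (if t < 2 * N * n then (H.coeff (t / n)).coeff (t % n) else 0) +
        if t ∈ Finset.Ico n (n + 2 * N * n) then (H.coeff ((t - n) / n)).coeff (n + (t - n) % n)
        else 0 := by
  have hn0 : 0 < n := Nat.pos_of_ne_zero hn
  have e : ∀ i j, i < n → (j * n + i) / n = j ∧ (j * n + i) % n = i := fun i j hi =>
    ⟨by rw [mul_comm, Nat.mul_add_div hn0, Nat.div_eq_of_lt hi, add_zero],
      by rw [mul_comm, Nat.mul_add_mod, Nat.mod_eq_of_lt hi]⟩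
  have e1 : H.eval (X ^ n) = polyOf (2 * N * n) (fun t => (H.coeff (t / n)).coeff (t % n)) +
      X ^ n * polyOf (2 * N * n) (fun t => (H.coeff (t / n)).coeff (n + t % n)) := by
    conv_lhs => rw [← polyOf_coeff_self hdeg]
    rw [eval_polyOf, polyOf_mul_length, polyOf_mul_length, Finset.mul_sum,
      ← Finset.sum_add_distrib]
    refine Finset.sum_congr rfl fun j _ => ?_
    have h1 : polyOf n (fun i => (H.coeff ((j * n + i) / n)).coeff ((j * n + i) % n)) =
        polyOf n (H.coeff j).coeff :=
      polyOf_congr fun i hi => by rw [(e i j hi).1, (e i j hi).2]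
    have h2 : polyOf n (fun i => (H.coeff ((j * n + i) / n)).coeff (n + (j * n + i) % n)) =
        polyOf n fun i => (H.coeff j).coeff (n + i) :=
      polyOf_congr fun i hi => by rw [(e i j hi).1, (e i j hi).2]
    rw [h1, h2]
    conv_lhs => rw [← polyOf_coeff_self (hc j), two_mul, polyOf_add_length]
    ring
  rw [e1]
  ext t
  simp only [coeff_add, coeff_polyOf, coeff_X_pow_mul', Finset.mem_Ico]
  have hNn : n ≤ N * n := Nat.le_mul_of_pos_left n (Nat.pos_of_ne_zero hN)
  have h4 : 2 * N * n = 2 * (N * n) := by ring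
  rw [h4]
  split_ifs <;> first | omega | simp

variable {ρ : ℕ} {s : F}

/-- One level of recursion of the algorithm of Schönhage and Strassen. -/
theorem PolyModCost.trinomialPow_step (hρ : (ρ = 2 ∧ s = 0) ∨ (ρ = 3 ∧ s = 1))
    (hρF : (ρ : F) ≠ 0) {a c K : ℕ} (hac : a ≤ c)
    (hK : PolyModCost (trinomialPow F s (ρ ^ c)) (2 * ρ ^ c) K) :
    PolyModCost (trinomialPow F s (ρ ^ (a + c))) (2 * ρ ^ (a + c))
      (2 * ρ ^ a * K + 960 * (a + 1) * ρ ^ (a + c)) := by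
  have hρ0 : 0 < ρ := by rcases hρ with ⟨h, -⟩ | ⟨h, -⟩ <;> omega
  have hn : ρ ^ c ≠ 0 := (pow_pos hρ0 c).ne'
  have hN : ρ ^ a ≠ 0 := (pow_pos hρ0 a).ne'
  have hmul := modMulCost_trinomialPow hρ hρF hac hn rfl hK
  rw [pow_add]
  generalize ρ ^ c = n at *
  generalize ρ ^ a = N at *
  have hNn : N * n ≠ 0 := mul_ne_zero hN hn
  have hQ := monic_trinomialPow s hNn
  have := nontrivial_adjoinRoot_trinomialPow s hn
  intro G
  set Q := trinomialPow F s (N * n) with hQdef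
  -- The fixed factor, reduced modulo `Q`, is cut into `2 * N` blocks of length `n`, which become
  -- the coefficients of a polynomial in a new variable; that variable stands for `X ^ n`.
  set G' : F[X][X] := polyOf (2 * N) fun j => polyOf n fun i => (G %ₘ Q).coeff (j * n + i) with hG'
  have hG'eval : G'.eval (X ^ n) = G %ₘ Q := by
    rw [hG', eval_polyOf_polyOf, polyOf_coeff_self]
    rw [mul_assoc, ← degree_trinomialPow s hNn]
    exact degree_modByMonic_lt _ hQ
  have hm := hmul (G'.map (AdjoinRoot.mk (trinomialPow F s n)))
  have h1 : CostLE 0 fun (x : ℕ → F) (p : ℕ × ℕ) => if p.2 < n then x (p.1 * n + p.2) else 0 :=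
    costLE_reindex_or _ _ _
  have h2 := CostLE.comp hm h1
  -- Back to one variable: the coefficient polynomials have length `2 * n` but are placed at
  -- distance `n`, so consecutive ones overlap and each place receives at most two terms.
  have hfold := (costLE_reindex_or (fun t : ℕ => t < 2 * N * n)
    (fun t => (t / n, t % n)) (0 : F)).add_of_support
    (costLE_reindex_or (fun t : ℕ => t ∈ Finset.Ico n (n + 2 * N * n))
      (fun t => ((t - n) / n, n + (t - n) % n)) 0) (Finset.Ico n (n + 2 * N * n))
    fun t ht x => if_neg ht
  refine (((costLE_mod_trinomialPow s hNn).comp (hfold.comp h2)).mono ?_).congr fun x t => ?_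
  · rw [Nat.card_Ico, Nat.add_sub_cancel_left]
    nlinarith [Nat.zero_le (N * n)]
  · set P' : F[X][X] := polyOf (2 * N) fun j => polyOf n fun i => x (j * n + i) with hP'
    set H := (P' * G') %ₘ (trinomialPow F s N).map C with hH
    have hQN := monic_trinomialPow s hN
    have hP'eval : P'.eval (X ^ n) = polyOf (2 * (N * n)) x := by
      rw [hP', eval_polyOf_polyOf, mul_assoc]
    have hHdeg : H.degree < (2 * N : ℕ) := by
      rw [← degree_trinomialPow (s : F) hN, ← degree_map_eq_of_injective (C_injective (R := F))
        (trinomialPow F s N)]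
      exact degree_modByMonic_lt _ (hQN.map C)
    have hHc : ∀ j, (H.coeff j).degree < (2 * n : ℕ) :=
      degree_coeff_modByMonic_map_C_lt hQN fun i => degree_polyOf_mul_polyOf_coeff_lt _ _ _ _ _ i
    have hout : ∀ j i, (trinomialCoordinates s hn).enc (((polyOf (2 * N) fun i =>
        (trinomialCoordinates s hn).dec fun k => if k < n then x (i * n + k) else 0) *
        G'.map (AdjoinRoot.mk (trinomialPow F s n)) %ₘ
          trinomialPow _ (algebraMap F _ s) N).coeff j) i = (H.coeff j).coeff i := by
      intro j i
      have e1 : (polyOf (2 * N) fun i => (trinomialCoordinates s hn).dec fun k =>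
          if k < n then x (i * n + k) else 0) = P'.map (AdjoinRoot.mk (trinomialPow F s n)) := by
        ext j
        rw [coeff_map, hP', coeff_polyOf, coeff_polyOf, apply_ite (AdjoinRoot.mk _), map_zero]
        congr 1
        change AdjoinRoot.mk _ (polyOf (2 * n) _) = _
        congr 1
        ext k
        rw [coeff_polyOf, coeff_polyOf]
        split_ifs <;> first | rfl | omega
      have e2 : trinomialPow _ (algebraMap F _ s) N =
          ((trinomialPow F s N).map C).map (AdjoinRoot.mk (trinomialPow F s n)) := by
        rw [map_trinomialPow, map_trinomialPow]
        rfl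
      rw [e1, e2, ← Polynomial.map_mul, ← map_modByMonic _ (hQN.map C), coeff_map,
        trinomialCoordinates_enc_mk, (modByMonic_eq_self_iff (monic_trinomialPow s hn)).2]
      rw [degree_trinomialPow s hn]
      exact hHc j
    simp only [hout]
    rw [← eval_X_pow_of_degree_coeff_lt hn hN hHdeg hHc]
    congr 1
    symm
    apply Polynomial.modByMonic_eq_of_dvd_sub hQ
    have d1 : (trinomialPow F s N).map C ∣ P' * G' - H := by
      rw [hH, modByMonic_eq_sub_mul_div, sub_sub_cancel]
      exact dvd_mul_right _ _
    have d2 : Q ∣ (P' * G' - H).eval (X ^ n) := by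
      convert eval_dvd d1 (x := (X : F[X]) ^ n) using 1
      rw [hQdef, map_trinomialPow, trinomialPow, trinomialPow]
      simp only [eval_add, eval_mul, eval_pow, eval_X, eval_C, eval_one, ← pow_mul]
      ring
    have d3 : Q ∣ G - G %ₘ Q := by
      rw [modByMonic_eq_sub_mul_div, sub_sub_cancel]
      exact dvd_mul_right _ _
    rw [eval_sub, eval_mul, hP'eval, hG'eval] at d2
    convert dvd_add d2 (d3.mul_left (polyOf (2 * (N * n)) x)) using 1
    ring

/-- Multiplication by a fixed polynomial, by sums of all products of coefficients. -/
theorem polyModCost_naive {Q : F[X]} (hQ : Q.Monic) {n : ℕ} (hn : Q.natDegree = n) :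
    PolyModCost Q n (2 * n * n) := by
  intro G
  have h := costLE_sparse (F := F) (I := Fin n) (Finset.range n)
    (fun i j => ((X ^ (i : ℕ) * G) %ₘ Q).coeff j) (fun i _ => (i : ℕ)) (fun _ j => j < n) (by simp)
  refine (h.mono (by simp)).congr fun x j => ?_
  have e : (polyOf n x * G) %ₘ Q = ∑ i : Fin n, x i • ((X ^ (i : ℕ) * G) %ₘ Q) := by
    rw [polyOf, Finset.sum_mul, ← modByMonicHom_apply, map_sum, Finset.sum_range]
    refine Finset.sum_congr rfl fun i _ => ?_
    rw [modByMonicHom_apply, mul_assoc, ← smul_eq_C_mul, smul_modByMonic]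
  rw [e, finsetSum_coeff]
  by_cases hj : j < n
  · simp only [hj, if_true, coeff_smul, smul_eq_mul, mul_comm]
  · simp only [hj, if_false, coeff_smul, smul_eq_mul]
    rw [Finset.sum_const_zero, Finset.sum_eq_zero]
    intro i _
    rw [coeff_eq_zero_of_degree_lt, mul_zero]
    refine (degree_modByMonic_lt _ hQ).trans_le ?_
    rw [degree_eq_natDegree hQ.ne_zero, hn]
    exact_mod_cast not_lt.1 hj

/-- The algorithm of Schönhage and Strassen. -/
theorem polyModCost_trinomialPow (hρ : (ρ = 2 ∧ s = 0) ∨ (ρ = 3 ∧ s = 1))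
    (hρF : (ρ : F) ≠ 0) (k : ℕ) :
    PolyModCost (trinomialPow F s (ρ ^ k)) (2 * ρ ^ k)
      (ρ ^ k * (1960 * ((k - 1) * Nat.clog 2 k) + 40)) := by
  have hρ0 : 0 < ρ := by rcases hρ with ⟨h, -⟩ | ⟨h, -⟩ <;> omega
  have hρ3 : ρ ≤ 3 := by rcases hρ with ⟨h, -⟩ | ⟨h, -⟩ <;> omega
  induction k using Nat.strong_induction_on with
  | _ k ih =>
    by_cases hk : k < 2
    · have hpos := (pow_pos hρ0 k).ne'
      refine fun G => (polyModCost_naive (monic_trinomialPow s hpos)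
        (natDegree_trinomialPow s hpos) G).mono ?_
      have : ρ ^ k ≤ 3 := by
        interval_cases k
        · simp
        · simpa using hρ3
      generalize 1960 * ((k - 1) * Nat.clog 2 k) = u
      nlinarith [Nat.zero_le (ρ ^ k * u), Nat.mul_le_mul_left (ρ ^ k) this]
    · push Not at hk
      -- Here `c` is half of `k`, rounded up as in the recursion of `Nat.clog`, and `2 * (c - 1) ≤ k
      -- - 1`. The constant `1960 = 40 + 2 * 960` is dictated by `k = 2`, where the bound is
      -- attained.
      obtain ⟨a, c, hac, hkac, hck, hc⟩ : ∃ a c, a ≤ c ∧ a + c = k ∧ c < k ∧ c = (k + 2 - 1) / 2 :=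
        ⟨k / 2, (k + 1) / 2, by omega, by omega, by omega, by omega⟩
      have h := PolyModCost.trinomialPow_step hρ hρF hac (ih c hck)
      rw [hkac] at h
      refine fun G => (h G).mono ?_
      have hclog := Nat.clog_of_two_le one_lt_two hk
      rw [← hc] at hclog
      rw [hclog]
      generalize Nat.clog 2 c = l
      have e1 : 2 * ρ ^ a * (ρ ^ c * (1960 * ((c - 1) * l) + 40)) =
          ρ ^ k * (1960 * (2 * (c - 1) * l) + 80) := by
        rw [← hkac, pow_add]
        ring
      rw [e1, mul_comm _ (ρ ^ k), ← mul_add]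
      refine Nat.mul_le_mul_left _ ?_
      have e2 : 2 * (c - 1) * l ≤ (k - 1) * l := Nat.mul_le_mul_right _ (by omega)
      have e3 : (k - 1) * (l + 1) = (k - 1) * l + (k - 1) := by ring
      rw [e3]
      generalize (k - 1) * l = u at *
      generalize 2 * (c - 1) * l = v at *
      omega

end SchonhageStrassenStep

/-! ### Fast multiplication by a fixed polynomial over an arbitrary field. -/

section PolyMul

open Polynomial

variable {F : Type*} [Field F]

variable (F) in
/-- Multiplication of polynomials of degree less than `2 ^ k` by a fixed polynomial of degree at most
`2 ^ k` takes at most `μ * 2 ^ k * (k + 1)` operations. -/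
def PolyMulCost (k μ : ℕ) : Prop :=
  ∀ G : F[X], G.natDegree ≤ 2 ^ k →
    CostLE (μ * 2 ^ k * (k + 1)) fun (x : ℕ → F) (j : ℕ) => (polyOf (2 ^ k) x * G).coeff j

theorem PolyMulCost.mono {k μ μ' : ℕ} (h : PolyMulCost F k μ) (hμ : μ ≤ μ') :
    PolyMulCost F k μ' := fun G hG => (h G hG).mono (by gcongr)

theorem degree_polyOf_mul_lt {n m : ℕ} (x : ℕ → F) {G : F[X]} (hG : G.natDegree ≤ m) :
    (polyOf n x * G).degree < (n + m : ℕ) := by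
  by_cases h0 : G = 0
  · simp only [h0, mul_zero, degree_zero]
    exact WithBot.bot_lt_coe _
  · rw [degree_mul, Nat.cast_add]
    exact WithBot.add_lt_add_of_lt_of_le (degree_ne_bot.2 h0) (degree_polyOf_lt n x)
      (degree_le_of_natDegree_le hG)

theorem polyOf_extend {n m : ℕ} (h : n ≤ m) (x : ℕ → F) :
    polyOf m (fun j => if j < n then x j else 0) = polyOf n x := by
  ext j
  simp only [coeff_polyOf]
  split_ifs <;> first | rfl | omega

/-- For `2 ^ k ≤ ρ ^ t` the product has degree below `2 * ρ ^ t`, so reduction modulo the trinomial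
does not change it. Rounding up to a power of `ρ` costs a factor of at most `3`, whence `5880 = 3 *
1960` and `120 = 3 * 40`. The bound `W` makes the constant uniform in `k`. -/
theorem polyMulCost_of_char_aux {ρ : ℕ} {s : F} (hρ : (ρ = 2 ∧ s = 0) ∨ (ρ = 3 ∧ s = 1))
    (hρF : (ρ : F) ≠ 0) {k W : ℕ} (hk : k ≤ W) :
    PolyMulCost F k (5880 * Nat.clog 2 W + 120) := by
  intro G hG
  have hρ1 : 1 < ρ := by rcases hρ with ⟨h, -⟩ | ⟨h, -⟩ <;> omega
  have hρ3 : ρ ≤ 3 := by rcases hρ with ⟨h, -⟩ | ⟨h, -⟩ <;> omega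
  obtain ⟨t, ht⟩ : ∃ t, t = Nat.clog ρ (2 ^ k) := ⟨_, rfl⟩
  have h1 : 2 ^ k ≤ ρ ^ t := ht ▸ Nat.le_pow_clog hρ1 _
  have htk : t ≤ k := by
    rw [ht]
    exact Nat.clog_le_of_le_pow (Nat.pow_le_pow_left hρ1 k)
  have h2 : ρ ^ t ≤ 3 * 2 ^ k := by
    rcases Nat.eq_zero_or_pos t with h0 | h0
    · rw [h0]
      have := Nat.one_le_two_pow (n := k)
      simp
      omega
    · have : ρ ^ (t - 1) < 2 ^ k := by
        by_contra hcon
        have := Nat.clog_le_of_le_pow (not_lt.1 hcon)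
        omega
      calc ρ ^ t = ρ ^ (t - 1) * ρ := by rw [← pow_succ]; congr 1; omega
        _ ≤ 2 ^ k * 3 := Nat.mul_le_mul this.le hρ3
        _ = 3 * 2 ^ k := mul_comm _ _
  have hpos : ρ ^ t ≠ 0 := by positivity
  have h := (polyModCost_trinomialPow hρ hρF t G).comp
    (costLE_reindex_or (fun j : ℕ => j < 2 ^ k) id (0 : F))
  refine (h.mono ?_).congr fun x j => ?_
  · have hc : Nat.clog 2 t ≤ Nat.clog 2 W := Nat.clog_mono_right 2 (htk.trans hk)
    calc 0 + ρ ^ t * (1960 * ((t - 1) * Nat.clog 2 t) + 40)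
        ≤ 3 * 2 ^ k * (1960 * ((k + 1) * Nat.clog 2 W) + 40 * (k + 1)) := by
          rw [zero_add]
          gcongr
          · omega
          · omega
      _ = _ := by ring
  · simp only [id]
    rw [polyOf_extend (by omega), (modByMonic_eq_self_iff (monic_trinomialPow s hpos)).2]
    rw [degree_trinomialPow s hpos]
    exact (degree_polyOf_mul_lt x hG).trans_le (by exact_mod_cast by omega)

/-- In every field `2` or `3` is invertible: if `2 = 0`, then `3 = 1`. -/
theorem polyMulCost_general {k W : ℕ} (hk : k ≤ W) :
    PolyMulCost F k (5880 * Nat.clog 2 W + 120) := by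
  by_cases h2 : (2 : F) = 0
  · refine polyMulCost_of_char_aux (ρ := 3) (s := 1) (Or.inr ⟨rfl, rfl⟩) ?_ hk
    have : (3 : F) = 1 := by linear_combination h2
    push_cast
    rw [this]
    exact one_ne_zero
  · exact polyMulCost_of_char_aux (ρ := 2) (s := 0) (Or.inl ⟨rfl, rfl⟩) (by exact_mod_cast h2) hk

/-- The coordinates of a field over itself. -/
def unitCoordinates : Coordinates F F Unit where
  enc :=
    { toFun := fun r _ => r
      map_add' := fun _ _ => rfl
      map_smul' := fun _ _ => rfl }
  dec x := x ()
  dec_enc _ := rfl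
  supp := Finset.univ
  enc_eq_zero k hk := absurd (Finset.mem_univ k) hk

theorem mulCost_unitCoordinates (c : F) : MulCost (unitCoordinates (F := F)) 1 c :=
  ((costLE_reindex (F := F) (id : Unit → Unit)).const_mul_of_support (fun _ => c) Finset.univ
    fun j hj => absurd (Finset.mem_univ j) hj).congr fun _ _ => rfl

/-- Multiplication by the fast Fourier transform. -/
theorem polyMulCost_of_isPrimitiveRoot {r k : ℕ} {ζ : F} (hζ : IsPrimitiveRoot ζ (2 ^ r))
    (hk : k + 1 ≤ r) : PolyMulCost F k 18 := by
  intro G hG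
  obtain ⟨r, rfl⟩ : ∃ r', r = r' + 1 := ⟨r - 1, by omega⟩
  have hneg : ζ ^ 2 ^ r = -1 := by
    have h1 : (ζ ^ 2 ^ r) ^ 2 = 1 := by rw [← pow_mul, ← pow_succ, hζ.pow_eq_one]
    have h2 : ζ ^ 2 ^ r ≠ 1 := hζ.pow_ne_one_of_pos_of_lt (by positivity)
      (Nat.pow_lt_pow_right one_lt_two (Nat.lt_succ_self r))
    rcases mul_eq_zero.1 (show (ζ ^ 2 ^ r - 1) * (ζ ^ 2 ^ r + 1) = 0 by linear_combination h1)
      with h | h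
    · exact absurd (sub_eq_zero.1 h) h2
    · exact eq_neg_of_add_eq_zero_left h
  have hF2 : ((2 : ℕ) : F) ≠ 0 := by
    intro h
    have h2 : ζ ^ 2 ^ r ≠ 1 := hζ.pow_ne_one_of_pos_of_lt (by positivity)
      (Nat.pow_lt_pow_right one_lt_two (Nat.lt_succ_self r))
    apply h2
    rw [hneg]
    push_cast at h
    linear_combination -h
  -- With `e = 0` the modulus is `X ^ 2 ^ (k + 1) - 1`, and the product has degree below `2 ^ (k +
  -- 1)`.
  have h := modMulCost_root (b := unitCoordinates (F := F)) (ρ := 2) (M := 2 ^ (r + 1))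
    (z := 2 ^ r) (m := 1) (K := 1) (ω := ζ) two_pos hζ.pow_eq_one (by positivity)
    (Dvd.intro_left _ rfl) (by rw [← pow_succ, hζ.pow_eq_one]) ?_ hF2
    (fun _ _ => mulCost_unitCoordinates _) mulCost_unitCoordinates (k + 1)
    (by rw [← pow_succ']; exact pow_dvd_pow 2 hk) 0 G
  · have h' := (CostLE.reindex (o := ℕ) h fun j => (j, ())).comp
      (costLE_reindex_or (fun p : ℕ × Unit => p.1 < 2 ^ k) (fun p => p.1) (0 : F))
    refine (h'.mono ?_).congr fun x j => ?_
    · rw [show (unitCoordinates (F := F)).supp.card = 1 from rfl]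
      have := Nat.one_le_two_pow (n := k)
      rw [pow_succ]
      nlinarith
    · change ((polyOf (2 ^ (k + 1)) (fun i => if i < 2 ^ k then x i else 0) * G) %ₘ _).coeff j = _
      have hlt : 2 ^ k ≤ 2 ^ (k + 1) := by rw [pow_succ]; omega
      rw [polyOf_extend hlt, (modByMonic_eq_self_iff (monic_X_pow_sub_C _ (by positivity))).2]
      rw [degree_X_pow_sub_C (by positivity)]
      exact (degree_polyOf_mul_lt x hG).trans_le (by rw [pow_succ, mul_two])
  · intro E hE
    have hodd : Odd E := (Nat.even_or_odd E).resolve_left fun h => hE h.two_dvd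
    simp [Finset.sum_range_succ, pow_mul, hneg, hodd.neg_one_pow]

/-- Multiplication in double length by four multiplications. -/
theorem PolyMulCost.double {k μ : ℕ} (h : PolyMulCost F k μ) :
    PolyMulCost F (k + 1) (2 * μ + 8) := by
  intro G hG
  set n := 2 ^ k with hn
  have hn2 : 2 ^ (k + 1) = n + n := by rw [pow_succ, hn]; ring
  -- The upper part has `n + 1` coefficients, since `G` may have degree exactly `2 * n`.
  set g : Fin 2 → F[X] := ![polyOf n G.coeff, polyOf (n + 1) fun j => G.coeff (n + j)] with hg
  have hgdeg : ∀ b, (g b).natDegree ≤ n := by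
    intro b
    rw [natDegree_le_iff_coeff_eq_zero]
    intro j hj
    fin_cases b
    · exact (coeff_polyOf _ _ _).trans (if_neg (by omega))
    · exact (coeff_polyOf _ _ _).trans (if_neg (by omega))
  have hGsplit : G = g 0 + X ^ n * g 1 := by
    conv_lhs => rw [← polyOf_coeff_self (P := G) (n := n + (n + 1))
      ((degree_le_of_natDegree_le hG).trans_lt (by rw [hn2]; exact_mod_cast by omega)),
      polyOf_add_length]
    rfl
  have hterm : ∀ p ∈ (Finset.univ : Finset (Fin 2 × Fin 2)),
      CostLE (0 + μ * n * (k + 1)) fun (x : ℕ → F) (j : ℕ) =>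
        if (p.1 + p.2 : ℕ) * n ≤ j then
          (polyOf n (fun i => x (p.1 * n + i)) * g p.2).coeff (j - (p.1 + p.2 : ℕ) * n) else 0 :=
    fun p _ => ((h (g p.2) (hgdeg _)).comp (costLE_reindex _)).reindex_or_zero _ _
  refine ((CostLE.sum_of_support _ hterm (Finset.range (4 * n)) ?_).mono ?_).congr fun x j => ?_
  · intro p _ j hj x
    rw [Finset.mem_range, not_lt] at hj
    split_ifs with hp
    · refine coeff_eq_zero_of_degree_lt ((degree_polyOf_mul_lt _ (hgdeg p.2)).trans_le ?_)
      have h1 : (p.1 + p.2 : ℕ) * n ≤ 2 * n := Nat.mul_le_mul_right _ (by omega)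
      exact_mod_cast (by omega)
    · rfl
  · simp only [Finset.sum_const, Finset.card_univ, Fintype.card_prod, Fintype.card_fin,
      Finset.card_range, smul_eq_mul, hn2]
    nlinarith [Nat.zero_le (n * k), Nat.zero_le (μ * n)]
  · have hx : polyOf (2 ^ (k + 1)) x = polyOf n x + X ^ n * polyOf n fun i => x (n + i) := by
      rw [hn2, polyOf_add_length]
    have e : polyOf (2 ^ (k + 1)) x * G = ∑ p : Fin 2 × Fin 2,
        polyOf n (fun i => x (p.1 * n + i)) * g p.2 * X ^ ((p.1 + p.2 : ℕ) * n) := by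
      rw [hx, Fintype.sum_prod_type]
      conv_lhs => rw [hGsplit]
      simp only [Fin.sum_univ_two]
      simp
      ring
    rw [e, finsetSum_coeff]
    exact Finset.sum_congr rfl fun p _ => (coeff_mul_X_pow' _ _ _).symm

/-- A root of unity of order `2 ^ r` serves the lengths with `k + 1 ≤ r`, whereas lengths up to `k =
r + 3` can occur. At most four doublings bridge the gap, and the constant grows through `18`, `44`,
`96`, `200`, `408`. -/
theorem polyMulCost_of_supportsFFT {b k : ℕ} (hb : 2 ≤ b) (h : SupportsFFT F b)
    (hk : k ≤ Nat.clog 2 b + 3) : PolyMulCost F k 408 := by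
  obtain ⟨r, ζ, hbr, hζ⟩ := h
  have hr : Nat.clog 2 b ≤ r := Nat.clog_le_of_le_pow hbr
  have hr0 : 0 < Nat.clog 2 b := Nat.clog_pos one_lt_two hb
  have h0 := fun (k : ℕ) (hk : k + 1 ≤ r) => polyMulCost_of_isPrimitiveRoot hζ hk
  have h1 := fun (k : ℕ) (hk : k ≤ r) (hk0 : 0 < k) =>
    (show PolyMulCost F k 44 by
      obtain ⟨k, rfl⟩ : ∃ k', k = k' + 1 := ⟨k - 1, by omega⟩
      exact (h0 k hk).double)
  have h2 := fun (k : ℕ) (hk : k ≤ r + 1) (hk0 : 1 < k) =>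
    (show PolyMulCost F k 96 by
      obtain ⟨k, rfl⟩ : ∃ k', k = k' + 1 := ⟨k - 1, by omega⟩
      exact (h1 k (by omega) (by omega)).double)
  have h3 := fun (k : ℕ) (hk : k ≤ r + 2) (hk0 : 2 < k) =>
    (show PolyMulCost F k 200 by
      obtain ⟨k, rfl⟩ : ∃ k', k = k' + 1 := ⟨k - 1, by omega⟩
      exact (h2 k (by omega) (by omega)).double)
  by_cases c0 : k + 1 ≤ r
  · exact (h0 k c0).mono (by norm_num)
  by_cases c1 : k ≤ r
  · exact (h1 k c1 (by omega)).mono (by norm_num)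
  by_cases c2 : k ≤ r + 1
  · exact (h2 k c2 (by omega)).mono (by norm_num)
  by_cases c3 : k ≤ r + 2
  · exact (h3 k c3 (by omega)).mono (by norm_num)
  obtain ⟨k, rfl⟩ : ∃ k', k = k' + 1 := ⟨k - 1, by omega⟩
  exact (h3 k (by omega) (by omega)).double

theorem clog_two_sub_one_mul_log_two_le (b : ℕ) :
    ((Nat.clog 2 b : ℝ) - 1) * Real.log 2 ≤ Real.log b := by
  by_cases hb : 1 < b
  · have h := Nat.pow_pred_clog_lt_self one_lt_two hb
    have h0 : 0 < Nat.clog 2 b := Nat.clog_pos one_lt_two hb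
    have h' : ((2 : ℝ) ^ (Nat.clog 2 b).pred) ≤ b := by exact_mod_cast h.le
    have h2 := Real.log_le_log (by positivity) h'
    rw [Real.log_pow] at h2
    rwa [Nat.pred_eq_sub_one, Nat.cast_sub h0, Nat.cast_one] at h2
  · rw [Nat.clog_of_right_le_one (not_lt.1 hb)]
    have := Real.log_natCast_nonneg b
    have := Real.log_two_gt_d9
    push_cast
    linarith

theorem log_ge_of_three_le {b : ℕ} (hb : 3 ≤ b) : 1.09 ≤ Real.log b := by
  have h3 : (3 : ℝ) ≤ b := by exact_mod_cast hb
  have h1 := Real.one_sub_inv_le_log_of_pos (x := b / Real.exp 1) (by positivity)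
  rw [Real.log_div (by positivity) (Real.exp_pos 1).ne', Real.log_exp, inv_div] at h1
  have h2 : Real.exp 1 / b ≤ 0.91 := by
    rw [div_le_iff₀ (by positivity)]
    have := Real.exp_one_lt_d9
    linarith
  linarith

/-- Fast multiplication, with the constant of a soft-O. -/
theorem exists_polyMulCost : ∃ C : ℝ, 0 < C ∧ ∀ (F : Type u) [Field F] (b : ℕ), 3 ≤ b →
    ∃ μ : ℕ, 0 < μ ∧ (∀ k ≤ Nat.clog 2 b + 3, PolyMulCost F k μ) ∧
      (μ : ℝ) * Real.log b ^ 2 ≤ C * softLogSq F b := by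
  refine ⟨400000, by norm_num, fun F _ b hb => ?_⟩
  by_cases h : SupportsFFT F b
  · refine ⟨408, by norm_num, fun k hk => polyMulCost_of_supportsFFT (by omega) h hk, ?_⟩
    rw [softLogSq, if_pos h]
    have := sq_nonneg (Real.log b)
    push_cast
    linarith
  · refine ⟨5880 * Nat.clog 2 (Nat.clog 2 b + 3) + 120, by omega,
      fun k hk => polyMulCost_general hk, ?_⟩
    rw [softLogSq, if_neg h]
    have hl2 := Real.log_two_gt_d9
    set x := Real.log b with hx
    have hx1 : 1.09 ≤ x := log_ge_of_three_le hb
    -- As `b ≥ 3`, `log log b` is bounded away from zero, so that additive constants can be absorbed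
    -- into multiples of it.
    have hlx : 1 / 13 ≤ Real.log x := by
      have h1 := Real.one_sub_inv_le_log_of_pos (x := x) (by linarith)
      have h2 : x⁻¹ ≤ 1.09⁻¹ := inv_anti₀ (by norm_num) hx1
      norm_num at h1 h2 ⊢
      linarith
    have hW : ((Nat.clog 2 b + 3 : ℕ) : ℝ) ≤ 8 * x := by
      have h1 := clog_two_sub_one_mul_log_two_le b
      rw [← hx] at h1
      push_cast
      nlinarith
    have hc := clog_two_sub_one_mul_log_two_le (Nat.clog 2 b + 3)
    have hlW : Real.log ((Nat.clog 2 b + 3 : ℕ) : ℝ) ≤ 3 * Real.log 2 + Real.log x := by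
      refine (Real.log_le_log (by positivity) hW).trans ?_
      rw [Real.log_mul (by norm_num) (by linarith), show (8 : ℝ) = 2 ^ 3 by norm_num,
        Real.log_pow]
      norm_num
    have hcl : (Nat.clog 2 (Nat.clog 2 b + 3) : ℝ) ≤ 60 * Real.log x := by
      nlinarith
    push_cast
    rw [mul_comm (x ^ 2), ← mul_assoc]
    refine mul_le_mul_of_nonneg_right ?_ (sq_nonneg x)
    linarith

end PolyMul

/-! ### Divide and conquer: linear substitution, interpolation sums, division and simultaneous
remainders. -/

section DivideAndConquer

open Polynomial

variable {F : Type*} [Field F]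

theorem polyOf_two_pow_succ (k : ℕ) (x : ℕ → F) : polyOf (2 ^ (k + 1)) x =
    polyOf (2 ^ k) x + X ^ 2 ^ k * polyOf (2 ^ k) fun j => x (2 ^ k + j) := by
  rw [pow_succ, mul_two, polyOf_add_length]

theorem natDegree_polyOf_two_pow_lt (k : ℕ) (x : ℕ → F) :
    (polyOf (2 ^ k) x).natDegree < 2 ^ k := by
  by_cases h : polyOf (2 ^ k) x = 0
  · simp [h]
  · exact (natDegree_lt_iff_degree_lt h).2 (degree_polyOf_lt _ _)

/-- Substitution of a linear polynomial. -/
theorem costLE_comp_linear {μ W : ℕ} (hμ : ∀ k ≤ W, PolyMulCost F k μ) (r : F[X])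
    (hr : r.natDegree ≤ 1) (k : ℕ) (hk : k ≤ W) :
    CostLE (2 ^ k * k * ((μ + 1) * (W + 1)))
      fun (x : ℕ → F) (j : ℕ) => ((polyOf (2 ^ k) x).comp r).coeff j := by
  have hdeg : ∀ (k : ℕ) (x : ℕ → F), ((polyOf (2 ^ k) x).comp r).degree < (2 ^ k : ℕ) := by
    intro k x
    refine (degree_le_natDegree).trans_lt ?_
    have h1 := natDegree_comp_le (p := polyOf (2 ^ k) x) (q := r)
    have h2 := natDegree_polyOf_two_pow_lt k x
    have : (polyOf (2 ^ k) x).natDegree * r.natDegree ≤ (polyOf (2 ^ k) x).natDegree * 1 :=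
      Nat.mul_le_mul_left _ hr
    exact_mod_cast (by omega)
  induction k with
  | zero =>
    refine ((costLE_reindex_or (fun j : ℕ => j = 0) (fun _ => 0) (0 : F)).mono (by simp)).congr ?_
    intro x j
    simp [polyOf_one, coeff_C]
  | succ k ih =>
    have ih := ih (by omega)
    -- Writing `P = P₀ + X ^ 2 ^ k * P₁`, one has `P(r) = P₀(r) + r ^ 2 ^ k * P₁(r)`, where the
    -- power of `r` is a fixed polynomial.
    have hG : (r ^ 2 ^ k).natDegree ≤ 2 ^ k :=
      natDegree_pow_le.trans (by simpa using Nat.mul_le_mul_left (2 ^ k) hr)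
    have h1 := (hμ k (by omega) _ hG).comp (ih.comp (costLE_reindex fun j => 2 ^ k + j))
    have h := ih.add_of_support h1 (Finset.range (2 ^ (k + 1))) ?_
    · refine (h.mono ?_).congr fun x j => ?_
      · rw [Finset.card_range, pow_succ]
        have h2 : k + 1 ≤ W + 1 := by omega
        have h3 : 2 ^ k * (μ * (k + 1)) ≤ 2 ^ k * (μ * (W + 1)) := by gcongr
        have h4 : 2 ^ k ≤ 2 ^ k * (W + 1) := Nat.le_mul_of_pos_right _ (by omega)
        nlinarith [Nat.zero_le (2 ^ k * (μ * (W + 1)))]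
      · rw [polyOf_two_pow_succ, add_comp, mul_comp, pow_comp, X_comp, coeff_add]
        rw [polyOf_coeff_self (hdeg k _), mul_comm (r ^ 2 ^ k)]
    · intro j hj x
      refine coeff_eq_zero_of_degree_lt ((degree_polyOf_mul_lt _ hG).trans_le ?_)
      rw [← mul_two, ← pow_succ]
      exact_mod_cast not_lt.1 (by simpa using hj)

theorem Finset.exists_split {ι : Type*} [DecidableEq ι] {s : Finset ι} {n : ℕ}
    (hs : s.card ≤ n + n) :
    ∃ s₁ s₂ : Finset ι, Disjoint s₁ s₂ ∧ s₁ ∪ s₂ = s ∧ s₁.card ≤ n ∧ s₂.card ≤ n := by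
  obtain ⟨t, hts, ht⟩ := Finset.exists_subset_card_eq (min_le_right n s.card)
  refine ⟨t, s \ t, Finset.disjoint_sdiff, Finset.union_sdiff_of_subset hts, by omega, ?_⟩
  rw [Finset.card_sdiff_of_subset hts]
  omega

theorem natDegree_prod_le_card_mul {ι : Type*} {g : ι → F[X]} {d : ℕ} (s : Finset ι)
    (hg : ∀ i ∈ s, (g i).natDegree ≤ d) : (∏ i ∈ s, g i).natDegree ≤ s.card * d :=
  (natDegree_prod_le s g).trans (by simpa using Finset.sum_le_card_nsmul s _ d hg)

theorem degree_sum_mul_prod_lt {ι : Type*} [DecidableEq ι] {g : ι → F[X]} {d : ℕ} (s : Finset ι)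
    (hg : ∀ i ∈ s, (g i).natDegree ≤ d) (x : ι → ℕ → F) :
    (∑ i ∈ s, polyOf d (x i) * ∏ i' ∈ s.erase i, g i').degree < (s.card * d : ℕ) := by
  rw [← mem_degreeLT]
  refine Submodule.sum_mem _ fun i hi => mem_degreeLT.2 ?_
  have h := degree_polyOf_mul_lt (n := d) (x i) (natDegree_prod_le_card_mul (s.erase i)
    fun i' hi' => hg i' (Finset.mem_of_mem_erase hi'))
  refine h.trans_le ?_
  rw [Finset.card_erase_of_mem hi]
  have : 0 < s.card := Finset.card_pos.2 ⟨i, hi⟩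
  have e : d + (s.card - 1) * d = s.card * d := by
    obtain ⟨c, hc⟩ : ∃ c, s.card = c + 1 := ⟨s.card - 1, by omega⟩
    rw [hc]
    simp
    ring
  rw [e]

/-- The merging step of the interpolation tree: the sum over each half is multiplied by the fixed
product over the other half. -/
theorem sum_mul_prod_erase_union {ι R : Type*} [CommRing R] [DecidableEq ι] {s t : Finset ι}
    (h : Disjoint s t) (P g : ι → R) :
    ∑ i ∈ s ∪ t, P i * ∏ i' ∈ (s ∪ t).erase i, g i' =
      (∑ i ∈ s, P i * ∏ i' ∈ s.erase i, g i') * ∏ i ∈ t, g i +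
        (∑ i ∈ t, P i * ∏ i' ∈ t.erase i, g i') * ∏ i ∈ s, g i := by
  rw [Finset.sum_union h, Finset.sum_mul, Finset.sum_mul]
  congr 1
  · refine Finset.sum_congr rfl fun i hi => ?_
    rw [mul_assoc, Finset.erase_union_distrib, Finset.erase_eq_of_notMem (Finset.disjoint_left.1 h hi),
      Finset.prod_union (h.mono_left (Finset.erase_subset _ _))]
  · refine Finset.sum_congr rfl fun i hi => ?_
    rw [mul_assoc, Finset.erase_union_distrib,
      Finset.erase_eq_of_notMem (Finset.disjoint_right.1 h hi),
      Finset.prod_union (h.mono_right (Finset.erase_subset _ _)), mul_comm (∏ i' ∈ t.erase i, g i')]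

/-- The combinations of fixed polynomials that occur in interpolation. -/
theorem costLE_sum_mul_prod {μ W : ℕ} (hμ : ∀ k ≤ W, PolyMulCost F k μ) {ι : Type*}
    [DecidableEq ι] (g : ι → F[X]) (w : ℕ) (j : ℕ) (hj : w + j ≤ W) (s : Finset ι)
    (hs : s.card ≤ 2 ^ j) (hg : ∀ i ∈ s, (g i).natDegree ≤ 2 ^ w) :
    CostLE (2 ^ (w + j) * j * ((μ + 1) * (W + 1))) fun (x : ι × ℕ → F) (o : ℕ) =>
      (∑ i ∈ s, polyOf (2 ^ w) (fun k => x (i, k)) * ∏ i' ∈ s.erase i, g i').coeff o := by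
  induction j generalizing s with
  | zero =>
    by_cases he : s = ∅
    · subst he
      simpa using costLE_const fun _ => 0
    · obtain ⟨i, rfl⟩ : ∃ i, s = {i} := Finset.card_eq_one.1
        (le_antisymm (by simpa using hs) (Finset.card_pos.2 (Finset.nonempty_iff_ne_empty.2 he)))
      refine ((costLE_reindex_or (fun o : ℕ => o < 2 ^ w) (fun o => (i, o)) (0 : F)).mono
        (by simp)).congr fun x o => ?_
      simp [coeff_polyOf]
  | succ j ih =>
    rw [pow_succ, mul_two] at hs
    obtain ⟨s₁, s₂, hd, rfl, hs₁, hs₂⟩ := Finset.exists_split hs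
    have hg₁ : ∀ i ∈ s₁, (g i).natDegree ≤ 2 ^ w := fun i hi =>
      hg i (Finset.mem_union_left _ hi)
    have hg₂ : ∀ i ∈ s₂, (g i).natDegree ≤ 2 ^ w := fun i hi =>
      hg i (Finset.mem_union_right _ hi)
    have hdeg : ∀ t : Finset ι, t.card ≤ 2 ^ j → (∀ i ∈ t, (g i).natDegree ≤ 2 ^ w) →
        (∏ i ∈ t, g i).natDegree ≤ 2 ^ (w + j) := fun t ht hgt =>
      (natDegree_prod_le_card_mul t hgt).trans (by
        rw [add_comm, pow_add]
        exact Nat.mul_le_mul_right _ ht)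
    have hdeg' : ∀ (t : Finset ι) (x : ι × ℕ → F), t.card ≤ 2 ^ j →
        (∀ i ∈ t, (g i).natDegree ≤ 2 ^ w) →
        (∑ i ∈ t, polyOf (2 ^ w) (fun k => x (i, k)) * ∏ i' ∈ t.erase i, g i').degree <
          (2 ^ (w + j) : ℕ) := fun t x ht hgt =>
      (degree_sum_mul_prod_lt t hgt fun i k => x (i, k)).trans_le (by
        rw [add_comm, pow_add]
        exact_mod_cast Nat.mul_le_mul_right _ ht)
    have hG₁ := hdeg s₁ hs₁ hg₁
    have hG₂ := hdeg s₂ hs₂ hg₂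
    have h1 := (hμ (w + j) (by omega) _ hG₂).comp (ih (by omega) s₁ hs₁ hg₁)
    have h2 := (hμ (w + j) (by omega) _ hG₁).comp (ih (by omega) s₂ hs₂ hg₂)
    have h := h1.add_of_support h2 (Finset.range (2 ^ (w + j + 1))) ?_
    · refine (h.mono ?_).congr fun x o => ?_
      · rw [Finset.card_range, ← add_assoc w j 1, pow_succ]
        have h3 : 2 ^ (w + j) * (μ * (w + j + 1)) ≤ 2 ^ (w + j) * (μ * (W + 1)) :=
          Nat.mul_le_mul_left _ (Nat.mul_le_mul_left _ (by omega))
        have h4 : 2 ^ (w + j) ≤ 2 ^ (w + j) * (W + 1) := Nat.le_mul_of_pos_right _ (by omega)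
        nlinarith
      · rw [polyOf_coeff_self (hdeg' s₁ x hs₁ hg₁), polyOf_coeff_self (hdeg' s₂ x hs₂ hg₂),
          ← coeff_add, sum_mul_prod_erase_union hd]
    · intro o ho x
      refine coeff_eq_zero_of_degree_lt ((degree_polyOf_mul_lt _ hG₁).trans_le ?_)
      rw [← mul_two, ← pow_succ]
      exact_mod_cast not_lt.1 (by simpa using ho)

/-- The quotient by a fixed polynomial, by multiplication with an approximation of its inverse. -/
theorem divX_iterate_mul_eq_divByMonic {G P : F[X]} (hG : G.Monic) {N : ℕ}
    (hP : P.degree < N) (hGN : G.natDegree ≤ N) :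
    polyOf N (fun j => (P * (X ^ N /ₘ G)).coeff (N + j)) = P /ₘ G := by
  set H := X ^ N /ₘ G with hH
  have h1 := modByMonic_add_div (X ^ N) G
  have h2 := modByMonic_add_div P G
  have hr0 := degree_modByMonic_lt (X ^ N) hG
  have hr := degree_modByMonic_lt P hG
  rw [← hH] at h1
  set r0 := X ^ N %ₘ G
  set r := P %ₘ G
  set q := P /ₘ G with hq
  have hd := natDegree_divByMonic P hG
  have hdH : H.natDegree = N - G.natDegree := by
    rw [hH, natDegree_divByMonic _ hG, natDegree_X_pow]
  have hqN : q.degree < N := (degree_divByMonic_le P G).trans_lt hP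
  -- The error from replacing the inverse of `G` by `H` has degree below `N`, so the coefficients of
  -- `P * H` from `N` on are those of the quotient `q`.
  have e : P * H = q * X ^ N + (r * H - q * r0) := by
    rw [← h2, ← h1]
    ring
  have hrem : (r * H - q * r0).degree < N := by
    refine (degree_sub_le _ _).trans_lt (max_lt ?_ ?_)
    · by_cases h0 : H = 0
      · simp only [h0, mul_zero, degree_zero]
        exact WithBot.bot_lt_coe _
      · rw [degree_mul]
        refine (WithBot.add_lt_add_right (degree_ne_bot.2 h0) hr).trans_le ?_
        rw [degree_eq_natDegree hG.ne_zero, degree_eq_natDegree h0, hdH]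
        exact_mod_cast (by omega)
    · by_cases h0 : q = 0
      · simp only [h0, zero_mul, degree_zero]
        exact WithBot.bot_lt_coe _
      · rw [degree_mul]
        refine (WithBot.add_lt_add_left (degree_ne_bot.2 h0) hr0).trans_le ?_
        have hP0 : P ≠ 0 := by
          rintro rfl
          exact h0 (by rw [hq, zero_divByMonic])
        have hGP : G.natDegree ≤ P.natDegree := by
          by_contra hcon
          apply h0
          rw [hq, divByMonic_eq_zero_iff hG]
          exact degree_lt_degree (not_le.1 hcon)
        have hPN : P.natDegree < N := (natDegree_lt_iff_degree_lt hP0).2 hP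
        rw [degree_eq_natDegree hG.ne_zero, degree_eq_natDegree h0, hd]
        exact_mod_cast (by omega)
  conv_rhs => rw [← polyOf_coeff_self hqN]
  refine polyOf_congr fun j _ => ?_
  rw [e, coeff_add, add_comm N j, coeff_mul_X_pow,
    coeff_eq_zero_of_degree_lt (hrem.trans_le (by exact_mod_cast Nat.le_add_left _ _)), add_zero]

/-- Reduction modulo a fixed polynomial. -/
theorem costLE_modByMonic {k μ : ℕ} (hμ : PolyMulCost F (k + 1) μ) {G : F[X]} (hG : G.Monic)
    (hGk : G.natDegree ≤ 2 ^ k) :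
    CostLE (2 ^ (k + 1) * (2 * (μ * (k + 2)) + 1)) fun (x : ℕ → F) (j : ℕ) =>
      (polyOf (2 ^ (k + 1)) x %ₘ G).coeff j := by
  have hk : 2 ^ k ≤ 2 ^ (k + 1) := Nat.pow_le_pow_right two_pos (Nat.le_succ k)
  have hH : (X ^ 2 ^ (k + 1) /ₘ G).natDegree ≤ 2 ^ (k + 1) := by
    rw [natDegree_divByMonic _ hG, natDegree_X_pow]
    exact Nat.sub_le _ _
  have h1 := (hμ G (hGk.trans hk)).comp ((hμ _ hH).reindex fun j => 2 ^ (k + 1) + j)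
  have h2 := (costLE_reindex_or (fun j : ℕ => j < 2 ^ k) id (0 : F)).sub_of_support
    (h1.reindex_or_zero (fun j : ℕ => j < 2 ^ k) id) (Finset.range (2 ^ k))
    fun j hj x => if_neg (by simpa using hj)
  refine (h2.mono ?_).congr fun x j => ?_
  · rw [Finset.card_range, show k + 1 + 1 = k + 2 from rfl, mul_assoc]
    nlinarith
  · simp only [id]
    rw [divX_iterate_mul_eq_divByMonic hG (degree_polyOf_lt _ _) (hGk.trans hk)]
    split_ifs with hj
    · rw [modByMonic_eq_sub_mul_div, coeff_sub, coeff_polyOf, if_pos (by omega), mul_comm G]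
    · rw [sub_zero]
      refine (coeff_eq_zero_of_degree_lt ((degree_modByMonic_lt _ hG).trans_le ?_)).symm
      rw [degree_eq_natDegree hG.ne_zero]
      exact_mod_cast (by omega)

/-- Reduction modulo many fixed polynomials. -/
theorem costLE_multi_modByMonic {μ W : ℕ} (hμ : ∀ k ≤ W, PolyMulCost F k μ) {ι : Type*}
    [DecidableEq ι] (g : ι → F[X]) (w : ℕ) (j : ℕ) (hj : w + j + 1 ≤ W) (s : Finset ι)
    (hs : s.card ≤ 2 ^ j) (hg : ∀ i ∈ s, (g i).natDegree ≤ 2 ^ w) (hm : ∀ i ∈ s, (g i).Monic) :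
    CostLE (2 ^ (w + j) * (j + 1) * (4 * ((μ + 1) * (W + 1))))
      fun (x : ℕ → F) (p : ι × ℕ) =>
        if p.1 ∈ s then (polyOf (2 ^ (w + j)) x %ₘ g p.1).coeff p.2 else 0 := by
  induction j generalizing s with
  | zero =>
    by_cases he : s = ∅
    · subst he
      simpa using (costLE_const fun _ => 0).mono (Nat.zero_le _)
    · obtain ⟨i, rfl⟩ : ∃ i, s = {i} := Finset.card_eq_one.1
        (le_antisymm (by simpa using hs) (Finset.card_pos.2 (Finset.nonempty_iff_ne_empty.2 he)))
      have h := (costLE_modByMonic (hμ (w + 1) (by omega)) (hm i (by simp)) (hg i (by simp))).comp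
        (costLE_reindex_or (fun k : ℕ => k < 2 ^ w) id (0 : F))
      refine ((h.reindex_or_zero (fun p : ι × ℕ => p.1 ∈ ({i} : Finset ι)) fun p => p.2).mono
        ?_).congr fun x p => ?_
      · rw [pow_succ, add_zero]
        have h3 : 2 ^ w * (μ * (w + 2)) ≤ 2 ^ w * (μ * (W + 1)) :=
          Nat.mul_le_mul_left _ (Nat.mul_le_mul_left _ (by omega))
        have h4 : 2 ^ w ≤ 2 ^ w * (W + 1) := Nat.le_mul_of_pos_right _ (by omega)
        nlinarith
      · simp only [id]
        rw [polyOf_extend (Nat.pow_le_pow_right two_pos (Nat.le_succ w)), add_zero]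
        split_ifs with hp
        · rw [Finset.mem_singleton.1 hp]
        · rfl
  | succ j ih =>
    rw [pow_succ, mul_two] at hs
    obtain ⟨s₁, s₂, hd, rfl, hs₁, hs₂⟩ := Finset.exists_split hs
    -- Remainder tree: reducing first modulo the product over half of the indices halves the length
    -- and does not affect the remainders modulo the factors.
    have key : ∀ t : Finset ι, t.card ≤ 2 ^ j → (∀ i ∈ t, (g i).natDegree ≤ 2 ^ w) →
        (∀ i ∈ t, (g i).Monic) →
        CostLE (2 ^ (w + j + 1) * (2 * (μ * (w + j + 2)) + 1) +
            2 ^ (w + j) * (j + 1) * (4 * ((μ + 1) * (W + 1))))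
          fun (x : ℕ → F) (p : ι × ℕ) =>
            if p.1 ∈ t then (polyOf (2 ^ (w + j + 1)) x %ₘ g p.1).coeff p.2 else 0 := by
      intro t ht hgt hmt
      have hG : (∏ i ∈ t, g i).natDegree ≤ 2 ^ (w + j) :=
        (natDegree_prod_le_card_mul t hgt).trans (by
          rw [add_comm, pow_add]
          exact Nat.mul_le_mul_right _ ht)
      have hGm : (∏ i ∈ t, g i).Monic := monic_prod_of_monic t g hmt
      refine ((ih (by omega) t ht hgt hmt).comp
        (costLE_modByMonic (hμ (w + j + 1) (by omega)) hGm hG)).congr fun x p => ?_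
      split_ifs with hp
      · rw [polyOf_coeff_self]
        · congr 1
          apply Polynomial.modByMonic_eq_of_dvd_sub (hmt _ hp)
          have h1 : (∏ i ∈ t, g i) ∣ polyOf (2 ^ (w + j + 1)) x -
              polyOf (2 ^ (w + j + 1)) x %ₘ ∏ i ∈ t, g i := by
            rw [modByMonic_eq_sub_mul_div, sub_sub_cancel]
            exact dvd_mul_right _ _
          rw [← neg_sub, dvd_neg]
          exact (Finset.dvd_prod_of_mem g hp).trans h1
        · refine (degree_modByMonic_lt _ hGm).trans_le ?_
          rw [degree_eq_natDegree hGm.ne_zero]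
          exact_mod_cast hG
      · rfl
    have h := ((key s₁ hs₁ (fun i hi => hg i (Finset.mem_union_left _ hi))
      fun i hi => hm i (Finset.mem_union_left _ hi)).pair
      (key s₂ hs₂ (fun i hi => hg i (Finset.mem_union_right _ hi))
      fun i hi => hm i (Finset.mem_union_right _ hi))).reindex
      fun p : ι × ℕ => if p.1 ∈ s₁ then Sum.inl p else Sum.inr p
    refine (h.mono ?_).congr fun x p => ?_
    · rw [← add_assoc w j 1, pow_succ]
      have h3 : 2 ^ (w + j) * (μ * (w + j + 2)) ≤ 2 ^ (w + j) * (μ * (W + 1)) :=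
          Nat.mul_le_mul_left _ (Nat.mul_le_mul_left _ (by omega))
      have h4 : 2 ^ (w + j) ≤ 2 ^ (w + j) * (W + 1) := Nat.le_mul_of_pos_right _ (by omega)
      nlinarith
    · rw [← add_assoc w j 1]
      by_cases h1 : p.1 ∈ s₁
      · simp [h1]
      · simp [h1]

end DivideAndConquer

/-! ### Partial fractions of a product of two shares. -/

section CrossSubspace

open Polynomial

variable {F : Type*} [Field F]

theorem polyOf_coeff_of_natDegree_lt {n : ℕ} {P : F[X]} (h : P.natDegree < n) :
    polyOf n P.coeff = P :=
  polyOf_coeff_self (degree_le_natDegree.trans_lt (by exact_mod_cast h))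

theorem natDegree_C_sub_X_le (c : F) : (C c - X : F[X]).natDegree ≤ 1 :=
  (natDegree_sub_le _ _).trans (by simp)

theorem natDegree_comp_C_sub_X_le (P : F[X]) (c : F) :
    (P.comp (C c - X)).natDegree ≤ P.natDegree :=
  natDegree_comp_le.trans (by simpa using Nat.mul_le_mul_left _ (natDegree_C_sub_X_le c))

theorem natDegree_prod_C_sub_X_pow_le {κ : Type*} (s : Finset κ) (f : κ → F) (r : ℕ) :
    (∏ k ∈ s, (C (f k) - X : F[X]) ^ r).natDegree ≤ s.card * r :=
  natDegree_prod_le_card_mul s fun k _ =>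
    natDegree_pow_le.trans (by simpa using Nat.mul_le_mul_left r (natDegree_C_sub_X_le (f k)))

/-- Partial fractions for the product of a Cauchy-Reed-Solomon code word and of a second one, with the
common denominator cancelled from one factor. The polynomial part has a low degree, up to the product
of the two noise polynomials. -/
theorem exists_polynomial_part {κ : Type*} [Fintype κ] [DecidableEq κ] (f : κ → F) {r e x : ℕ}
    {P Q : κ → F[X]} {za zb : F[X]} (hP : ∀ k, (P k).natDegree ≤ e)
    (hQ : ∀ k, (Q k).natDegree ≤ e) (hPQ : ∀ k k', (P k).natDegree + (Q k').natDegree ≤ r + e)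
    (hza : za.natDegree < x) (hzb : zb.natDegree < x) :
    ∃ Pol : F[X], Pol.degree < (r * (Fintype.card κ - 1) + x + e : ℕ) ∧
      ∀ a, (∀ k, f k - a ≠ 0) →
        (∏ k, (f k - a) ^ r) *
            (∑ k, ((f k - a) ^ r)⁻¹ * (P k).eval (f k - a) + za.eval a) *
            (∑ k, ((f k - a) ^ r)⁻¹ * (Q k).eval (f k - a) + zb.eval a) =
          ∑ k, ∑ i : Fin r, ((f k - a) ^ (r - (i : ℕ)))⁻¹ *
            ((∏ k' ∈ Finset.univ.erase k, (X + C (f k' - f k)) ^ r) * (P k * Q k)).coeff i +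
          Pol.eval a + (∏ k, (f k - a) ^ r) * (za.eval a * zb.eval a) := by
  set N := r * (Fintype.card κ - 1) + x + e with hN
  set T : κ → F[X] := fun k =>
    (∏ k' ∈ Finset.univ.erase k, (X + C (f k' - f k)) ^ r) * (P k * Q k) with hT
  set E : Finset κ → F[X] := fun s => ∏ k ∈ s, (C (f k) - X) ^ r with hE
  set p : κ → F[X] := fun k => (P k).comp (C (f k) - X) with hp
  set q : κ → F[X] := fun k => (Q k).comp (C (f k) - X) with hq
  have hcard : ∀ k : κ, (Finset.univ.erase k).card = Fintype.card κ - 1 := fun k => by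
    rw [Finset.card_erase_of_mem (Finset.mem_univ k), Finset.card_univ]
  have hTdeg : ∀ k, (T k).natDegree < r + N := by
    intro k
    have h1 : (∏ k' ∈ Finset.univ.erase k, (X + C (f k' - f k) : F[X]) ^ r).natDegree ≤
        (Fintype.card κ - 1) * r := by
      rw [← hcard k]
      refine natDegree_prod_le_card_mul _ fun k' _ => natDegree_pow_le.trans ?_
      rw [natDegree_X_add_C, mul_one]
    have h2 := natDegree_mul_le (p := ∏ k' ∈ Finset.univ.erase k, (X + C (f k' - f k) : F[X]) ^ r)
      (q := P k * Q k)
    have h3 := natDegree_mul_le (p := P k) (q := Q k)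
    have h4 := hPQ k k
    rw [mul_comm (Fintype.card κ - 1) r] at h1
    simp only [hT]
    omega
  have hpdeg : ∀ k, (p k).natDegree ≤ (P k).natDegree := fun k => natDegree_comp_C_sub_X_le _ _
  have hqdeg : ∀ k, (q k).natDegree ≤ (Q k).natDegree := fun k => natDegree_comp_C_sub_X_le _ _
  have hEdeg : ∀ s, (E s).natDegree ≤ s.card * r := fun s => natDegree_prod_C_sub_X_pow_le s f r
  -- The polynomial part collects the coefficients of `T k` from degree `r` on (equal poles), the
  -- terms with distinct poles `k ≠ k'`, whose denominators cancel against the common factor, and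
  -- the products of a data term with a noise polynomial.
  refine ⟨∑ k, (polyOf N fun j => (T k).coeff (r + j)).comp (C (f k) - X) +
    ∑ k, ∑ k' ∈ Finset.univ.erase k, p k * q k' * E ((Finset.univ.erase k).erase k') +
    ∑ k, p k * E (Finset.univ.erase k) * zb + ∑ k, q k * E (Finset.univ.erase k) * za, ?_, ?_⟩
  · rw [← mem_degreeLT]
    have hlt : ∀ G : F[X], G.natDegree < N → G ∈ degreeLT F N := fun G hG =>
      mem_degreeLT.2 (degree_le_natDegree.trans_lt (by exact_mod_cast hG))
    refine Submodule.add_mem _ (Submodule.add_mem _ (Submodule.add_mem _ ?_ ?_) ?_) ?_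
    · refine Submodule.sum_mem _ fun k _ => hlt _ ?_
      refine (natDegree_comp_C_sub_X_le _ _).trans_lt ?_
      by_cases h0 : (polyOf N fun j => (T k).coeff (r + j)) = 0
      · rw [h0, natDegree_zero]
        omega
      · exact (natDegree_lt_iff_degree_lt h0).2 (degree_polyOf_lt _ _)
    · refine Submodule.sum_mem _ fun k _ => Submodule.sum_mem _ fun k' hk' => hlt _ ?_
      have h1 := natDegree_mul_le (p := p k * q k') (q := E ((Finset.univ.erase k).erase k'))
      have h2 := natDegree_mul_le (p := p k) (q := q k')
      have h3 := hEdeg ((Finset.univ.erase k).erase k')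
      rw [Finset.card_erase_of_mem hk', hcard] at h3
      have h4 : 0 < Fintype.card κ - 1 := by
        rw [← hcard k]
        exact Finset.card_pos.2 ⟨k', hk'⟩
      have h5 : (Fintype.card κ - 1 - 1) * r + r = r * (Fintype.card κ - 1) := by
        obtain ⟨c, hc⟩ : ∃ c, Fintype.card κ - 1 = c + 1 := ⟨_, (Nat.sub_add_cancel h4).symm⟩
        rw [hc]
        simp
        ring
      have := hpdeg k
      have := hqdeg k'
      have := hPQ k k'
      omega
    · refine Submodule.sum_mem _ fun k _ => hlt _ ?_
      have h1 := natDegree_mul_le (p := p k * E (Finset.univ.erase k)) (q := zb)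
      have h2 := natDegree_mul_le (p := p k) (q := E (Finset.univ.erase k))
      have h3 := hEdeg (Finset.univ.erase k)
      rw [hcard, mul_comm] at h3
      have := hpdeg k
      have := hP k
      omega
    · refine Submodule.sum_mem _ fun k _ => hlt _ ?_
      have h1 := natDegree_mul_le (p := q k * E (Finset.univ.erase k)) (q := za)
      have h2 := natDegree_mul_le (p := q k) (q := E (Finset.univ.erase k))
      have h3 := hEdeg (Finset.univ.erase k)
      rw [hcard, mul_comm] at h3
      have := hqdeg k
      have := hQ k
      omega
  · intro a ha
    set v : κ → F := fun k => (f k - a) ^ r with hv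
    have hv0 : ∀ k, v k ≠ 0 := fun k => pow_ne_zero _ (ha k)
    have hEe : ∀ s, (E s).eval a = ∏ k ∈ s, v k := fun s => by
      simp [hE, eval_prod, hv]
    have hpe : ∀ k, (p k).eval a = (P k).eval (f k - a) := fun k => by simp [hp]
    have hqe : ∀ k, (q k).eval a = (Q k).eval (f k - a) := fun k => by simp [hq]
    have hD : ∀ k, ∏ k, v k = v k * ∏ k' ∈ Finset.univ.erase k, v k' := fun k =>
      (Finset.mul_prod_erase _ _ (Finset.mem_univ k)).symm
    have hD' : ∀ k, ∀ k' ∈ Finset.univ.erase k,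
        ∏ k, v k = v k * (v k' * ∏ k'' ∈ (Finset.univ.erase k).erase k', v k'') := fun k k' hk' => by
      rw [Finset.mul_prod_erase _ _ hk', Finset.mul_prod_erase _ _ (Finset.mem_univ k)]
    -- For equal poles one factor `v k` remains in the denominator. The coefficients of `T k` below
    -- `r` give the principal part, and the others are divisible by `v k`.
    have hdiag : ∀ k, (∏ k, v k) * ((v k)⁻¹ * (P k).eval (f k - a)) *
        ((v k)⁻¹ * (Q k).eval (f k - a)) =
        ∑ i : Fin r, ((f k - a) ^ (r - (i : ℕ)))⁻¹ * (T k).coeff i +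
          (polyOf N fun j => (T k).coeff (r + j)).eval (f k - a) := by
      intro k
      have e1 : (T k).eval (f k - a) = (∏ k' ∈ Finset.univ.erase k, v k') *
          ((P k).eval (f k - a) * (Q k).eval (f k - a)) := by
        simp only [hT, eval_mul, eval_prod, eval_pow, eval_add, eval_X, eval_C, hv]
        congr 1
        exact Finset.prod_congr rfl fun k' _ => by ring
      have e2 : (T k).eval (f k - a) = ∑ i : Fin r, (T k).coeff i * (f k - a) ^ (i : ℕ) +
          v k * (polyOf N fun j => (T k).coeff (r + j)).eval (f k - a) := by
        conv_lhs => rw [← polyOf_coeff_of_natDegree_lt (hTdeg k), polyOf_add_length]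
        rw [eval_add, eval_mul, eval_pow, eval_X, eval_polyOf, Finset.sum_range]
      have e3 : ∀ i : Fin r, (v k)⁻¹ * ((T k).coeff i * (f k - a) ^ (i : ℕ)) =
          ((f k - a) ^ (r - (i : ℕ)))⁻¹ * (T k).coeff i := fun i => by
        have : v k = (f k - a) ^ (r - (i : ℕ)) * (f k - a) ^ (i : ℕ) := by
          rw [← pow_add, Nat.sub_add_cancel i.2.le]
        rw [this]
        have := ha k
        field_simp
      have e4 : (∏ k, v k) * ((v k)⁻¹ * (P k).eval (f k - a)) * ((v k)⁻¹ * (Q k).eval (f k - a)) =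
          (v k)⁻¹ * (T k).eval (f k - a) := by
        rw [e1, hD k]
        have := hv0 k
        field_simp
      rw [e4, e2, mul_add, Finset.mul_sum, Finset.sum_congr rfl fun i _ => e3 i,
        inv_mul_cancel_left₀ (hv0 k)]
    have hoff : ∀ k, ∀ k' ∈ Finset.univ.erase k, (∏ k, v k) * ((v k)⁻¹ * (P k).eval (f k - a)) *
        ((v k')⁻¹ * (Q k').eval (f k' - a)) =
        (P k).eval (f k - a) * (Q k').eval (f k' - a) *
          ∏ k'' ∈ (Finset.univ.erase k).erase k', v k'' := by
      intro k k' hk'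
      rw [hD' k k' hk']
      have := hv0 k
      have := hv0 k'
      field_simp
    have hone : ∀ (k : κ) (c : F), (∏ k, v k) * ((v k)⁻¹ * c) =
        c * ∏ k' ∈ Finset.univ.erase k, v k' := fun k c => by
      rw [hD k]
      have := hv0 k
      field_simp
    have expand : (∏ k, v k) * (∑ k, (v k)⁻¹ * (P k).eval (f k - a) + za.eval a) *
          (∑ k, (v k)⁻¹ * (Q k).eval (f k - a) + zb.eval a) =
        ∑ k, ∑ k', (∏ k, v k) * ((v k)⁻¹ * (P k).eval (f k - a)) *
          ((v k')⁻¹ * (Q k').eval (f k' - a)) +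
        ∑ k, (∏ k, v k) * ((v k)⁻¹ * (P k).eval (f k - a)) * zb.eval a +
        ∑ k, (∏ k, v k) * ((v k)⁻¹ * (Q k).eval (f k - a)) * za.eval a +
        (∏ k, v k) * (za.eval a * zb.eval a) := by
      rw [← Finset.sum_mul, ← Finset.sum_mul, ← Finset.mul_sum, ← Finset.mul_sum]
      simp only [← Finset.mul_sum]
      rw [← Finset.sum_mul, ← Finset.mul_sum]
      ring
    rw [expand]
    simp only [hone _ (eval _ _)]
    have hsplit : ∀ k, ∑ k', (P k).eval (f k - a) * (∏ k' ∈ Finset.univ.erase k, v k') *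
          ((v k')⁻¹ * (Q k').eval (f k' - a)) =
        ∑ i : Fin r, ((f k - a) ^ (r - (i : ℕ)))⁻¹ * (T k).coeff i +
          (polyOf N fun j => (T k).coeff (r + j)).eval (f k - a) +
        ∑ k' ∈ Finset.univ.erase k, (P k).eval (f k - a) * (Q k').eval (f k' - a) *
          ∏ k'' ∈ (Finset.univ.erase k).erase k', v k'' := by
      intro k
      rw [← Finset.add_sum_erase _ _ (Finset.mem_univ k), ← hone, hdiag]
      congr 1
      exact Finset.sum_congr rfl fun k' hk' => by rw [hoff k k' hk']
    simp only [hsplit, Finset.sum_add_distrib, eval_add, eval_finsetSum, eval_mul, eval_comp,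
      eval_sub, eval_C, eval_X, hEe, hpe, hqe]
    ring

end CrossSubspace

/-! ### Decoding by interpolation and local expansion. -/

section Decoding

open Polynomial

variable {F : Type*} [Field F]

/-- A polynomial with nonzero constant term is coprime to `X ^ r`, so Bézout gives an inverse;
reducing it modulo `X ^ r` bounds its degree. Such inverses are the fixed corrections of the
decoder. -/
theorem exists_inverse_mod_X_pow {H : F[X]} (hH : H.coeff 0 ≠ 0) (r : ℕ) :
    ∃ G : F[X], G.natDegree ≤ r ∧ X ^ r ∣ H * G - 1 := by
  have hc : IsCoprime H (X ^ r) := by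
    refine IsCoprime.pow_right ?_
    rw [isCoprime_comm, Polynomial.irreducible_X.coprime_iff_not_dvd, X_dvd_iff]
    exact hH
  obtain ⟨a, b, hab⟩ := hc
  have hm : (X ^ r : F[X]).Monic := monic_X_pow r
  refine ⟨a %ₘ X ^ r, ?_, ?_⟩
  · have := natDegree_modByMonic_le a hm
    rwa [natDegree_X_pow] at this
  · rw [modByMonic_eq_sub_mul_div]
    exact ⟨-b - H * (a /ₘ X ^ r), by linear_combination hab⟩

theorem eval_linear_product_ne_zero {κ : Type*} (s : Finset κ) (f : κ → F) (r : ℕ) (c : F)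
    (h : ∀ k ∈ s, f k ≠ c) : (∏ k ∈ s, (X + C (f k - c) : F[X]) ^ r).coeff 0 ≠ 0 := by
  rw [coeff_zero_eq_eval_zero, eval_prod]
  refine Finset.prod_ne_zero_iff.2 fun k hk => ?_
  rw [eval_pow, eval_add, eval_X, eval_C, zero_add]
  exact pow_ne_zero _ (sub_ne_zero.2 (h k hk))

variable {ι κ : Type*} [Fintype ι] [DecidableEq ι] [Fintype κ]

/-- The polynomial with the values `y s * ∏ k, (f k - α s) ^ r` at the points `α s`. -/
noncomputable def scaledInterpolation (f : κ → F) (α : ι → F) (r : ℕ) (y : ι → F) : F[X] :=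
  ∑ s, polyOf 1 (fun _ => ((∏ k, (f k - α s) ^ r) *
    (∏ s' ∈ Finset.univ.erase s, (α s - α s'))⁻¹) * y s) *
      ∏ s' ∈ Finset.univ.erase s, (X - C (α s'))

theorem degree_scaledInterpolation_lt (f : κ → F) (α : ι → F) (r : ℕ) (y : ι → F) :
    (scaledInterpolation f α r y).degree < (Fintype.card ι : ℕ) := by
  have h := degree_sum_mul_prod_lt (g := fun s : ι => X - C (α s)) (d := 1) Finset.univ
    (fun s _ => (natDegree_X_sub_C _).le) fun s _ => ((∏ k, (f k - α s) ^ r) *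
    (∏ s' ∈ Finset.univ.erase s, (α s - α s'))⁻¹) * y s
  rwa [mul_one] at h

theorem eval_scaledInterpolation (f : κ → F) {α : ι → F} (hα : Function.Injective α) (r : ℕ)
    (y : ι → F) (s : ι) :
    (scaledInterpolation f α r y).eval (α s) = (∏ k, (f k - α s) ^ r) * y s := by
  rw [scaledInterpolation, eval_finsetSum, Finset.sum_eq_single s]
  · rw [polyOf_one, eval_mul, eval_C, eval_prod]
    simp only [eval_sub, eval_X, eval_C]
    have : ∏ s' ∈ Finset.univ.erase s, (α s - α s') ≠ 0 :=
      Finset.prod_ne_zero_iff.2 fun s' hs' =>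
        sub_ne_zero.2 fun h => (Finset.ne_of_mem_erase hs') (hα h).symm
    field_simp
  · intro s' _ hs'
    rw [eval_mul, eval_prod]
    have h : ∏ j ∈ Finset.univ.erase s', eval (α s) (X - C (α j)) = 0 :=
      Finset.prod_eq_zero (Finset.mem_erase.2 ⟨hs'.symm, Finset.mem_univ s⟩) (by simp)
    rw [h, mul_zero]
  · simp

/-- The local expansion at `f k` of the function with the values `y`, corrected by the factor `G`. -/
noncomputable def localExpansion (f : κ → F) (α : ι → F) (r : ℕ) (G : F[X]) (y : ι → F) (k : κ) :
    F[X] :=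
  ((scaledInterpolation f α r y %ₘ (X - C (f k)) ^ r).comp (C (f k) - X)) * G

/-- Clearing denominators turns `y` into the values of a polynomial `Np` of degree below the number
of points, so interpolation recovers `Np`. In the local variable at `f k`, every summand of `Np`
except the `k`-th is divisible by `X ^ r`. The `k`-th one is the truncation of `c k * W k` times the
product of the other denominators, and `G` inverts the known factor modulo `X ^ r`. -/
theorem coeff_localExpansion [DecidableEq κ] {f : κ → F} {α : ι → F}
    (hα : Function.Injective α) (hfα : ∀ k s, f k ≠ α s) {r M : ℕ} {c W : κ → F[X]} {Pol : F[X]}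
    (hPol : Pol.degree < M) (hM : M + Fintype.card κ * r ≤ Fintype.card ι) {y : ι → F}
    (hy : ∀ s, y s = ∑ k, ∑ i : Fin r, ((f k - α s) ^ (r - (i : ℕ)))⁻¹ * (c k * W k).coeff i +
      Pol.eval (α s)) {k : κ} {G : F[X]}
    (hG : X ^ r ∣ (c k * ∏ k' ∈ Finset.univ.erase k, (X + C (f k' - f k)) ^ r) * G - 1)
    {i : ℕ} (hi : i < r) : (localExpansion f α r G y k).coeff i = (W k).coeff i := by
  classical
  have hr : 0 < r := by omega
  set U : κ → F[X] := fun k => C (f k) - X with hU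
  set L : κ → F[X] := fun k => polyOf r (c k * W k).coeff with hL
  set E : κ → F[X] := fun k => ∏ k' ∈ Finset.univ.erase k, U k' ^ r with hE
  set Np : F[X] := ∑ k, (L k).comp (U k) * E k + Pol * ∏ k, U k ^ r with hNp
  have hUU : ∀ k', (U k').comp (U k) = X + C (f k' - f k) := fun k' => by
    simp [hU]
    ring
  have hcard : ∀ k : κ, (Finset.univ.erase k).card = Fintype.card κ - 1 := fun k => by
    rw [Finset.card_erase_of_mem (Finset.mem_univ k), Finset.card_univ]
  have hκ : 0 < Fintype.card κ := Fintype.card_pos_iff.2 ⟨k⟩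
  have hNdeg : Np.degree < (Fintype.card ι : ℕ) := by
    rw [← mem_degreeLT]
    refine Submodule.add_mem _ (Submodule.sum_mem _ fun k _ => mem_degreeLT.2 ?_)
      (mem_degreeLT.2 ?_)
    · have h1 : ((L k).comp (U k)).natDegree < r := by
        refine (natDegree_comp_C_sub_X_le _ _).trans_lt ?_
        by_cases h0 : L k = 0
        · rwa [h0, natDegree_zero]
        · exact (natDegree_lt_iff_degree_lt h0).2 (degree_polyOf_lt _ _)
      have h2 : (E k).natDegree ≤ (Fintype.card κ - 1) * r := by
        rw [← hcard k]
        exact natDegree_prod_C_sub_X_pow_le _ _ _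
      have h3 := natDegree_mul_le (p := (L k).comp (U k)) (q := E k)
      have h4 : (Fintype.card κ - 1) * r + r = Fintype.card κ * r := by
        obtain ⟨d, hd⟩ : ∃ d, Fintype.card κ = d + 1 := ⟨_, (Nat.sub_add_cancel hκ).symm⟩
        rw [hd]
        simp
        ring
      exact degree_le_natDegree.trans_lt (by exact_mod_cast (by omega))
    · have h1 := degree_polyOf_mul_lt (n := M) Pol.coeff
        (natDegree_prod_C_sub_X_pow_le Finset.univ f r)
      rw [polyOf_coeff_self hPol, Finset.card_univ] at h1
      exact h1.trans_le (by exact_mod_cast hM)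
  have hEq : scaledInterpolation f α r y = Np := by
    refine eq_of_degrees_lt_of_eval_finset_eq (Finset.univ.image α) ?_ ?_ ?_
    · rw [Finset.card_image_of_injective _ hα]
      exact degree_scaledInterpolation_lt _ _ _ _
    · rw [Finset.card_image_of_injective _ hα]
      exact hNdeg
    · intro a ha
      obtain ⟨s, -, rfl⟩ := Finset.mem_image.1 ha
      rw [eval_scaledInterpolation f hα, hy, hNp, eval_add, eval_mul, eval_finsetSum, mul_add,
        Finset.mul_sum]
      congr 1
      · refine Finset.sum_congr rfl fun k _ => ?_
        have hne : f k - α s ≠ 0 := sub_ne_zero.2 (hfα k s)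
        rw [eval_mul, eval_comp, hL, eval_polyOf, hE, eval_prod,
          ← Finset.mul_prod_erase _ _ (Finset.mem_univ k), Finset.sum_range]
        simp only [hU, eval_pow, eval_sub, eval_C, eval_X]
        rw [mul_right_comm, Finset.mul_sum]
        congr 1
        refine Finset.sum_congr rfl fun i _ => ?_
        have : (f k - α s) ^ r = (f k - α s) ^ (r - (i : ℕ)) * (f k - α s) ^ (i : ℕ) := by
          rw [← pow_add, Nat.sub_add_cancel i.2.le]
        rw [this]
        field_simp
      · rw [eval_prod, mul_comm]
        simp [hU]
  have hUkk : (U k).comp (U k) = X := by rw [hUU]; simp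
  have hcompE : ∀ k', k' ≠ k → X ^ r ∣ (E k').comp (U k) := fun k' hk' => by
    rw [hE, prod_comp]
    refine Dvd.dvd.trans ?_ (Finset.dvd_prod_of_mem _
      (Finset.mem_erase.2 ⟨hk'.symm, Finset.mem_univ k⟩))
    rw [pow_comp, hUkk]
  have hcompEk : (E k).comp (U k) = ∏ k' ∈ Finset.univ.erase k, (X + C (f k' - f k)) ^ r := by
    rw [hE, prod_comp]
    exact Finset.prod_congr rfl fun k' _ => by rw [pow_comp, hUU]
  set e : F[X] := ∏ k' ∈ Finset.univ.erase k, (X + C (f k' - f k)) ^ r with he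
  have hcompN : X ^ r ∣ Np.comp (U k) - L k * e := by
    rw [hNp, add_comp, Polynomial.sum_comp, ← Finset.add_sum_erase _ _ (Finset.mem_univ k), mul_comp,
      comp_assoc, hUkk, comp_X, hcompEk]
    have h1 : X ^ r ∣ ∑ k' ∈ Finset.univ.erase k, ((L k').comp (U k') * E k').comp (U k) :=
      Finset.dvd_sum fun k' hk' => by
        rw [mul_comp]
        exact (hcompE k' (Finset.ne_of_mem_erase hk')).mul_left _
    have h2 : X ^ r ∣ (Pol * ∏ k, U k ^ r).comp (U k) := by
      rw [mul_comp, prod_comp]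
      refine Dvd.dvd.mul_left (Dvd.dvd.trans ?_ (Finset.dvd_prod_of_mem _ (Finset.mem_univ k))) _
      rw [pow_comp, hUkk]
    convert dvd_add h1 h2 using 1
    ring
  -- Since `X - C (f k)` becomes `-X` in the local variable, reduction modulo its `r`-th power is
  -- harmless modulo `X ^ r`.
  have hrem : X ^ r ∣ (Np %ₘ (X - C (f k)) ^ r).comp (U k) - Np.comp (U k) := by
    rw [modByMonic_eq_sub_mul_div, sub_comp, mul_comp, pow_comp]
    have h1 : (X - C (f k)).comp (U k) = -X := by simp [hU]
    rw [h1, sub_sub_cancel_left, dvd_neg, neg_pow, mul_assoc]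
    exact Dvd.dvd.mul_left (dvd_mul_right _ _) _
  have hLc : X ^ r ∣ L k - c k * W k := by
    rw [X_pow_dvd_iff]
    intro d hd
    rw [coeff_sub, hL, coeff_polyOf, if_pos hd, sub_self]
  have hfin : X ^ r ∣ localExpansion f α r G y k - W k := by
    rw [localExpansion, hEq]
    obtain ⟨a1, h1⟩ := hcompN
    obtain ⟨a2, h2⟩ := hrem
    obtain ⟨a3, h3⟩ := hLc
    obtain ⟨a4, h4⟩ := hG
    refine ⟨(a2 + a1) * G + a3 * e * G + W k * a4, ?_⟩
    linear_combination G * h2 + G * h1 + e * G * h3 + W k * h4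
  have := X_pow_dvd_iff.1 hfin i hi
  rwa [coeff_sub, sub_eq_zero] at this

end Decoding

/-! ### Entangled polynomial codes and the structure of the answers. -/

namespace GCSA

open Polynomial

variable {F : Type u} [Field F]

/-- The entry at `(i, t)` of the entangled polynomial encoding of `A`. -/
noncomputable def entryPolyA {lam kap : ℕ} (p m : ℕ) (A : Matrix (Fin lam) (Fin kap) F)
    (i : Fin (lam / m)) (t : Fin (kap / p)) : F[X] :=
  ∑ m' : Fin m, ∑ p' : Fin p, C (A (blockIdx m' i) (blockIdx p' t)) * X ^ ((p' : ℕ) + p * m')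

/-- The entry at `(t, j)` of the entangled polynomial encoding of `B`. -/
noncomputable def entryPolyB {kap mu : ℕ} (p m n : ℕ) (B : Matrix (Fin kap) (Fin mu) F)
    (t : Fin (kap / p)) (j : Fin (mu / n)) : F[X] :=
  ∑ p' : Fin p, ∑ n' : Fin n,
    C (B (blockIdx p' t) (blockIdx n' j)) * X ^ ((p - 1 - p') + p * m * n')

/-- The polynomial with the coefficients `z`. -/
noncomputable def noisePoly {x : ℕ} (z : Fin x → F) : F[X] := ∑ y : Fin x, C (z y) * X ^ (y : ℕ)

theorem eval_noisePoly {x : ℕ} (z : Fin x → F) (a : F) :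
    (noisePoly z).eval a = ∑ y : Fin x, a ^ (y : ℕ) * z y := by
  simp only [noisePoly, eval_finsetSum, eval_mul, eval_C, eval_pow, eval_X]
  exact Finset.sum_congr rfl fun _ _ => mul_comm _ _

theorem epA_apply {lam kap : ℕ} (p m : ℕ) (A : Matrix (Fin lam) (Fin kap) F) (u : F)
    (i : Fin (lam / m)) (t : Fin (kap / p)) : epA p m A u i t = (entryPolyA p m A i t).eval u := by
  simp only [epA, entryPolyA, Matrix.sum_apply, Matrix.smul_apply, Matrix.submatrix_apply, smul_eq_mul,
    eval_finsetSum, eval_mul, eval_C, eval_pow, eval_X]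
  exact Finset.sum_congr rfl fun _ _ => Finset.sum_congr rfl fun _ _ => mul_comm _ _

theorem epB_apply {kap mu : ℕ} (p m n : ℕ) (B : Matrix (Fin kap) (Fin mu) F) (u : F)
    (t : Fin (kap / p)) (j : Fin (mu / n)) :
    epB p m n B u t j = (entryPolyB p m n B t j).eval u := by
  simp only [epB, entryPolyB, Matrix.sum_apply, Matrix.smul_apply, Matrix.submatrix_apply, smul_eq_mul,
    eval_finsetSum, eval_mul, eval_C, eval_pow, eval_X]
  exact Finset.sum_congr rfl fun _ _ => Finset.sum_congr rfl fun _ _ => mul_comm _ _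

theorem natDegree_noisePoly_lt {x : ℕ} (hx : 0 < x) (z : Fin x → F) :
    (noisePoly z).natDegree < x := by
  refine Nat.lt_of_le_pred hx (natDegree_sum_le_of_forall_le _ _ fun y _ => ?_)
  exact (natDegree_C_mul_X_pow_le _ _).trans (Nat.le_pred_of_lt y.2)

theorem natDegree_entryPolyA_lt {lam kap p m : ℕ} (hp : 0 < p) (hm : 0 < m)
    (A : Matrix (Fin lam) (Fin kap) F) (i : Fin (lam / m)) (t : Fin (kap / p)) :
    (entryPolyA p m A i t).natDegree < p * m := by
  refine Nat.lt_of_le_pred (Nat.mul_pos hp hm) (natDegree_sum_le_of_forall_le _ _ fun m' _ =>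
    natDegree_sum_le_of_forall_le _ _ fun p' _ => (natDegree_C_mul_X_pow_le _ _).trans
      (Nat.le_pred_of_lt ?_))
  calc (p' : ℕ) + p * m' < p + p * m' := Nat.add_lt_add_right p'.2 _
    _ = p * (m' + 1) := by ring
    _ ≤ p * m := Nat.mul_le_mul_left _ m'.2

theorem natDegree_entryPolyB_le {kap mu p m n : ℕ}
    (B : Matrix (Fin kap) (Fin mu) F) (t : Fin (kap / p)) (j : Fin (mu / n)) :
    (entryPolyB p m n B t j).natDegree ≤ p - 1 + (p * m * n - p * m) := by
  refine natDegree_sum_le_of_forall_le _ _ fun p' _ =>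
    natDegree_sum_le_of_forall_le _ _ fun n' _ => (natDegree_C_mul_X_pow_le _ _).trans
      (add_le_add (Nat.sub_le _ _) ?_)
  calc p * m * n' ≤ p * m * (n - 1) := Nat.mul_le_mul_left _ (Nat.le_pred_of_lt n'.2)
    _ = p * m * n - p * m := by rw [Nat.mul_sub, mul_one]

theorem degree_bounds {lam kap mu p m n : ℕ} (hp : 0 < p) (hm : 0 < m) (hn : 0 < n)
    (A : Matrix (Fin lam) (Fin kap) F) (B : Matrix (Fin kap) (Fin mu) F) (i : Fin (lam / m))
    (t t' : Fin (kap / p)) (j : Fin (mu / n)) :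
    (entryPolyA p m A i t).natDegree ≤ degE p m n ∧ (entryPolyB p m n B t' j).natDegree ≤ degE p m n ∧
      (entryPolyA p m A i t).natDegree + (entryPolyB p m n B t' j).natDegree ≤
        p * m * n + degE p m n := by
  have h1 := natDegree_entryPolyA_lt hp hm A i t
  have h2 := natDegree_entryPolyB_le (m := m) (n := n) B t' j
  have h3 : p * m * 1 ≤ p * m * n := Nat.mul_le_mul_left _ hn
  rw [degE]
  generalize p * m * n = r at *
  generalize p * m = q at *
  omega

theorem shareA_apply {lam kap X' ℓ Kc : ℕ} (p m n : ℕ) (f : Fin ℓ × Fin Kc → F) (a : F)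
    (A : Fin (ℓ * Kc) → Matrix (Fin lam) (Fin kap) F)
    (Z : Fin ℓ → Fin X' → Matrix (Fin (lam / m)) (Fin (kap / p)) F) (l : Fin ℓ)
    (i : Fin (lam / m)) (t : Fin (kap / p)) :
    shareA p m n f a A Z l i t = (∏ k, (f (l, k) - a) ^ (p * m * n)) *
      (∑ k, ((f (l, k) - a) ^ (p * m * n))⁻¹ *
        (entryPolyA p m (A (finProdFinEquiv (l, k))) i t).eval (f (l, k) - a) +
        (noisePoly fun x => Z l x i t).eval a) := by
  simp [shareA, Matrix.sum_apply, epA_apply, eval_noisePoly]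

theorem shareB_apply {kap mu X' ℓ Kc : ℕ} (p m n : ℕ) (f : Fin ℓ × Fin Kc → F) (a : F)
    (B : Fin (ℓ * Kc) → Matrix (Fin kap) (Fin mu) F)
    (Z : Fin ℓ → Fin X' → Matrix (Fin (kap / p)) (Fin (mu / n)) F) (l : Fin ℓ)
    (t : Fin (kap / p)) (j : Fin (mu / n)) :
    shareB p m n f a B Z l t j = ∑ k, ((f (l, k) - a) ^ (p * m * n))⁻¹ *
        (entryPolyB p m n (B (finProdFinEquiv (l, k))) t j).eval (f (l, k) - a) +
        (noisePoly fun x => Z l x t j).eval a := by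
  simp [shareB, Matrix.sum_apply, epB_apply, eval_noisePoly]

/-- The row and column indices as pairs of a block and a position within the block. -/
def blockEquiv {N q : ℕ} (h : q ∣ N) : Fin q × Fin (N / q) ≃ Fin N :=
  finProdFinEquiv.trans (finCongr (Nat.mul_div_cancel' h))

theorem blockEquiv_apply {N q : ℕ} (h : q ∣ N) (x : Fin q × Fin (N / q)) :
    blockEquiv h x = blockIdx x.1 x.2 := by
  ext
  simp [blockEquiv, blockIdx]
  ring

/-- The term `p₁ + (p - 1 - p₂)` differs from `p - 1` by less than `p`, so the multiples of `p` on
both sides must agree. This forces `p₁ = p₂`, and a residue modulo `m` separates the remaining two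
digits. -/
theorem exponent_eq_iff {p m p₁ p₂ m₁ m₂ n₁ n₂ : ℕ} (h1 : p₁ < p) (h2 : p₂ < p) (h3 : m₁ < m)
    (h4 : m₂ < m) : p₁ + p * m₁ + (p - 1 - p₂ + p * m * n₁) = p - 1 + p * m₂ + p * m * n₂ ↔
      p₁ = p₂ ∧ m₁ = m₂ ∧ n₁ = n₂ := by
  constructor
  · intro h
    have e : p₁ + (p - 1 - p₂) + p * (m₁ + m * n₁) = p - 1 + p * (m₂ + m * n₂) := by
      rw [mul_add, mul_add, ← mul_assoc, ← mul_assoc]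
      omega
    have e1 : m₁ + m * n₁ = m₂ + m * n₂ := by
      rcases lt_trichotomy (m₁ + m * n₁) (m₂ + m * n₂) with hlt | heq | hgt
      · have := Nat.mul_le_mul_left p (Nat.succ_le_of_lt hlt)
        rw [Nat.mul_succ] at this
        omega
      · exact heq
      · have := Nat.mul_le_mul_left p (Nat.succ_le_of_lt hgt)
        rw [Nat.mul_succ] at this
        omega
    rw [e1] at e
    have e2 : m₁ = m₂ := by
      have := congrArg (· % m) e1
      simpa [Nat.add_mul_mod_self_left, Nat.mod_eq_of_lt h3, Nat.mod_eq_of_lt h4] using this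
    refine ⟨by omega, e2, ?_⟩
    rw [e2] at e1
    exact Nat.eq_of_mul_eq_mul_left (by omega) (Nat.add_left_cancel e1)
  · rintro ⟨rfl, rfl, rfl⟩
    omega

/-- The products of the entangled polynomial codes contain the desired products as coefficients. -/
theorem coeff_sum_entryPoly_mul {lam kap mu p m n : ℕ} (hp : p ∣ kap)
    (A : Matrix (Fin lam) (Fin kap) F) (B : Matrix (Fin kap) (Fin mu) F) (m₀ : Fin m)
    (n₀ : Fin n) (i : Fin (lam / m)) (j : Fin (mu / n)) :
    (∑ t, entryPolyA p m A i t * entryPolyB p m n B t j).coeff (p - 1 + p * m₀ + p * m * n₀) =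
      (A * B) (blockIdx m₀ i) (blockIdx n₀ j) := by
  have h : ∀ t, (entryPolyA p m A i t * entryPolyB p m n B t j).coeff
      (p - 1 + p * m₀ + p * m * n₀) = ∑ p' : Fin p, A (blockIdx m₀ i) (blockIdx p' t) *
        B (blockIdx p' t) (blockIdx n₀ j) := by
    intro t
    rw [entryPolyA, entryPolyB, Finset.sum_mul_sum]
    simp only [Finset.sum_mul_sum, finsetSum_coeff]
    have e : ∀ (m₁ : Fin m) (p₂ p₁ : Fin p) (n₁ : Fin n),
        (C (A (blockIdx m₁ i) (blockIdx p₁ t)) * X ^ ((p₁ : ℕ) + p * m₁) *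
          (C (B (blockIdx p₂ t) (blockIdx n₁ j)) * X ^ (p - 1 - p₂ + p * m * n₁))).coeff
          (p - 1 + p * m₀ + p * m * n₀) =
        if m₁ = m₀ then if p₁ = p₂ then if n₁ = n₀ then
          A (blockIdx m₁ i) (blockIdx p₁ t) * B (blockIdx p₂ t) (blockIdx n₁ j) else 0 else 0
          else 0 := by
      intro m₁ p₂ p₁ n₁
      have e1 : C (A (blockIdx m₁ i) (blockIdx p₁ t)) * X ^ ((p₁ : ℕ) + p * m₁) *
          (C (B (blockIdx p₂ t) (blockIdx n₁ j)) * X ^ (p - 1 - p₂ + p * m * n₁)) =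
          C (A (blockIdx m₁ i) (blockIdx p₁ t) * B (blockIdx p₂ t) (blockIdx n₁ j)) *
            X ^ ((p₁ : ℕ) + p * m₁ + (p - 1 - p₂ + p * m * n₁)) := by
        rw [pow_add, C_mul]
        ring
      rw [e1, coeff_C_mul_X_pow]
      have e2 := exponent_eq_iff (n₁ := n₁) (n₂ := n₀) p₁.2 p₂.2 m₁.2 m₀.2
      simp only [Fin.ext_iff]
      rw [if_congr (eq_comm.trans e2) rfl rfl]
      by_cases c1 : (p₁ : ℕ) = p₂ <;> by_cases c2 : (m₁ : ℕ) = m₀ <;>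
        by_cases c3 : (n₁ : ℕ) = n₀ <;> simp [c1, c2, c3]
    simp only [e]
    simp
  rw [finsetSum_coeff, Finset.sum_congr rfl fun t _ => h t, Matrix.mul_apply, Finset.sum_comm,
    ← (blockEquiv hp).sum_comp, Fintype.sum_prod_type]
  simp only [blockEquiv_apply]

/-- The polynomial whose coefficients are the numbers `coef`. -/
noncomputable def coefPoly {ℓ Kc : ℕ} (p m n : ℕ) (f : Fin ℓ × Fin Kc → F) (x : Fin ℓ × Fin Kc) :
    F[X] :=
  ∏ k' ∈ Finset.univ.erase x.2, (X + C (f (x.1, k') - f x)) ^ (p * m * n)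

/-- The convolution in the definition of the aligned noise is a product with `coefPoly`. This is
what gives noise and data principal parts of the same form. -/
theorem coeff_coefPoly_mul {ℓ Kc p m n : ℕ} (f : Fin ℓ × Fin Kc → F) (l : Fin ℓ) (k : Fin Kc)
    (W : F[X]) (i : Fin (p * m * n)) : (coefPoly p m n f (l, k) * W).coeff i =
      ∑ i' ∈ Finset.Iic i, coef p m n f l k ((i : ℕ) - i') * W.coeff i' := by
  rw [mul_comm, coeff_mul, Finset.Nat.sum_antidiagonal_eq_sum_range_succ
    fun a b => W.coeff a * (coefPoly p m n f (l, k)).coeff b]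
  symm
  refine Finset.sum_bij (fun i' _ => (i' : ℕ)) ?_ ?_ ?_ ?_
  · intro i' hi'
    rw [Finset.mem_Iic, Fin.le_def] at hi'
    exact Finset.mem_range.2 (Nat.lt_succ_of_le hi')
  · exact fun a _ b _ h => Fin.ext h
  · intro b hb
    have hb' := Nat.lt_succ_iff.1 (Finset.mem_range.1 hb)
    exact ⟨⟨b, hb'.trans_lt i.2⟩, Finset.mem_Iic.2 hb', rfl⟩
  · intro a _
    rw [mul_comm]
    rfl

open Classical in
/-- The part of a polynomial at the undesired positions, filled with noise. -/
noncomputable def undesiredPoly {r c X' ℓ Kc p m n : ℕ}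
    (Z : NoiseLabel X' ℓ Kc p m n → Matrix (Fin r) (Fin c) F) (i : Fin r) (j : Fin c)
    (x : Fin ℓ × Fin Kc) : F[X] :=
  polyOf (p * m * n) fun e => if h : e < p * m * n ∧ e + 1 ∉ desired p m n then
    Z (.inr ⟨(x.1, x.2, ⟨e, h.1⟩), h.2⟩) i j else 0

theorem alignedNoise_apply {r c X' ℓ Kc p m n : ℕ} (f : Fin ℓ × Fin Kc → F) (a : F)
    (Z : NoiseLabel X' ℓ Kc p m n → Matrix (Fin r) (Fin c) F) (i : Fin r) (j : Fin c) :
    alignedNoise p m n f a Z i j =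
      (noisePoly fun x => Z (.inl x) i j).eval a +
        ∑ x, ∑ e : Fin (p * m * n), ((f x - a) ^ (p * m * n - (e : ℕ)))⁻¹ *
          (coefPoly p m n f x * undesiredPoly Z i j x).coeff e := by
  rw [alignedNoise, Matrix.add_apply, Fintype.sum_prod_type]
  congr 1
  · simp [Matrix.sum_apply, eval_noisePoly]
  · simp only [Matrix.sum_apply, Matrix.smul_apply, smul_eq_mul, coeff_coefPoly_mul]
    refine Finset.sum_congr rfl fun l _ => Finset.sum_congr rfl fun k _ =>
      Finset.sum_congr rfl fun e _ => ?_
    congr 1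
    refine Finset.sum_congr rfl fun i' _ => ?_
    congr 1
    rw [undesiredPoly, coeff_polyOf, if_pos i'.2]
    by_cases h : (i' : ℕ) + 1 ∉ desired p m n
    · rw [dif_pos h, dif_pos ⟨i'.2, h⟩]
    · rw [dif_neg h, dif_neg fun h' => h h'.2]
      rfl

/-- The structure of the products of the shares: principal parts, a polynomial of low degree, and the
product of the noise terms. -/
theorem exists_sum_share_mul {lam kap mu X' ℓ Kc p m n : ℕ} (hX : 0 < X') (hp : 0 < p) (hm : 0 < m)
    (hn : 0 < n) (f : Fin ℓ × Fin Kc → F) (A : Fin (ℓ * Kc) → Matrix (Fin lam) (Fin kap) F)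
    (B : Fin (ℓ * Kc) → Matrix (Fin kap) (Fin mu) F)
    (ZA : Fin ℓ → Fin X' → Matrix (Fin (lam / m)) (Fin (kap / p)) F)
    (ZB : Fin ℓ → Fin X' → Matrix (Fin (kap / p)) (Fin (mu / n)) F)
    (i : Fin (lam / m)) (j : Fin (mu / n)) :
    ∃ Pol : F[X], Pol.degree < (numPolyNoise X' Kc p m n : ℕ) ∧ ∀ a, (∀ x, f x ≠ a) →
      ∑ l, ∑ t, shareA p m n f a A ZA l i t * shareB p m n f a B ZB l t j =
        ∑ x, ∑ e : Fin (p * m * n), ((f x - a) ^ (p * m * n - (e : ℕ)))⁻¹ *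
          (coefPoly p m n f x * ∑ t, entryPolyA p m (A (finProdFinEquiv x)) i t *
            entryPolyB p m n (B (finProdFinEquiv x)) t j).coeff e +
        Pol.eval a + ∑ l, (∏ k, (f (l, k) - a) ^ (p * m * n)) *
          ∑ t, (noisePoly fun x => ZA l x i t).eval a * (noisePoly fun x => ZB l x t j).eval a := by
  have key : ∀ (l : Fin ℓ) (t : Fin (kap / p)), _ := fun l t =>
    exists_polynomial_part (fun k => f (l, k))
      (P := fun k => entryPolyA p m (A (finProdFinEquiv (l, k))) i t)
      (Q := fun k => entryPolyB p m n (B (finProdFinEquiv (l, k))) t j)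
      (r := p * m * n) (e := degE p m n)
      (fun k => (degree_bounds hp hm hn (A (finProdFinEquiv (l, k))) (B (finProdFinEquiv (l, k)))
        i t t j).1)
      (fun k => (degree_bounds hp hm hn (A (finProdFinEquiv (l, k))) (B (finProdFinEquiv (l, k)))
        i t t j).2.1)
      (fun k k' => (degree_bounds hp hm hn (A (finProdFinEquiv (l, k)))
        (B (finProdFinEquiv (l, k'))) i t t j).2.2)
      (natDegree_noisePoly_lt hX fun x => ZA l x i t) (natDegree_noisePoly_lt hX fun x => ZB l x t j)
  choose Pol hPol hval using key
  refine ⟨∑ l, ∑ t, Pol l t, ?_, fun a ha => ?_⟩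
  · rw [← mem_degreeLT]
    refine Submodule.sum_mem _ fun l _ => Submodule.sum_mem _ fun t _ => mem_degreeLT.2 ?_
    simpa [numPolyNoise] using hPol l t
  · have h : ∀ l t, shareA p m n f a A ZA l i t * shareB p m n f a B ZB l t j =
        ∑ k, ∑ e : Fin (p * m * n), ((f (l, k) - a) ^ (p * m * n - (e : ℕ)))⁻¹ *
          (coefPoly p m n f (l, k) * (entryPolyA p m (A (finProdFinEquiv (l, k))) i t *
            entryPolyB p m n (B (finProdFinEquiv (l, k))) t j)).coeff e +
        (Pol l t).eval a + (∏ k, (f (l, k) - a) ^ (p * m * n)) *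
          ((noisePoly fun x => ZA l x i t).eval a * (noisePoly fun x => ZB l x t j).eval a) := by
      intro l t
      rw [shareA_apply, shareB_apply]
      exact hval l t a fun k => sub_ne_zero.2 (ha (l, k))
    simp only [h, Finset.sum_add_distrib, Fintype.sum_prod_type, eval_finsetSum, Finset.mul_sum,
      finsetSum_coeff]
    congr 2
    refine Finset.sum_congr rfl fun l _ => ?_
    rw [Finset.sum_comm]
    refine Finset.sum_congr rfl fun k _ => ?_
    rw [Finset.sum_comm]

end GCSA

/-! ### Entropy, and independence from bijections of the randomness. -/

section Information

open scoped ENNReal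

variable {Ω α β γ δ ζ : Type*}

theorem entropy_comp_of_injective [Finite α] [Finite β] (P : PMF Ω) (V : Ω → α) {e : α → β}
    (he : Function.Injective e) : entropy P (fun ω => e (V ω)) = entropy P V := by
  classical
  have h : ∀ a, (P.map fun ω => e (V ω)) (e a) = (P.map V) a := by
    intro a
    rw [PMF.map_apply, PMF.map_apply]
    exact tsum_congr fun ω => by simp only [he.eq_iff]
  unfold entropy
  rw [← he.tsum_eq (f := fun b => Real.negMulLog ((P.map fun ω => e (V ω)) b).toReal)]
  · simp only [h]
  · intro b hb
    by_contra hb'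
    refine hb ?_
    have : (P.map fun ω => e (V ω)) b = 0 := by
      rw [PMF.map_apply]
      refine ENNReal.tsum_eq_zero.2 fun ω => if_neg fun h => hb' ⟨_, h.symm⟩
    simp [this]

theorem PMF.sum_toReal [Fintype α] (q : PMF α) : ∑ a, (q a).toReal = 1 := by
  rw [← ENNReal.toReal_sum fun a _ => q.apply_ne_top a, ← tsum_fintype (L := .unconditional _),
    q.tsum_coe, ENNReal.toReal_one]

/-- The chain rule for the entropy. -/
theorem entropy_prod_eq [Fintype α] [Finite β] (P : PMF Ω) (V : Ω → α) (W : Ω → β) (q : α → PMF β)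
    (h : P.map (fun ω => (V ω, W ω)) = (P.map V).bind fun a => (q a).map (Prod.mk a)) :
    entropy P (fun ω => (V ω, W ω)) =
      entropy P V + ∑ a, ((P.map V) a).toReal * entropy (q a) id := by
  classical
  have := Fintype.ofFinite β
  have hab : ∀ a b, ((P.map fun ω => (V ω, W ω)) (a, b)).toReal =
      ((P.map V) a).toReal * ((q a) b).toReal := by
    intro a b
    rw [h, PMF.bind_apply, tsum_eq_single a, PMF.map_apply (Prod.mk a), tsum_eq_single b]
    · simp
    · intro b' hb'
      simp [hb'.symm]
    · intro a' ha'
      rw [PMF.map_apply]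
      simp [ha'.symm]
  simp only [entropy, tsum_fintype, Fintype.sum_prod_type, hab, Real.negMulLog_mul, PMF.map_id,
    Finset.sum_add_distrib, ← Finset.sum_mul, ← Finset.mul_sum, PMF.sum_toReal, one_mul]

theorem entropy_congr [Finite α] {P : PMF Ω} {V : Ω → α} {q : PMF α} (h : P.map V = q) :
    entropy P V = entropy q id := by
  rw [entropy, entropy, h, PMF.map_id]

/-- If the conditional law of `W` given `V` is constantly `q`, then `q` is also the law of `W`, and
the chain rule makes the entropy of the pair the sum of the two entropies. -/
theorem mutualInfo_eq_zero [Finite α] [Finite β] {P : PMF Ω} {V : Ω → α} {W : Ω → β} (q : PMF β)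
    (h : P.map (fun ω => (V ω, W ω)) = (P.map V).bind fun a => q.map (Prod.mk a)) :
    mutualInfo P V W = 0 := by
  have := Fintype.ofFinite α
  have hW : P.map W = q := by
    have := congrArg (PMF.map Prod.snd) h
    rw [PMF.map_comp, PMF.map_bind] at this
    simp only [PMF.map_comp] at this
    have e : ∀ a : α, (Prod.snd ∘ Prod.mk a : β → β) = id := fun a => rfl
    simp only [e, PMF.map_id, PMF.bind_const] at this
    exact this
  rw [mutualInfo, entropy_prod_eq P V W (fun _ => q) h, entropy_congr hW, ← Finset.sum_mul,
    PMF.sum_toReal]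
  ring

/-- The variable `h (V ω)` adds nothing to `V`, so the chain rule for `(V, W)` and for `(h V, W)`
covers all terms. Both add the same average entropy of `q`, because the conditional law of `W`
depends on `V` only through `h`. -/
theorem condMutualInfo_eq_zero [Finite α] [Finite β] [Finite γ] {P : PMF Ω} {V : Ω → α}
    {W : Ω → β} (h : α → γ) (q : γ → PMF β)
    (hq : P.map (fun ω => (V ω, W ω)) = (P.map V).bind fun a => (q (h a)).map (Prod.mk a)) :
    condMutualInfo P V W (fun ω => h (V ω)) = 0 := by
  classical
  have := Fintype.ofFinite α
  have := Fintype.ofFinite γ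
  have h1 : entropy P (fun ω => (V ω, h (V ω))) = entropy P V :=
    entropy_comp_of_injective P V (e := fun a => (a, h a)) fun a a' e => (Prod.ext_iff.1 e).1
  have h2 : entropy P (fun ω => (V ω, W ω, h (V ω))) = entropy P (fun ω => (V ω, W ω)) :=
    entropy_comp_of_injective P (fun ω => (V ω, W ω))
      (e := fun x : α × β => (x.1, x.2, h x.1)) fun a a' e => by
        simp only [Prod.ext_iff] at e
        exact Prod.ext e.1 e.2.1
  have h3 : entropy P (fun ω => (W ω, h (V ω))) = entropy P (fun ω => (h (V ω), W ω)) :=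
    entropy_comp_of_injective P (fun ω => (h (V ω), W ω)) Prod.swap_injective
  have hZ : P.map (fun ω => (h (V ω), W ω)) =
      (P.map fun ω => h (V ω)).bind fun c => (q c).map (Prod.mk c) := by
    have := congrArg (PMF.map (Prod.map h id)) hq
    rw [PMF.map_comp, PMF.map_bind] at this
    refine this.trans ?_
    rw [show (fun ω => h (V ω)) = h ∘ V from rfl, ← PMF.map_comp, PMF.bind_map _ h]
    congr 1
    funext a
    rw [PMF.map_comp]
    rfl
  have hE : ∑ c, ((P.map fun ω => h (V ω)) c).toReal * entropy (q c) id =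
      ∑ a, ((P.map V) a).toReal * entropy (q (h a)) id := by
    have e : ∀ c, ((P.map fun ω => h (V ω)) c).toReal =
        ∑ a, if c = h a then ((P.map V) a).toReal else 0 := by
      intro c
      rw [show (fun ω => h (V ω)) = h ∘ V from rfl, ← PMF.map_comp, PMF.map_apply,
        tsum_fintype, ENNReal.toReal_sum]
      · exact Finset.sum_congr rfl fun a _ => by split_ifs <;> rfl
      · intro a _
        split_ifs
        · exact PMF.apply_ne_top _ _
        · exact ENNReal.zero_ne_top
    simp only [e, Finset.sum_mul]
    rw [Finset.sum_comm]
    refine Finset.sum_congr rfl fun a _ => ?_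
    simp
  rw [condMutualInfo, h1, h2, h3, entropy_prod_eq P V W _ hq, entropy_prod_eq P _ W q hZ, hE]
  ring

theorem PMF.map_uniformOfFintype_equiv [Fintype α] [Nonempty α] [Fintype β] [Nonempty β]
    (e : α ≃ β) : (PMF.uniformOfFintype α).map e = PMF.uniformOfFintype β := by
  classical
  ext b
  rw [PMF.map_apply, tsum_eq_single (e.symm b)]
  · simp [Fintype.card_congr e]
  · intro a ha
    exact if_neg fun h => ha (by rw [h, e.symm_apply_apply])

theorem PMF.uniformOfFintype_prod [Fintype α] [Nonempty α] [Fintype β] [Nonempty β] :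
    PMF.uniformOfFintype (α × β) =
      (PMF.uniformOfFintype α).bind fun a => (PMF.uniformOfFintype β).map (Prod.mk a) := by
  classical
  ext ⟨a, b⟩
  rw [PMF.bind_apply, tsum_eq_single a, PMF.map_apply, tsum_eq_single b]
  · simp only [PMF.uniformOfFintype_apply, Fintype.card_prod, Nat.cast_mul, if_true]
    rw [ENNReal.mul_inv (by simp) (by simp)]
  · intro b' hb'
    simp [hb'.symm]
  · intro a' ha'
    rw [PMF.map_apply]
    simp [ha'.symm]

/-- Data that are processed with independent uniform randomness into observations whose law does not
depend on the data are independent of the observations. -/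
theorem mutualInfo_eq_zero_of_equiv [Finite α] [Finite β] [Fintype ζ] [Nonempty ζ] (π : PMF δ)
    (mk : δ → ζ → Ω) (V : Ω → α) (W : Ω → β) (v : δ → α) (hv : ∀ d z, V (mk d z) = v d)
    (e : ∀ d d', ∃ τ : ζ ≃ ζ, ∀ z, W (mk d z) = W (mk d' (τ z))) :
    mutualInfo (π.bind fun d => (PMF.uniformOfFintype ζ).map (mk d)) V W = 0 := by
  obtain ⟨d₀, -⟩ := π.support_nonempty
  refine mutualInfo_eq_zero ((PMF.uniformOfFintype ζ).map fun z => W (mk d₀ z)) ?_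
  have hV : (π.bind fun d => (PMF.uniformOfFintype ζ).map (mk d)).map V = π.map v := by
    rw [PMF.map_bind, ← PMF.bind_pure_comp]
    congr 1
    funext d
    rw [PMF.map_comp, show V ∘ mk d = Function.const ζ (v d) from funext (hv d), PMF.map_const]
    rfl
  rw [hV, PMF.map_bind, PMF.bind_map]
  congr 1
  funext d
  obtain ⟨τ, hτ⟩ := e d d₀
  rw [PMF.map_comp, Function.comp_apply, PMF.map_comp]
  conv_rhs => rw [← PMF.map_uniformOfFintype_equiv τ, PMF.map_comp]
  congr 1
  funext z
  simp [hv, hτ]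

/-- Data that are processed with independent uniform randomness into observations whose law depends
on the data through a function `h` only are independent of the observations given `h`. -/
theorem condMutualInfo_eq_zero_of_equiv [Finite α] [Finite β] [Finite γ] [Fintype ζ] [Nonempty ζ]
    (π : PMF α) (mk : α → ζ → Ω) (V : Ω → α) (W : Ω → β) (h : α → γ)
    (hv : ∀ d z, V (mk d z) = d)
    (e : ∀ d d', h d = h d' → ∃ τ : ζ ≃ ζ, ∀ z, W (mk d z) = W (mk d' (τ z))) :
    condMutualInfo (π.bind fun d => (PMF.uniformOfFintype ζ).map (mk d)) V W
      (fun ω => h (V ω)) = 0 := by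
  obtain ⟨d₀, -⟩ := π.support_nonempty
  have : Nonempty α := ⟨d₀⟩
  -- The conditional law given a value of `h` is computed from one datum with that value, chosen by
  -- `Function.invFun`.
  refine condMutualInfo_eq_zero h
    (fun c => (PMF.uniformOfFintype ζ).map fun z => W (mk (Function.invFun h c) z)) ?_
  have hV : (π.bind fun d => (PMF.uniformOfFintype ζ).map (mk d)).map V = π := by
    rw [PMF.map_bind]
    conv_rhs => rw [← PMF.bind_pure π]
    congr 1
    funext d
    rw [PMF.map_comp, show V ∘ mk d = Function.const ζ d from funext (hv d), PMF.map_const]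
  rw [hV, PMF.map_bind]
  congr 1
  funext d
  obtain ⟨τ, hτ⟩ := e d (Function.invFun h (h d)) (Function.invFun_eq ⟨d, rfl⟩).symm
  rw [PMF.map_comp, PMF.map_comp]
  conv_rhs => rw [← PMF.map_uniformOfFintype_equiv τ, PMF.map_comp]
  congr 1
  funext z
  simp [hv, hτ]

end Information

/-! ### Security, strong security and privacy of the scheme. -/

open Polynomial

namespace Scheme

variable {F : Type u} [Field F] {S L lam kap mu : ℕ} (P : Scheme F S L lam kap mu)

/-- The realization with given data and given randomness. -/
def Realization.ofData (d : (Fin L → Matrix (Fin lam) (Fin kap) F) × (Fin L → Matrix (Fin kap) (Fin mu) F))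
    (z : (P.νA → F) × (P.νB → F) × (∀ s, P.νS s → F)) : P.Realization :=
  ⟨d.1, d.2, z.1, z.2.1, z.2.2⟩

open Classical in
theorem law_eq [Fintype F] (pA : PMF (Fin L → Matrix (Fin lam) (Fin kap) F))
    (pB : PMF (Fin L → Matrix (Fin kap) (Fin mu) F)) :
    P.law pA pB = (pA.bind fun A => pB.map (Prod.mk A)).bind fun d =>
      (PMF.uniformOfFintype ((P.νA → F) × (P.νB → F) × (∀ s, P.νS s → F))).map
        (Realization.ofData P d) := by
  rw [law, PMF.bind_bind]
  congr 1
  funext A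
  rw [PMF.bind_map]
  rfl

open Classical in
-- Here the source noise is counted among the data and only the server noise remains as randomness.
-- Strong security needs this grouping, as it protects the shares too.
theorem law_eq_bind_shares [Fintype F] (pA : PMF (Fin L → Matrix (Fin lam) (Fin kap) F))
    (pB : PMF (Fin L → Matrix (Fin kap) (Fin mu) F)) :
    ∃ π : PMF (((Fin L → Matrix (Fin lam) (Fin kap) F) × (Fin L → Matrix (Fin kap) (Fin mu) F)) ×
        (P.νA → F) × (P.νB → F)),
      P.law pA pB = π.bind fun d => (PMF.uniformOfFintype (∀ s, P.νS s → F)).map fun w =>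
        Realization.ofData P d.1 (d.2.1, d.2.2, w) := by
  refine ⟨(pA.bind fun A => pB.map (Prod.mk A)).bind fun d =>
    (PMF.uniformOfFintype ((P.νA → F) × (P.νB → F))).map (Prod.mk d), ?_⟩
  rw [law_eq]
  conv_rhs => rw [PMF.bind_bind]
  congr 1
  funext d
  rw [← PMF.map_uniformOfFintype_equiv (Equiv.prodAssoc (P.νA → F) (P.νB → F) (∀ s, P.νS s → F)),
    PMF.map_comp, PMF.uniformOfFintype_prod, PMF.map_bind, PMF.bind_map]
  congr 1
  funext z
  rw [PMF.map_comp]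
  rfl

end Scheme

namespace GCSA

variable {F : Type u} [Field F]

theorem noisePoly_add {x : ℕ} (z z' : Fin x → F) :
    noisePoly (z + z') = noisePoly z + noisePoly z' := by
  simp [noisePoly, add_mul, Finset.sum_add_distrib]

theorem noisePoly_coeff {x : ℕ} {P : F[X]} (h : P.degree < x) :
    noisePoly (fun y : Fin x => P.coeff y) = P := by
  conv_rhs => rw [← polyOf_coeff_self h, polyOf, Finset.sum_range]
  rfl

theorem exists_noisePoly_eval_eq {S x : ℕ} {α : Fin S → F} (hα : Function.Injective α)
    {T : Finset (Fin S)} (hT : T.card ≤ x) (v : Fin S → F) :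
    ∃ z : Fin x → F, ∀ s ∈ T, (noisePoly z).eval (α s) = v s := by
  refine ⟨fun y => (Lagrange.interpolate T α v).coeff y, fun s hs => ?_⟩
  rw [noisePoly_coeff, Lagrange.eval_interpolate_at_node v hα.injOn hs]
  exact (Lagrange.degree_interpolate_lt v hα.injOn).trans_le (by exact_mod_cast hT)

/-- The data terms for `A` and `A'` differ by prescribed values at no more than `X'` points, and a
noise polynomial can take any such values. The shift is the same for all `z`, so it acts by
translation. -/
theorem exists_shareA_shift {lam kap X' ℓ Kc S p m : ℕ} (n : ℕ) (f : Fin ℓ × Fin Kc → F)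
    {α : Fin S → F} (hα : Function.Injective α) {T : Finset (Fin S)} (hT : T.card ≤ X')
    (A A' : Fin (ℓ * Kc) → Matrix (Fin lam) (Fin kap) F) :
    ∃ a : Fin ℓ × Fin X' × Fin (lam / m) × Fin (kap / p) → F, ∀ s ∈ T, ∀ z,
      shareA p m n f (α s) A (fun l x => Matrix.of fun i j => z (l, x, i, j)) =
        shareA p m n f (α s) A' fun l x => Matrix.of fun i j => (z + a) (l, x, i, j) := by
  choose a ha using fun (l : Fin ℓ) (i : Fin (lam / m)) (t : Fin (kap / p)) =>
    exists_noisePoly_eval_eq hα hT fun s => ∑ k, ((f (l, k) - α s) ^ (p * m * n))⁻¹ *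
        (entryPolyA p m (A (finProdFinEquiv (l, k))) i t).eval (f (l, k) - α s) -
      ∑ k, ((f (l, k) - α s) ^ (p * m * n))⁻¹ *
        (entryPolyA p m (A' (finProdFinEquiv (l, k))) i t).eval (f (l, k) - α s)
  refine ⟨fun y : Fin ℓ × Fin X' × Fin (lam / m) × Fin (kap / p) => a y.1 y.2.2.1 y.2.2.2 y.2.1, fun s hs z => ?_⟩
  funext l
  ext i t
  rw [shareA_apply, shareA_apply]
  have e := noisePoly_add (fun x => z (l, x, i, t)) (a l i t)
  have e' : (noisePoly fun x => (z + fun y : Fin ℓ × Fin X' × Fin (lam / m) × Fin (kap / p) => a y.1 y.2.2.1 y.2.2.2 y.2.1) (l, x, i, t)) =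
    noisePoly ((fun x => z (l, x, i, t)) + a l i t) := rfl
  simp only [Matrix.of_apply]
  rw [e', e, eval_add, ha l i t s hs]
  ring

theorem exists_shareB_shift {kap mu X' ℓ Kc S p n : ℕ} (m : ℕ) (f : Fin ℓ × Fin Kc → F)
    {α : Fin S → F} (hα : Function.Injective α) {T : Finset (Fin S)} (hT : T.card ≤ X')
    (B B' : Fin (ℓ * Kc) → Matrix (Fin kap) (Fin mu) F) :
    ∃ b : Fin ℓ × Fin X' × Fin (kap / p) × Fin (mu / n) → F, ∀ s ∈ T, ∀ z,
      shareB p m n f (α s) B (fun l x => Matrix.of fun i j => z (l, x, i, j)) =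
        shareB p m n f (α s) B' fun l x => Matrix.of fun i j => (z + b) (l, x, i, j) := by
  choose b hb using fun (l : Fin ℓ) (t : Fin (kap / p)) (j : Fin (mu / n)) =>
    exists_noisePoly_eval_eq hα hT fun s => ∑ k, ((f (l, k) - α s) ^ (p * m * n))⁻¹ *
        (entryPolyB p m n (B (finProdFinEquiv (l, k))) t j).eval (f (l, k) - α s) -
      ∑ k, ((f (l, k) - α s) ^ (p * m * n))⁻¹ *
        (entryPolyB p m n (B' (finProdFinEquiv (l, k))) t j).eval (f (l, k) - α s)
  refine ⟨fun y : Fin ℓ × Fin X' × Fin (kap / p) × Fin (mu / n) => b y.1 y.2.2.1 y.2.2.2 y.2.1, fun s hs z => ?_⟩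
  funext l
  ext t j
  rw [shareB_apply, shareB_apply]
  have e := noisePoly_add (fun x => z (l, x, t, j)) (b l t j)
  have e' : (noisePoly fun x => (z + fun y : Fin ℓ × Fin X' × Fin (kap / p) × Fin (mu / n) => b y.1 y.2.2.1 y.2.2.2 y.2.1) (l, x, t, j)) =
    noisePoly ((fun x => z (l, x, t, j)) + b l t j) := rfl
  simp only [Matrix.of_apply]
  rw [e', e, eval_add, hb l t j s hs]
  ring

/-- A change of data is compensated by translations of the two source noises. The server noise is
left alone, and with it the messages, which do not depend on the shares. -/
theorem isSecure [Fintype F] {S X' ℓ Kc p m n lam kap mu : ℕ} (f : Fin ℓ × Fin Kc → F)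
    {α : Fin S → F} (hα : Function.Injective α) (g : Fin S)
    (dec : ∀ T : Finset (Fin S), (T → Fin (lam / m) × Fin (mu / n) → F) →
      (Fin (ℓ * Kc) → Matrix (Fin lam) (Fin mu) F)) :
    (gcsaNA X' ℓ Kc p m n lam kap mu f α g dec).IsSecure X' := by
  classical
  intro pA pB T hT
  rw [Scheme.law_eq]
  refine mutualInfo_eq_zero_of_equiv _ _ _ _ id (fun _ _ => rfl) fun d d' => ?_
  obtain ⟨a, ha⟩ := exists_shareA_shift (p := p) (m := m) n f hα hT d.1 d'.1
  obtain ⟨b, hb⟩ := exists_shareB_shift (p := p) (n := n) m f hα hT d.2 d'.2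
  refine ⟨Equiv.prodCongr (Equiv.addRight a) (Equiv.prodCongr (Equiv.addRight b) (Equiv.refl _)),
    fun z => ?_⟩
  refine Prod.ext (funext fun s => funext fun e => ?_) (Prod.ext (funext fun s => funext fun e => ?_)
    rfl)
  · exact congrFun (congrFun (congrFun (ha s s.2 z.1) e.1) e.2.1) e.2.2
  · exact congrFun (congrFun (congrFun (hb s s.2 z.2.1) e.1) e.2.1) e.2.2

theorem isStronglySecure [Fintype F] {S X' ℓ Kc p m n lam kap mu : ℕ} (f : Fin ℓ × Fin Kc → F)
    (α : Fin S → F) (g : Fin S)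
    (dec : ∀ T : Finset (Fin S), (T → Fin (lam / m) × Fin (mu / n) → F) →
      (Fin (ℓ * Kc) → Matrix (Fin lam) (Fin mu) F)) :
    (gcsaNA X' ℓ Kc p m n lam kap mu f α g dec).IsStronglySecure := by
  classical
  intro pA pB
  obtain ⟨π, hπ⟩ := Scheme.law_eq_bind_shares (gcsaNA X' ℓ Kc p m n lam kap mu f α g dec) pA pB
  rw [hπ]
  exact mutualInfo_eq_zero_of_equiv _ _ _ _ (fun d => (d.1.1, d.1.2,
    (fun s => (gcsaNA X' ℓ Kc p m n lam kap mu f α g dec).encA s d.1.1 d.2.1),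
    (fun s => (gcsaNA X' ℓ Kc p m n lam kap mu f α g dec).encB s d.1.2 d.2.2)))
    (fun _ _ => rfl) fun d d' => ⟨Equiv.refl _, fun z => rfl⟩

theorem undesiredPoly_add {r c X' ℓ Kc p m n : ℕ}
    (Z Z' : NoiseLabel X' ℓ Kc p m n → Matrix (Fin r) (Fin c) F) (i : Fin r) (j : Fin c)
    (x : Fin ℓ × Fin Kc) :
    undesiredPoly (Z + Z') i j x = undesiredPoly Z i j x + undesiredPoly Z' i j x := by
  ext e
  simp only [undesiredPoly, coeff_add, coeff_polyOf]
  split_ifs <;> simp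

theorem alignedNoise_add {r c X' ℓ Kc p m n : ℕ} (f : Fin ℓ × Fin Kc → F) (a : F)
    (Z Z' : NoiseLabel X' ℓ Kc p m n → Matrix (Fin r) (Fin c) F) (i : Fin r) (j : Fin c) :
    alignedNoise p m n f a (Z + Z') i j =
      alignedNoise p m n f a Z i j + alignedNoise p m n f a Z' i j := by
  have h : (noisePoly fun x => (Z + Z') (.inl x) i j) =
    (noisePoly fun x => Z (.inl x) i j) + noisePoly fun x => Z' (.inl x) i j :=
    noisePoly_add _ _
  simp only [alignedNoise_apply, undesiredPoly_add, h, eval_add, mul_add, coeff_add,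
    Finset.sum_add_distrib]
  ring

theorem coeff_coefPoly_mul_congr {ℓ Kc p m n : ℕ} (f : Fin ℓ × Fin Kc → F) (x : Fin ℓ × Fin Kc)
    {W W' : F[X]} (h : ∀ e < p * m * n, W.coeff e = W'.coeff e) (i : Fin (p * m * n)) :
    (coefPoly p m n f x * W).coeff i = (coefPoly p m n f x * W').coeff i := by
  rw [coeff_coefPoly_mul f x.1 x.2 W, coeff_coefPoly_mul f x.1 x.2 W']
  exact Finset.sum_congr rfl fun i' _ => by rw [h i' i'.2]

theorem exists_of_mem_desired {p m n e : ℕ} (h : e + 1 ∈ desired p m n) :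
    ∃ (m₀ : Fin m) (n₀ : Fin n), 0 < p → e = p - 1 + p * m₀ + p * m * n₀ := by
  obtain ⟨m₀, n₀, h⟩ := h
  exact ⟨m₀, n₀, fun hp => by omega⟩

/-- The noise matrices parametrize exactly the polynomials of degree below `numPolyNoise` and the
principal parts that vanish at the desired positions. -/
theorem exists_noise_eq {r c X' ℓ Kc p m n : ℕ} {Pol : Fin r → Fin c → F[X]}
    (hPol : ∀ i j, (Pol i j).degree < (numPolyNoise X' Kc p m n : ℕ))
    (W : Fin r → Fin c → Fin ℓ × Fin Kc → F[X])
    (hW : ∀ i j x e, e + 1 ∈ desired p m n → (W i j x).coeff e = 0) :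
    ∃ D : NoiseLabel X' ℓ Kc p m n → Matrix (Fin r) (Fin c) F, ∀ i j,
      (noisePoly fun x => D (.inl x) i j) = Pol i j ∧
      ∀ x, ∀ e < p * m * n, (undesiredPoly D i j x).coeff e = (W i j x).coeff e := by
  refine ⟨Sum.elim (fun x => Matrix.of fun i j => (Pol i j).coeff x)
    fun x => Matrix.of fun i j => (W i j (x.1.1, x.1.2.1)).coeff x.1.2.2,
    fun i j => ⟨noisePoly_coeff (hPol i j), fun x e he => ?_⟩⟩
  rw [undesiredPoly, coeff_polyOf, if_pos he]
  by_cases h : e + 1 ∈ desired p m n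
  · rw [dif_neg fun h' => h'.2 h, hW i j x e h]
  · rw [dif_pos ⟨he, h⟩]
    rfl

/-- The sum of the products of the shares and the aligned noise is determined, up to a translation of
the noise, by the products of the data. -/
theorem exists_alignedNoise_shift {lam kap mu X' ℓ Kc p m n : ℕ} (hX : 0 < X') (hp : 0 < p)
    (hm : 0 < m) (hn : 0 < n) (hpk : p ∣ kap) (f : Fin ℓ × Fin Kc → F)
    {A A' : Fin (ℓ * Kc) → Matrix (Fin lam) (Fin kap) F}
    {B B' : Fin (ℓ * Kc) → Matrix (Fin kap) (Fin mu) F} (hAB : ∀ l, A l * B l = A' l * B' l)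
    (ZA : Fin ℓ → Fin X' → Matrix (Fin (lam / m)) (Fin (kap / p)) F)
    (ZB : Fin ℓ → Fin X' → Matrix (Fin (kap / p)) (Fin (mu / n)) F) :
    ∃ D : NoiseLabel X' ℓ Kc p m n → Matrix (Fin (lam / m)) (Fin (mu / n)) F,
      ∀ i j a, (∀ x, f x ≠ a) → ∑ l, ∑ t, shareA p m n f a A ZA l i t * shareB p m n f a B ZB l t j =
        ∑ l, ∑ t, shareA p m n f a A' ZA l i t * shareB p m n f a B' ZB l t j +
          alignedNoise p m n f a D i j := by
  choose Pol hPol hval using fun i j => exists_sum_share_mul hX hp hm hn f A B ZA ZB i j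
  choose Pol' hPol' hval' using fun i j => exists_sum_share_mul hX hp hm hn f A' B' ZA ZB i j
  obtain ⟨D, hD⟩ := exists_noise_eq
    (fun i j => (degree_sub_le (Pol i j) (Pol' i j)).trans_lt (max_lt (hPol i j) (hPol' i j)))
    (fun i j x => ∑ t, entryPolyA p m (A (finProdFinEquiv x)) i t *
        entryPolyB p m n (B (finProdFinEquiv x)) t j -
      ∑ t, entryPolyA p m (A' (finProdFinEquiv x)) i t *
        entryPolyB p m n (B' (finProdFinEquiv x)) t j) (by
      intro i j x e h
      obtain ⟨m₀, n₀, h⟩ := exists_of_mem_desired h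
      rw [h hp, coeff_sub, coeff_sum_entryPoly_mul hpk, coeff_sum_entryPoly_mul hpk, hAB, sub_self])
  refine ⟨D, fun i j a ha => ?_⟩
  -- The noise `ZA`, `ZB` is the same for both data, so the products of noise polynomials cancel.
  -- Hence `D` has to cover only degrees below `numPolyNoise`, although those products may have a
  -- larger degree.
  rw [hval i j a ha, hval' i j a ha, alignedNoise_apply, (hD i j).1]
  simp only [coeff_coefPoly_mul_congr f _ ((hD i j).2 _), mul_sub, coeff_sub,
    Finset.sum_sub_distrib, eval_sub]
  ring

theorem isPrivate [Fintype F] {S X' ℓ Kc p m n lam kap mu : ℕ} (hX : 0 < X') (hp : 0 < p)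
    (hm : 0 < m) (hn : 0 < n) (hpk : p ∣ kap) {f : Fin ℓ × Fin Kc → F} {α : Fin S → F}
    (hf : ∀ x s, f x ≠ α s) (g : Fin S)
    (dec : ∀ T : Finset (Fin S), (T → Fin (lam / m) × Fin (mu / n) → F) →
      (Fin (ℓ * Kc) → Matrix (Fin lam) (Fin mu) F)) :
    (gcsaNA X' ℓ Kc p m n lam kap mu f α g dec).IsPrivate := by
  classical
  intro pA pB
  rw [Scheme.law_eq]
  refine condMutualInfo_eq_zero_of_equiv _ _ _ _
    (fun d : (Fin (ℓ * Kc) → Matrix (Fin lam) (Fin kap) F) ×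
      (Fin (ℓ * Kc) → Matrix (Fin kap) (Fin mu) F) => fun l => d.1 l * d.2 l)
    (fun _ _ => rfl) fun d d' hd => ?_
  choose D hD using fun (a : Fin ℓ × Fin X' × Fin (lam / m) × Fin (kap / p) → F)
    (b : Fin ℓ × Fin X' × Fin (kap / p) × Fin (mu / n) → F) =>
    exists_alignedNoise_shift hX hp hm hn hpk f (congrFun hd)
      (fun l x => Matrix.of fun i j => a (l, x, i, j)) (fun l x => Matrix.of fun i j => b (l, x, i, j))
  -- The translation of the server noise depends on the source noise, so the bijection is a shear
  -- that fixes the source noise.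
  refine ⟨Equiv.prodShear (Equiv.refl _) fun a => Equiv.prodShear (Equiv.refl _) fun b =>
    Equiv.addRight fun s v => D a b v.1.1 v.1.2.1 v.1.2.2, fun z => ?_⟩
  funext s e
  have h1 := hD z.1 z.2.1 e.1 e.2 (α s) fun x => hf x s
  have h2 := alignedNoise_add f (α s) (fun v => Matrix.of fun i j => z.2.2 g ⟨(v, i, j), rfl⟩)
    (D z.1 z.2.1) e.1 e.2
  refine Eq.trans (congrArg (· + _) h1) (Eq.trans ?_ (congrArg (_ + ·) h2.symm))
  rw [add_assoc, add_comm (alignedNoise p m n f (α s) (D z.1 z.2.1) e.1 e.2)]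
  rfl

end GCSA

/-! ### The decoding functions and the recovery threshold. -/

open Polynomial

namespace GCSA

variable {F : Type u} [Field F]

/-- The points are distinct, so the product to be inverted has a nonzero constant term. -/
theorem exists_correction {ℓ Kc p m n : ℕ} {f : Fin ℓ × Fin Kc → F} (hf : Function.Injective f)
    (x : Fin ℓ × Fin Kc) : ∃ G : F[X], G.natDegree ≤ p * m * n ∧
      X ^ (p * m * n) ∣ (coefPoly p m n f x *
        ∏ x' ∈ Finset.univ.erase x, (X + C (f x' - f x)) ^ (p * m * n)) * G - 1 := by
  refine exists_inverse_mod_X_pow ?_ _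
  rw [mul_coeff_zero]
  refine mul_ne_zero (eval_linear_product_ne_zero _ (fun k' => f (x.1, k')) _ _ fun k hk h => ?_)
    (eval_linear_product_ne_zero _ _ _ _ fun x' hx' h => Finset.ne_of_mem_erase hx' (hf h))
  exact Finset.ne_of_mem_erase hk (Prod.ext_iff.1 (hf h)).2

/-- The number of the block of the desired product with a given row and column. -/
def desiredExponent {lam mu p m n : ℕ} (hm : m ∣ lam) (hn : n ∣ mu) (i : Fin lam) (j : Fin mu) : ℕ :=
  p - 1 + p * ((blockEquiv hm).symm i).1 + p * m * ((blockEquiv hn).symm j).1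

theorem desiredExponent_lt {lam mu p m n : ℕ} (hp : 0 < p) (hm : m ∣ lam) (hn : n ∣ mu)
    (i : Fin lam) (j : Fin mu) : desiredExponent (p := p) hm hn i j < p * m * n := by
  have h1 := Nat.mul_le_mul_left p (Nat.succ_le_of_lt ((blockEquiv hm).symm i).1.2)
  have h2 := Nat.mul_le_mul_left (p * m) (Nat.succ_le_of_lt ((blockEquiv hn).symm j).1.2)
  rw [Nat.mul_succ] at h1 h2
  rw [desiredExponent]
  omega

/-- The decoding function for the servers in `T`: the desired products are coefficients of local
expansions of the answers, with the corrections `G`. -/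
noncomputable def decoder {S ℓ Kc p m n lam mu : ℕ} (hm : m ∣ lam) (hn : n ∣ mu)
    (f : Fin ℓ × Fin Kc → F) (α : Fin S → F) (G : Fin ℓ × Fin Kc → F[X]) (T : Finset (Fin S))
    (y : T → Fin (lam / m) × Fin (mu / n) → F) (L : Fin (ℓ * Kc)) : Matrix (Fin lam) (Fin mu) F :=
  Matrix.of fun i j => (localExpansion f (fun s : T => α s) (p * m * n) (G (finProdFinEquiv.symm L))
    (fun s => y s (((blockEquiv hm).symm i).2, ((blockEquiv hn).symm j).2))
    (finProdFinEquiv.symm L)).coeff (desiredExponent (p := p) hm hn i j)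

theorem desiredExponent_blockEquiv {lam mu p m n : ℕ} (hm : m ∣ lam) (hn : n ∣ mu) (m₀ : Fin m)
    (i : Fin (lam / m)) (n₀ : Fin n) (j : Fin (mu / n)) :
    desiredExponent (p := p) hm hn (blockEquiv hm (m₀, i)) (blockEquiv hn (n₀, j)) =
      p - 1 + p * m₀ + p * m * n₀ := by
  simp [desiredExponent]

theorem decoder_apply {S ℓ Kc p m n lam mu : ℕ} (hm : m ∣ lam) (hn : n ∣ mu)
    (f : Fin ℓ × Fin Kc → F) (α : Fin S → F) (G : Fin ℓ × Fin Kc → F[X]) (T : Finset (Fin S))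
    (y : T → Fin (lam / m) × Fin (mu / n) → F) (x : Fin ℓ × Fin Kc) (m₀ : Fin m)
    (i : Fin (lam / m)) (n₀ : Fin n) (j : Fin (mu / n)) :
    decoder (p := p) hm hn f α G T y (finProdFinEquiv x) (blockEquiv hm (m₀, i))
        (blockEquiv hn (n₀, j)) =
      (localExpansion f (fun s : T => α s) (p * m * n) (G x) (fun s => y s (i, j)) x).coeff
        (p - 1 + p * m₀ + p * m * n₀) := by
  simp only [decoder, Matrix.of_apply, desiredExponent_blockEquiv, Equiv.symm_apply_apply]

theorem degE_lt {p m n : ℕ} (hp : 0 < p) (hm : 0 < m) (hn : 0 < n) : degE p m n < p * m * n := by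
  have h1 : p * m * 1 ≤ p * m * n := Nat.mul_le_mul_left _ hn
  have h2 : p * 1 ≤ p * m := Nat.mul_le_mul_left _ hm
  rw [degE]
  omega

theorem numPolyNoise_le {X' Kc p m n : ℕ} (hK : 0 < Kc) (hp : 0 < p) (hm : 0 < m) (hn : 0 < n) :
    numPolyNoise X' Kc p m n ≤ p * m * n * Kc + X' := by
  have h := degE_lt hp hm hn
  obtain ⟨K, rfl⟩ := Nat.exists_eq_add_of_lt hK
  rw [numPolyNoise]
  simp only [zero_add, Nat.add_sub_cancel, Nat.mul_succ]
  omega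

theorem natDegree_noiseProduct_le {ι : Type*} {X' ℓ Kc : ℕ} (hX : 0 < X') (f : Fin ℓ × Fin Kc → F)
    (r : ℕ) (s : Finset ι) (za zb : Fin ℓ → ι → Fin X' → F) :
    (∑ l, (∏ k, (C (f (l, k)) - X) ^ r) * ∑ t ∈ s, noisePoly (za l t) * noisePoly (zb l t)).natDegree ≤
      r * Kc + (2 * X' - 2) := by
  refine natDegree_sum_le_of_forall_le _ _ fun l _ => natDegree_mul_le.trans (add_le_add ?_
    (natDegree_sum_le_of_forall_le _ _ fun t _ => natDegree_mul_le.trans ?_))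
  · have := natDegree_prod_C_sub_X_pow_le Finset.univ (fun k => f (l, k)) r
    rwa [Finset.card_univ, Fintype.card_fin, mul_comm] at this
  · have h1 := natDegree_noisePoly_lt hX (za l t)
    have h2 := natDegree_noisePoly_lt hX (zb l t)
    omega

/-- The threshold comes from counting. The products of noise polynomials dominate the polynomial
part, whose degree is below `p * m * n * Kc + (2 * X' - 1)`; the `ℓ * Kc` poles of order `p * m * n`
account for the rest of `R`. -/
theorem coeff_localExpansion_answer {S X' ℓ Kc p m n lam kap mu : ℕ} (hX : 0 < X') (hK : 0 < Kc)
    (hp : 0 < p) (hm : 0 < m) (hn : 0 < n) {f : Fin ℓ × Fin Kc → F} {α : Fin S → F}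
    (hα : Function.Injective α) (hfα : ∀ x s, f x ≠ α s) {T : Finset (Fin S)}
    (hT : T.card = p * m * n * (ℓ + 1) * Kc + 2 * X' - 1)
    (A : Fin (ℓ * Kc) → Matrix (Fin lam) (Fin kap) F)
    (B : Fin (ℓ * Kc) → Matrix (Fin kap) (Fin mu) F)
    (ZA : Fin ℓ → Fin X' → Matrix (Fin (lam / m)) (Fin (kap / p)) F)
    (ZB : Fin ℓ → Fin X' → Matrix (Fin (kap / p)) (Fin (mu / n)) F)
    (Z : NoiseLabel X' ℓ Kc p m n → Matrix (Fin (lam / m)) (Fin (mu / n)) F)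
    (i : Fin (lam / m)) (j : Fin (mu / n)) {x : Fin ℓ × Fin Kc} {G : F[X]}
    (hG : X ^ (p * m * n) ∣ (coefPoly p m n f x *
        ∏ x' ∈ Finset.univ.erase x, (X + C (f x' - f x)) ^ (p * m * n)) * G - 1)
    {e : ℕ} (he : e < p * m * n) :
    (localExpansion f (fun s : T => α s) (p * m * n) G (fun s =>
      ∑ l, ∑ t, shareA p m n f (α s) A ZA l i t * shareB p m n f (α s) B ZB l t j +
        alignedNoise p m n f (α s) Z i j) x).coeff e =
      (∑ t, entryPolyA p m (A (finProdFinEquiv x)) i t *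
        entryPolyB p m n (B (finProdFinEquiv x)) t j + undesiredPoly Z i j x).coeff e := by
  obtain ⟨Pol, hPol, hval⟩ := exists_sum_share_mul hX hp hm hn f A B ZA ZB i j
  refine coeff_localExpansion (M := p * m * n * Kc + (2 * X' - 1))
    (c := coefPoly p m n f) (W := fun x => ∑ t, entryPolyA p m (A (finProdFinEquiv x)) i t *
        entryPolyB p m n (B (finProdFinEquiv x)) t j + undesiredPoly Z i j x)
    (Pol := Pol + (noisePoly fun y => Z (.inl y) i j) +
      ∑ l, (∏ k, (C (f (l, k)) - X) ^ (p * m * n)) *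
        ∑ t, (noisePoly fun y => ZA l y i t) * noisePoly fun y => ZB l y t j)
    (hα.comp Subtype.val_injective) (fun x s => hfα x s) ?_ ?_ (fun s => ?_) hG he
  · have hN := numPolyNoise_le (X' := X') hK hp hm hn
    rw [← mem_degreeLT]
    refine Submodule.add_mem _ (Submodule.add_mem _ (mem_degreeLT.2 ?_) (mem_degreeLT.2 ?_))
      (mem_degreeLT.2 ?_)
    · exact hPol.trans_le (by exact_mod_cast by omega)
    · rcases Nat.eq_zero_or_pos (numPolyNoise X' Kc p m n) with h0 | h0
      · rw [noisePoly, Finset.sum_eq_zero fun y _ => (Fin.elim0 (h0 ▸ y)), degree_zero]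
        exact WithBot.bot_lt_coe _
      · refine degree_le_natDegree.trans_lt ?_
        have := natDegree_noisePoly_lt h0 fun y => Z (.inl y) i j
        exact_mod_cast (by omega)
    · refine degree_le_natDegree.trans_lt ?_
      have := natDegree_noiseProduct_le hX f (p * m * n) Finset.univ (fun l t y => ZA l y i t)
        fun l t y => ZB l y t j
      exact_mod_cast (by omega)
  · rw [Fintype.card_coe, hT, Fintype.card_prod, Fintype.card_fin, Fintype.card_fin]
    have : p * m * n * (ℓ + 1) * Kc = p * m * n * Kc + ℓ * Kc * (p * m * n) := by ring
    omega
  · rw [hval _ fun x => hfα x s, alignedNoise_apply]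
    simp only [mul_add, coeff_add, Finset.sum_add_distrib, eval_add, eval_finsetSum, eval_mul,
      eval_prod, eval_pow, eval_sub, eval_C, eval_X, Function.comp_apply]
    ring

theorem undesiredPoly_coeff_of_mem {r c X' ℓ Kc p m n e : ℕ}
    (Z : NoiseLabel X' ℓ Kc p m n → Matrix (Fin r) (Fin c) F) (i : Fin r) (j : Fin c)
    (x : Fin ℓ × Fin Kc) (h : e + 1 ∈ desired p m n) : (undesiredPoly Z i j x).coeff e = 0 := by
  rw [undesiredPoly, coeff_polyOf]
  split_ifs with h1 h2
  · exact absurd h h2.2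
  · rfl
  · rfl

open Classical in
/-- The decoding functions that use exactly `R` answers. -/
noncomputable def decoders {S ℓ Kc p m n lam mu : ℕ} (R : ℕ) (hm : m ∣ lam) (hn : n ∣ mu)
    (f : Fin ℓ × Fin Kc → F) (α : Fin S → F) (G : Fin ℓ × Fin Kc → F[X]) (T : Finset (Fin S))
    (y : T → Fin (lam / m) × Fin (mu / n) → F) : Fin (ℓ * Kc) → Matrix (Fin lam) (Fin mu) F :=
  (if T.card = R then decoder (p := p) hm hn f α G T else 0) y

theorem recoversFrom {S X' ℓ Kc p m n lam kap mu R : ℕ} (hX : 0 < X') (hK : 0 < Kc)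
    (hp : 0 < p) (hm : 0 < m) (hn : 0 < n) (hmd : m ∣ lam) (hpd : p ∣ kap) (hnd : n ∣ mu)
    {f : Fin ℓ × Fin Kc → F} {α : Fin S → F}
    (hα : Function.Injective α) (hfα : ∀ x s, f x ≠ α s) (g : Fin S)
    (hR : R = p * m * n * (ℓ + 1) * Kc + 2 * X' - 1) {G : Fin ℓ × Fin Kc → F[X]}
    (hG : ∀ x, X ^ (p * m * n) ∣ (coefPoly p m n f x *
        ∏ x' ∈ Finset.univ.erase x, (X + C (f x' - f x)) ^ (p * m * n)) * G x - 1)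
    {T : Finset (Fin S)} (hT : T.card = R) :
    (gcsaNA X' ℓ Kc p m n lam kap mu f α g
      (decoders (p := p) R hmd hnd f α G)).RecoversFrom T := by
  intro ω
  funext L
  obtain ⟨x, rfl⟩ := finProdFinEquiv.surjective L
  ext i j
  obtain ⟨⟨m₀, i⟩, rfl⟩ := (blockEquiv hmd).surjective i
  obtain ⟨⟨n₀, j⟩, rfl⟩ := (blockEquiv hnd).surjective j
  have he := desiredExponent_lt hp hmd hnd (blockEquiv hmd (m₀, i)) (blockEquiv hnd (n₀, j))
  have h := coeff_localExpansion_answer hX hK hp hm hn hα hfα (hT.trans hR) ω.A ω.B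
    (fun l x => Matrix.of fun i j => ω.ZA (l, x, i, j))
    (fun l x => Matrix.of fun i j => ω.ZB (l, x, i, j))
    (fun v => Matrix.of fun i j => ω.W g ⟨(v, i, j), rfl⟩) i j (hG x) he
  have e1 := desiredExponent_blockEquiv (p := p) hmd hnd m₀ i n₀ j
  rw [coeff_add, undesiredPoly_coeff_of_mem, add_zero, e1, coeff_sum_entryPoly_mul hpd] at h
  · rw [blockEquiv_apply, blockEquiv_apply]
    refine Eq.trans ?_ h
    rw [← blockEquiv_apply hmd (m₀, i), ← blockEquiv_apply hnd (n₀, j)]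
    refine (congrFun (congrFun (congrFun (congrFun (if_pos hT) _) _) _) _).trans ?_
    exact decoder_apply hmd hnd f α G T _ x m₀ i n₀ j
  · rw [e1]
    exact ⟨m₀, n₀, by omega⟩

/-- Minimality is a property of the chosen decoding functions: on sets of any size other than `R`
they return zero, which is wrong as soon as some product is nonzero. -/
theorem isRecoveryThreshold {S X' ℓ Kc p m n lam kap mu R : ℕ} (hX : 0 < X') (hℓ : 0 < ℓ)
    (hK : 0 < Kc) (hp : 0 < p) (hm : 0 < m) (hn : 0 < n) (hlam : 0 < lam) (hkap : 0 < kap)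
    (hmu : 0 < mu) (hmd : m ∣ lam) (hpd : p ∣ kap) (hnd : n ∣ mu)
    {f : Fin ℓ × Fin Kc → F} {α : Fin S → F}
    (hα : Function.Injective α) (hfα : ∀ x s, f x ≠ α s) (g : Fin S)
    (hR : R = p * m * n * (ℓ + 1) * Kc + 2 * X' - 1) (hRS : R ≤ S) {G : Fin ℓ × Fin Kc → F[X]}
    (hG : ∀ x, X ^ (p * m * n) ∣ (coefPoly p m n f x *
        ∏ x' ∈ Finset.univ.erase x, (X + C (f x' - f x)) ^ (p * m * n)) * G x - 1) :
    (gcsaNA X' ℓ Kc p m n lam kap mu f α g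
      (decoders (p := p) R hmd hnd f α G)).IsRecoveryThreshold R := by
  refine ⟨fun T hT => recoversFrom hX hK hp hm hn hmd hpd hnd hα hfα g hR hG hT, fun r hr => ?_⟩
  by_contra! hlt
  obtain ⟨T, -, hT⟩ := Finset.exists_subset_card_eq (s := (Finset.univ : Finset (Fin S))) (n := r)
    (by rw [Finset.card_univ, Fintype.card_fin]; omega)
  set A : Matrix (Fin lam) (Fin kap) F := Matrix.of fun _ _ => 1 with hA
  -- Only the first row of `B` is nonzero, so the entries of `A * B` are `1` in every
  -- characteristic; two matrices of ones would give `kap`, which may vanish in `F`.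
  set B : Matrix (Fin kap) (Fin mu) F := Matrix.of fun t _ => if t = ⟨0, hkap⟩ then 1 else 0 with hB
  have hAB : (A * B) ⟨0, hlam⟩ ⟨0, hmu⟩ = 1 := by simp [hA, hB, Matrix.mul_apply]
  have h := hr T hT ⟨fun _ => A, fun _ => B, fun _ => 0, fun _ => 0, fun _ _ => 0⟩
  have h' := congrFun (congrFun (congrFun h ⟨0, Nat.mul_pos hℓ hK⟩) ⟨0, hlam⟩) ⟨0, hmu⟩
  replace h' := (congrFun (congrFun (congrFun (congrFun (if_neg (by omega)) _) _) _) _).symm.trans h'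
  exact zero_ne_one (h'.trans hAB)

theorem isSMBMMCode [Fintype F] {S X' ℓ Kc p m n lam kap mu R : ℕ} (hX : 0 < X') (hK : 0 < Kc)
    (hp : 0 < p) (hm : 0 < m) (hn : 0 < n) (hmd : m ∣ lam) (hpd : p ∣ kap) (hnd : n ∣ mu)
    {f : Fin ℓ × Fin Kc → F} {α : Fin S → F}
    (hα : Function.Injective α) (hfα : ∀ x s, f x ≠ α s) (g : Fin S)
    (hR : R = p * m * n * (ℓ + 1) * Kc + 2 * X' - 1) (hRS : R ≤ S) {G : Fin ℓ × Fin Kc → F[X]}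
    (hG : ∀ x, X ^ (p * m * n) ∣ (coefPoly p m n f x *
        ∏ x' ∈ Finset.univ.erase x, (X + C (f x' - f x)) ^ (p * m * n)) * G x - 1) :
    (gcsaNA X' ℓ Kc p m n lam kap mu f α g
      (decoders (p := p) R hmd hnd f α G)).IsSMBMMCode X' where
  correct := by
    obtain ⟨T, -, hT⟩ := Finset.exists_subset_card_eq (s := (Finset.univ : Finset (Fin S))) (n := R)
      (by rw [Finset.card_univ, Fintype.card_fin]; exact hRS)
    exact ⟨T, recoversFrom hX hK hp hm hn hmd hpd hnd hα hfα g hR hG hT⟩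
  secure := isSecure f hα g _
  stronglySecure := isStronglySecure f α g _
  isPrivate := isPrivate hX hp hm hn hpd hfα g _

end GCSA

/-! ### Existence of the points, and communication costs. -/

namespace GCSA

theorem exists_points {F : Type*} [Fintype F] {S ℓ Kc : ℕ} (h : S + ℓ * Kc ≤ Fintype.card F) :
    ∃ (f : Fin ℓ × Fin Kc → F) (α : Fin S → F), Function.Injective (Sum.elim f α) := by
  obtain ⟨e⟩ := Function.Embedding.nonempty_of_card_le
    (α := (Fin ℓ × Fin Kc) ⊕ Fin S) (β := F) (by simpa [add_comm] using h)
  refine ⟨fun x => e (.inl x), fun s => e (.inr s), ?_⟩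
  convert e.injective
  funext x
  cases x <;> rfl

variable {F : Type u} [Field F] {S X' ℓ Kc p m n lam kap mu : ℕ}

variable (f : Fin ℓ × Fin Kc → F) (α : Fin S → F) (g : Fin S)
  (dec : ∀ T : Finset (Fin S), (T → Fin (lam / m) × Fin (mu / n) → F) →
    (Fin (ℓ * Kc) → Matrix (Fin lam) (Fin mu) F))

theorem uploadCostA_eq (hℓ : 0 < ℓ) (hlam : 0 < lam) (hkap : 0 < kap)
    (hm : m ∣ lam) (hp : p ∣ kap) :
    (gcsaNA X' ℓ Kc p m n lam kap mu f α g dec).uploadCostA = (S : ℚ) / (Kc * p * m) := by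
  have h : ∀ s, Fintype.card ((gcsaNA X' ℓ Kc p m n lam kap mu f α g dec).ιA s) =
      ℓ * (lam / m * (kap / p)) := fun s =>
    (Fintype.card_congr (Equiv.refl (Fin ℓ × Fin (lam / m) × Fin (kap / p)))).trans (by simp)
  rw [Scheme.uploadCostA, Finset.sum_congr rfl fun s _ => h s, Finset.sum_const, Finset.card_univ,
    Fintype.card_fin, smul_eq_mul]
  obtain ⟨a, rfl⟩ := hm
  obtain ⟨b, rfl⟩ := hp
  have h1 : 0 < m := Nat.pos_of_mul_pos_right hlam
  have h2 : 0 < p := Nat.pos_of_mul_pos_right hkap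
  have h3 : 0 < a := Nat.pos_of_mul_pos_left hlam
  have h4 : 0 < b := Nat.pos_of_mul_pos_left hkap
  rw [Nat.mul_div_cancel_left _ h1, Nat.mul_div_cancel_left _ h2]
  push_cast
  field_simp

theorem uploadCostB_eq (hℓ : 0 < ℓ) (hkap : 0 < kap) (hmu : 0 < mu)
    (hp : p ∣ kap) (hn : n ∣ mu) :
    (gcsaNA X' ℓ Kc p m n lam kap mu f α g dec).uploadCostB = (S : ℚ) / (Kc * p * n) := by
  have h : ∀ s, Fintype.card ((gcsaNA X' ℓ Kc p m n lam kap mu f α g dec).ιB s) =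
      ℓ * (kap / p * (mu / n)) := fun s =>
    (Fintype.card_congr (Equiv.refl (Fin ℓ × Fin (kap / p) × Fin (mu / n)))).trans (by simp)
  rw [Scheme.uploadCostB, Finset.sum_congr rfl fun s _ => h s, Finset.sum_const, Finset.card_univ,
    Fintype.card_fin, smul_eq_mul]
  obtain ⟨a, rfl⟩ := hn
  obtain ⟨b, rfl⟩ := hp
  have h1 : 0 < n := Nat.pos_of_mul_pos_right hmu
  have h2 : 0 < p := Nat.pos_of_mul_pos_right hkap
  have h3 : 0 < a := Nat.pos_of_mul_pos_left hmu
  have h4 : 0 < b := Nat.pos_of_mul_pos_left hkap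
  rw [Nat.mul_div_cancel_left _ h1, Nat.mul_div_cancel_left _ h2]
  push_cast
  field_simp

theorem serverCommCost_eq (hlam : 0 < lam) (hmu : 0 < mu) (hm : m ∣ lam) (hn : n ∣ mu) :
    (gcsaNA X' ℓ Kc p m n lam kap mu f α g dec).serverCommCost =
      ((S : ℚ) - 1) / (ℓ * Kc * m * n) := by
  classical
  have h : ∀ s s', Fintype.card ((gcsaNA X' ℓ Kc p m n lam kap mu f α g dec).ιM s' s) =
      if s' = g then lam / m * (mu / n) else 0 := by
    intro s s'
    split_ifs with hs
    · exact (Fintype.card_congr ((Equiv.subtypeUnivEquiv fun _ => hs :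
        {_e : Fin (lam / m) × Fin (mu / n) // s' = g} ≃ _))).trans (by simp)
    · exact Fintype.card_eq_zero_iff.2 ⟨fun e => hs e.2⟩
  have h0 : ∑ s, ∑ s' ∈ Finset.univ.erase s,
      Fintype.card ((gcsaNA X' ℓ Kc p m n lam kap mu f α g dec).ιM s' s) =
      (S - 1) * (lam / m * (mu / n)) := by
    simp only [h, Finset.sum_ite_eq', Finset.mem_erase, Finset.mem_univ, and_true]
    rw [← Finset.sum_filter, Finset.sum_const, smul_eq_mul]
    congr 1
    rw [Finset.filter_ne, Finset.card_erase_of_mem (Finset.mem_univ g), Finset.card_univ,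
      Fintype.card_fin]
  have hS : 1 ≤ S := (Nat.zero_le g.1).trans_lt g.2
  rw [Scheme.serverCommCost, h0]
  obtain ⟨a, rfl⟩ := hm
  obtain ⟨b, rfl⟩ := hn
  have h1 : 0 < m := Nat.pos_of_mul_pos_right hlam
  have h2 : 0 < n := Nat.pos_of_mul_pos_right hmu
  have h3 : 0 < a := Nat.pos_of_mul_pos_left hlam
  have h4 : 0 < b := Nat.pos_of_mul_pos_left hmu
  rw [Nat.mul_div_cancel_left _ h1, Nat.mul_div_cancel_left _ h2]
  push_cast [hS]
  field_simp

theorem downloadCost_eq {R : ℕ} (hR : R ≤ S) (hlam : 0 < lam) (hmu : 0 < mu) (hm : m ∣ lam)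
    (hn : n ∣ mu) : (gcsaNA X' ℓ Kc p m n lam kap mu f α g dec).downloadCost R =
      (R : ℚ) / (ℓ * Kc * m * n) := by
  classical
  have h : ∀ s, Fintype.card ((gcsaNA X' ℓ Kc p m n lam kap mu f α g dec).ιY s) =
      lam / m * (mu / n) := fun s =>
    (Fintype.card_congr (Equiv.refl (Fin (lam / m) × Fin (mu / n)))).trans (by simp)
  have h0 : (Finset.univ.powersetCard R).sup (fun T : Finset (Fin S) => ∑ s ∈ T,
      Fintype.card ((gcsaNA X' ℓ Kc p m n lam kap mu f α g dec).ιY s)) =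
      R * (lam / m * (mu / n)) := by
    simp only [h, Finset.sum_const, smul_eq_mul]
    rw [Finset.sup_congr rfl fun T hT => by rw [(Finset.mem_powersetCard.1 hT).2],
      Finset.sup_const]
    exact Finset.powersetCard_nonempty.2 (by simpa using hR)
  rw [Scheme.downloadCost, h0]
  obtain ⟨a, rfl⟩ := hm
  obtain ⟨b, rfl⟩ := hn
  have h1 : 0 < m := Nat.pos_of_mul_pos_right hlam
  have h2 : 0 < n := Nat.pos_of_mul_pos_right hmu
  have h3 : 0 < a := Nat.pos_of_mul_pos_left hlam
  have h4 : 0 < b := Nat.pos_of_mul_pos_left hmu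
  rw [Nat.mul_div_cancel_left _ h1, Nat.mul_div_cancel_left _ h2]
  push_cast
  field_simp

end GCSA

/-! ### Complexity of encoding and of the answers. -/

section Encoding

open Polynomial

variable {F : Type*} [Field F] {ι : Type*}

theorem costLE_mul_fixed {k μ N : ℕ} (hμ : PolyMulCost F k μ) {P : (ι → F) → F[X]}
    (hP : CostLE N fun x j => (P x).coeff j) (hdeg : ∀ x, (P x).natDegree < 2 ^ k) {G : F[X]}
    (hG : G.natDegree ≤ 2 ^ k) :
    CostLE (N + μ * 2 ^ k * (k + 1)) fun x j => (P x * G).coeff j :=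
  ((hμ G hG).comp hP).congr fun x j => by rw [polyOf_coeff_of_natDegree_lt (hdeg x)]

theorem costLE_multi_eval {μ W q S : ℕ} (hμ : ∀ k ≤ W, PolyMulCost F k μ) (hq : q + 1 ≤ W)
    (α : Fin S → F) (hS : S ≤ 2 ^ q) :
    CostLE (2 ^ q * (q + 1) * (4 * ((μ + 1) * (W + 1))))
      fun (x : ℕ → F) s => (polyOf (2 ^ q) x).eval (α s) := by
  have h := costLE_multi_modByMonic hμ (fun s => X - C (α s)) 0 q (by omega) Finset.univ
    (by rwa [Finset.card_univ, Fintype.card_fin]) (fun s _ => (natDegree_X_sub_C _).le)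
    fun s _ => monic_X_sub_C _
  rw [zero_add] at h
  refine (h.reindex fun s => (s, 0)).congr fun x s => ?_
  rw [if_pos (Finset.mem_univ _), modByMonic_X_sub_C_eq_C_eval, coeff_C_zero]

/-- The coefficients of a polynomial whose coefficients are inputs, at distinct exponents. -/
theorem costLE_coeff_sum {κ : Type*} [Fintype κ] {ε : κ → ℕ} (hε : Function.Injective ε)
    (σ : κ → ι) :
    CostLE 0 fun (x : ι → F) j => (∑ y, C (x (σ y)) * X ^ ε y : F[X]).coeff j := by
  classical
  rcases isEmpty_or_nonempty κ with hκ | hκ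
  · exact (costLE_const fun _ => (0 : F)).congr fun x j => by simp
  refine (costLE_reindex_or (fun j => ∃ y, ε y = j) (fun j => σ (Function.invFun ε j)) (0 : F)).congr
    fun x j => ?_
  simp only [finsetSum_coeff, coeff_C_mul_X_pow]
  split_ifs with h
  · obtain ⟨y, rfl⟩ := h
    rw [Function.leftInverse_invFun hε, Finset.sum_eq_single y]
    · simp
    · intro y' _ hy'
      exact if_neg fun h => hy' (hε h.symm)
    · simp
  · exact (Finset.sum_eq_zero fun y _ => if_neg fun hy => h ⟨y, hy.symm⟩).symm

/-- The numerator of a share. -/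
noncomputable def shareNumerator {Kc : ℕ} (f : Fin Kc → F) (r : ℕ) (V : Fin Kc → F[X]) (Z : F[X]) :
    F[X] :=
  ∑ k, (V k).comp (C (f k) - X) * ∏ k' ∈ Finset.univ.erase k, (C (f k') - X) ^ r +
    Z * ∏ k, (C (f k) - X) ^ r

theorem eval_shareNumerator {Kc : ℕ} {f : Fin Kc → F} (r : ℕ) (V : Fin Kc → F[X]) (Z : F[X]) {a : F}
    (ha : ∀ k, f k ≠ a) : (shareNumerator f r V Z).eval a = (∏ k, (f k - a) ^ r) *
      (∑ k, ((f k - a) ^ r)⁻¹ * (V k).eval (f k - a) + Z.eval a) := by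
  rw [shareNumerator, eval_add, eval_mul, eval_finsetSum, mul_add, Finset.mul_sum]
  simp only [eval_mul, eval_comp, eval_prod, eval_pow, eval_sub, eval_C, eval_X]
  congr 1
  · refine Finset.sum_congr rfl fun k _ => ?_
    rw [← Finset.mul_prod_erase _ _ (Finset.mem_univ k)]
    have := pow_ne_zero r (sub_ne_zero.2 (ha k))
    field_simp
  · rw [mul_comm]

theorem two_pow_clog_le {x : ℕ} (hx : 0 < x) : 2 ^ Nat.clog 2 x ≤ 2 * x := by
  rcases Nat.lt_or_ge 1 x with h | h
  · have h1 := Nat.pow_pred_clog_lt_self one_lt_two h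
    have h2 : 0 < Nat.clog 2 x := Nat.clog_pos one_lt_two h
    obtain ⟨c, hc⟩ := Nat.exists_eq_add_of_lt h2
    rw [hc, zero_add, Nat.pred_succ] at h1
    rw [hc, zero_add, pow_succ]
    omega
  · have : x = 1 := by omega
    simp [this]

theorem natDegree_C_sub_X_pow_le (c : F) (r : ℕ) : ((C c - X : F[X]) ^ r).natDegree ≤ r :=
  natDegree_pow_le.trans (by simpa using Nat.mul_le_mul_left r (natDegree_C_sub_X_le c))

theorem costLE_sum_comp {μ W w j Kc r : ℕ} (hμ : ∀ k ≤ W, PolyMulCost F k μ) (hwj : w + j ≤ W)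
    (hrw : r ≤ 2 ^ w) (hKj : Kc ≤ 2 ^ j) (f : Fin Kc → F) {V : Fin Kc → (ι → F) → F[X]}
    (hV : ∀ k, CostLE 0 fun x j => (V k x).coeff j) (hVdeg : ∀ k x, (V k x).natDegree < r) :
    CostLE (Kc * (2 ^ w * w * ((μ + 1) * (W + 1))) + 2 ^ (w + j) * j * ((μ + 1) * (W + 1)))
      fun x e => (∑ k, (V k x).comp (C (f k) - X) *
        ∏ k' ∈ Finset.univ.erase k, (C (f k') - X) ^ r).coeff e := by
  have hcd : ∀ k x, polyOf (2 ^ w) ((V k x).comp (C (f k) - X)).coeff =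
      (V k x).comp (C (f k) - X) := fun k x =>
    polyOf_coeff_of_natDegree_lt
      (((natDegree_comp_C_sub_X_le _ _).trans_lt (hVdeg k x)).trans_le hrw)
  have h1 : ∀ k, CostLE (2 ^ w * w * ((μ + 1) * (W + 1)))
      fun (x : ι → F) e => ((V k x).comp (C (f k) - X)).coeff e := by
    intro k
    have h := (costLE_comp_linear hμ (C (f k) - X) (natDegree_C_sub_X_le _) w (by omega)).comp (hV k)
    rw [zero_add] at h
    refine h.congr fun x e => ?_
    rw [polyOf_coeff_of_natDegree_lt ((hVdeg k x).trans_le hrw)]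
  have h2 := costLE_family h1
  rw [Finset.sum_const, Finset.card_univ, Fintype.card_fin, smul_eq_mul] at h2
  have h3 := (costLE_sum_mul_prod hμ (fun k => (C (f k) - X) ^ r) w j hwj Finset.univ
    (by rwa [Finset.card_univ, Fintype.card_fin])
    fun k _ => (natDegree_C_sub_X_pow_le _ _).trans hrw).comp h2
  have e : ∀ x : ι → F, ∑ k, polyOf (2 ^ w) (fun e => ((V k x).comp (C (f k) - X)).coeff e) *
      ∏ k' ∈ Finset.univ.erase k, (C (f k') - X) ^ r = ∑ k, (V k x).comp (C (f k) - X) *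
        ∏ k' ∈ Finset.univ.erase k, (C (f k') - X) ^ r := fun x =>
    Finset.sum_congr rfl fun k _ => congrArg (· * _) (hcd k x)
  simp only [e] at h3
  exact h3

/-- The numerator is assembled from shifted data polynomials and the noise times the common
denominator, then evaluated at all points and scaled by the constants `c s`. In units of `2 ^ q * (q
+ 1) * ((μ + 1) * (q + 4))` the stages cost at most `2 + 1 + 1 + 4 + 1`. -/
theorem costLE_shareNumerator {μ q S Kc r x₀ : ℕ} (hμ : ∀ k ≤ q + 3, PolyMulCost F k μ)
    (hS : S ≤ 2 ^ q) (hr : 0 < r) (hKc : 0 < Kc) (hx : r * Kc + x₀ ≤ S) (h2 : 2 * (r * Kc) ≤ S)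
    (f : Fin Kc → F) {V : Fin Kc → (ι → F) → F[X]} (hV : ∀ k, CostLE 0 fun x j => (V k x).coeff j)
    (hVdeg : ∀ k x, (V k x).natDegree < r) {Z : (ι → F) → F[X]}
    (hZ : CostLE 0 fun x j => (Z x).coeff j) (hZdeg : ∀ x, (Z x).natDegree < x₀) (α : Fin S → F)
    (c : Fin S → F) :
    CostLE (10 * (2 ^ q * (q + 1) * ((μ + 1) * (q + 4))))
      fun x s => c s * (shareNumerator f r (fun k => V k x) (Z x)).eval (α s) := by
  classical
  have hKr : r * Kc ≤ 2 ^ q := by omega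
  set w := Nat.clog 2 r with hw
  set j := Nat.clog 2 Kc with hj
  have hrw : r ≤ 2 ^ w := Nat.le_pow_clog one_lt_two r
  have hKj : Kc ≤ 2 ^ j := Nat.le_pow_clog one_lt_two Kc
  -- Rounding both `r` and `Kc` up to powers of two may cost a factor `4`; half of it is absorbed by
  -- `2 * (r * Kc) ≤ S`.
  have hwj : 2 ^ (w + j) ≤ 2 ^ (q + 1) := by
    calc 2 ^ (w + j) = 2 ^ w * 2 ^ j := pow_add _ _ _
      _ ≤ 2 * r * (2 * Kc) := Nat.mul_le_mul (two_pow_clog_le hr) (two_pow_clog_le hKc)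
      _ = 2 * (2 * (r * Kc)) := by ring
      _ ≤ 2 * 2 ^ q := Nat.mul_le_mul_left _ (by omega)
      _ = 2 ^ (q + 1) := by ring
  have hwj' : w + j ≤ q + 1 := (Nat.pow_le_pow_iff_right one_lt_two).1 hwj
  have hcd : ∀ k x, ((V k x).comp (C (f k) - X)).natDegree < r := fun k x =>
    (natDegree_comp_C_sub_X_le _ _).trans_lt (hVdeg k x)
  have h3' := costLE_sum_comp hμ (w := w) (j := j) (by omega) hrw hKj f hV hVdeg
  have hΔ := natDegree_prod_C_sub_X_pow_le Finset.univ f r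
  rw [Finset.card_univ, Fintype.card_fin, mul_comm Kc] at hΔ
  have h4 := costLE_mul_fixed (hμ q (by omega)) hZ (fun x => (hZdeg x).trans_le (by omega))
    (hΔ.trans hKr)
  have h5 := h3'.add_of_support h4 (Finset.range S) fun e he x => by
    refine coeff_eq_zero_of_natDegree_lt (natDegree_mul_le.trans_lt ?_)
    have := hZdeg x
    rw [Finset.mem_range] at he
    omega
  have hdeg : ∀ x, (shareNumerator f r (fun k => V k x) (Z x)).degree < (2 ^ q : ℕ) := by
    intro x
    rw [← mem_degreeLT]
    refine Submodule.add_mem _ (mem_degreeLT.2 ?_) (mem_degreeLT.2 ?_)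
    · have h := degree_sum_mul_prod_lt (g := fun k => (C (f k) - X) ^ r) Finset.univ
        (fun k _ => natDegree_C_sub_X_pow_le (f k) r) fun k => ((V k x).comp (C (f k) - X)).coeff
      rw [Finset.card_univ, Fintype.card_fin, mul_comm Kc] at h
      simp only [polyOf_coeff_of_natDegree_lt (hcd _ x)] at h
      exact h.trans_le (by exact_mod_cast hKr)
    · refine degree_le_natDegree.trans_lt ?_
      have h := (natDegree_mul_le (p := Z x) (q := ∏ k, (C (f k) - X) ^ r)).trans_lt
        (Nat.add_lt_add_of_lt_of_le (hZdeg x) hΔ)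
      exact_mod_cast (by omega)
  have h6 := ((costLE_multi_eval hμ (by omega) α hS).comp h5).const_mul_of_support c Finset.univ
    (by simp)
  refine (h6.mono ?_).congr fun x s => ?_
  · simp only [Finset.card_univ, Fintype.card_fin, Finset.card_range, zero_add, add_assoc]
    set K := (μ + 1) * (q + 4) with hK
    have e1 : Kc * (2 ^ w * w * K) + 2 ^ (w + j) * j * K ≤ 2 * (2 ^ q * (q + 1) * K) := by
      calc Kc * (2 ^ w * w * K) + 2 ^ (w + j) * j * K
          ≤ 2 ^ j * (2 ^ w * w * K) + 2 ^ (w + j) * j * K := by gcongr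
        _ = 2 ^ (w + j) * (w + j) * K := by ring
        _ ≤ 2 ^ (q + 1) * (q + 1) * K := by gcongr
        _ = 2 * (2 ^ q * (q + 1) * K) := by ring
    have e2 : μ * 2 ^ q * (q + 1) ≤ 2 ^ q * (q + 1) * K := by
      have : μ ≤ K := by
        calc μ ≤ (μ + 1) * 1 := by omega
          _ ≤ K := Nat.mul_le_mul_left _ (by omega)
      calc μ * 2 ^ q * (q + 1) = 2 ^ q * (q + 1) * μ := by ring
        _ ≤ _ := Nat.mul_le_mul_left _ this
    have e3 : S ≤ 2 ^ q * (q + 1) * K := by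
      calc S ≤ 2 ^ q * 1 * 1 := by omega
        _ ≤ 2 ^ q * (q + 1) * K := by
          gcongr
          · omega
          · exact Nat.mul_pos (by omega) (by omega)
    have e4 : 2 ^ q * (q + 1) * (4 * K) = 4 * (2 ^ q * (q + 1) * K) := by ring
    rw [e4]
    generalize 2 ^ q * (q + 1) * K = Y at *
    omega
  · congr 1
    rw [← polyOf_coeff_self (hdeg x)]
    rfl

/-- Real bound for the cost of the quasi-linear algorithms in length `b`. -/
theorem quasilinear_le {b μ : ℕ} (hb : 3 ≤ b) (hμ : 0 < μ) :
    ((2 ^ Nat.clog 2 b * (Nat.clog 2 b + 1) * ((μ + 1) * (Nat.clog 2 b + 4)) : ℕ) : ℝ) ≤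
      100 * (b * (μ * Real.log b ^ 2)) := by
  have h1 : ((2 ^ Nat.clog 2 b : ℕ) : ℝ) ≤ 2 * b := by exact_mod_cast two_pow_clog_le (by omega)
  have h2 := clog_two_sub_one_mul_log_two_le b
  have h3 := log_ge_of_three_le hb
  have h4 := Real.log_two_gt_d9
  set q := Nat.clog 2 b
  set t := Real.log b
  have hq : (q : ℝ) ≤ 1.45 * t + 1 := by
    by_contra! hlt
    have : (1.45 * t) * 0.6931471803 < (q - 1 : ℝ) * Real.log 2 :=
      mul_lt_mul'' (by linarith) h4 (by linarith) (by norm_num)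
    linarith
  have hμ1 : (μ : ℝ) + 1 ≤ 2 * μ := by
    have : (1 : ℝ) ≤ μ := by exact_mod_cast hμ
    linarith
  have hb0 : (0 : ℝ) ≤ b := Nat.cast_nonneg _
  have hm0 : (0 : ℝ) ≤ μ := Nat.cast_nonneg _
  have ht : 0 ≤ t := by linarith
  push_cast at h1 ⊢
  have e1 : (q : ℝ) + 1 ≤ 3.4 * t := by linarith
  have e2 : (q : ℝ) + 4 ≤ 6.2 * t := by linarith
  calc (2 : ℝ) ^ q * (q + 1) * ((μ + 1) * (q + 4))
      ≤ 2 * b * (3.4 * t) * (2 * μ * (6.2 * t)) := by gcongr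
    _ = 84.32 * (b * (μ * t ^ 2)) := by ring
    _ ≤ _ := by
      have : 0 ≤ b * (μ * t ^ 2) := by positivity
      linarith

end Encoding

namespace GCSA

open Polynomial

variable {F : Type u} [Field F] {S X' ℓ Kc p m n lam kap mu : ℕ}

/-- Distinct blocks have distinct exponents, so each coefficient is a single input or zero, and no
operation is needed. -/
theorem costLE_entryPolyA {ι : Type*} (hp : 0 < p) (σ : Fin lam → Fin kap → ι) (i : Fin (lam / m))
    (t : Fin (kap / p)) : CostLE 0 fun (x : ι → F) e =>
      (entryPolyA p m (Matrix.of fun a b => x (σ a b)) i t).coeff e := by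
  have hε : Function.Injective fun y : Fin m × Fin p => (y.2 : ℕ) + p * y.1 := by
    rintro ⟨a, b⟩ ⟨a', b'⟩ h
    dsimp only at h
    have h1 : (b : ℕ) = b' := by
      have := congrArg (· % p) h
      simpa [Nat.add_mul_mod_self_left, Nat.mod_eq_of_lt b.2, Nat.mod_eq_of_lt b'.2] using this
    rw [h1] at h
    exact Prod.ext (Fin.ext (Nat.eq_of_mul_eq_mul_left hp (Nat.add_left_cancel h))) (Fin.ext h1)
  refine (costLE_coeff_sum (F := F) hε fun y => σ (blockIdx y.1 i) (blockIdx y.2 t)).congr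
    fun x e => ?_
  rw [Fintype.sum_prod_type]
  rfl

theorem costLE_entryPolyB {ι : Type*} (hp : 0 < p) (hm : 0 < m) (σ : Fin kap → Fin mu → ι)
    (t : Fin (kap / p)) (j : Fin (mu / n)) : CostLE 0 fun (x : ι → F) e =>
      (entryPolyB p m n (Matrix.of fun a b => x (σ a b)) t j).coeff e := by
  have hε : Function.Injective fun y : Fin p × Fin n => (p - 1 - (y.1 : ℕ)) + p * m * y.2 := by
    rintro ⟨a, b⟩ ⟨a', b'⟩ h
    dsimp only at h
    have h0 := (exponent_eq_iff (m := m) (m₁ := 0) (m₂ := 0) (n₁ := b) (n₂ := b') a'.2 a.2 hm hm).1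
      (by
        have := a.2
        have := a'.2
        omega)
    exact Prod.ext (Fin.ext h0.1.symm) (Fin.ext h0.2.2)
  refine (costLE_coeff_sum (F := F) hε fun y => σ (blockIdx y.1 t) (blockIdx y.2 j)).congr
    fun x e => ?_
  rw [Fintype.sum_prod_type]
  rfl

theorem costLE_noisePoly {ι : Type*} (σ : Fin X' → ι) :
    CostLE 0 fun (x : ι → F) e => (noisePoly fun y => x (σ y)).coeff e :=
  costLE_coeff_sum Fin.val_injective σ

theorem costLE_shareA {μ q : ℕ} (f : Fin ℓ × Fin Kc → F) (α : Fin S → F)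
    (hμ : ∀ k ≤ q + 3, PolyMulCost F k μ) (hX : 0 < X') (hK : 0 < Kc)
    (hp : 0 < p) (hm : 0 < m) (hn : 0 < n) (hS : S ≤ 2 ^ q) (hx : p * m * n * Kc + X' ≤ S)
    (h2 : 2 * (p * m * n * Kc) ≤ S) (hf : ∀ x s, f x ≠ α s) :
    CostLE (ℓ * (lam / m * (kap / p)) * (10 * (2 ^ q * (q + 1) * ((μ + 1) * (q + 4)))))
      (fun (x : (Fin (ℓ * Kc) × Fin lam × Fin kap) ⊕
          (Fin ℓ × Fin X' × Fin (lam / m) × Fin (kap / p)) → F)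
        (o : (_s : Fin S) × (Fin ℓ × Fin (lam / m) × Fin (kap / p))) =>
        shareA p m n f (α o.1) (fun l => Matrix.of fun i j => x (.inl (l, i, j)))
          (fun l v => Matrix.of fun i j => x (.inr (l, v, i, j))) o.2.1 o.2.2.1 o.2.2.2) := by
  have hpm : p * m * 1 ≤ p * m * n := Nat.mul_le_mul_left _ hn
  have h1 : ∀ y : Fin ℓ × Fin (lam / m) × Fin (kap / p),
      CostLE (10 * (2 ^ q * (q + 1) * ((μ + 1) * (q + 4))))
        fun (x : (Fin (ℓ * Kc) × Fin lam × Fin kap) ⊕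
          (Fin ℓ × Fin X' × Fin (lam / m) × Fin (kap / p)) → F) (s : Fin S) =>
        1 * (shareNumerator (fun k => f (y.1, k)) (p * m * n) (fun k => entryPolyA p m
          (Matrix.of fun a b => x (.inl (finProdFinEquiv (y.1, k), a, b))) y.2.1 y.2.2)
          (noisePoly fun v => x (.inr (y.1, v, y.2.1, y.2.2)))).eval (α s) := by
    intro y
    have e1 := fun k => costLE_entryPolyA (F := F) (m := m) hp (fun a b =>
      (.inl (finProdFinEquiv (y.1, k), a, b) : (Fin (ℓ * Kc) × Fin lam × Fin kap) ⊕
        (Fin ℓ × Fin X' × Fin (lam / m) × Fin (kap / p)))) y.2.1 y.2.2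
    have e2 := costLE_noisePoly (F := F) fun v => (.inr (y.1, v, y.2.1, y.2.2) :
      (Fin (ℓ * Kc) × Fin lam × Fin kap) ⊕ (Fin ℓ × Fin X' × Fin (lam / m) × Fin (kap / p)))
    exact costLE_shareNumerator (x₀ := X') hμ hS
      (Nat.mul_pos (Nat.mul_pos hp hm) hn) hK hx h2 (fun k => f (y.1, k)) e1
      (fun k x => (natDegree_entryPolyA_lt hp hm _ _ _).trans_le (by omega)) e2
      (fun x => natDegree_noisePoly_lt hX _) α fun _ => 1
  have h := costLE_family h1
  rw [Finset.sum_const, Finset.card_univ, Fintype.card_prod, Fintype.card_prod, Fintype.card_fin,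
    Fintype.card_fin, Fintype.card_fin, smul_eq_mul] at h
  refine (h.reindex fun o : (_s : Fin S) × (Fin ℓ × Fin (lam / m) × Fin (kap / p)) =>
    (o.2, o.1)).congr fun x o => ?_
  rw [one_mul, eval_shareNumerator _ _ _ fun k => hf (o.2.1, k) o.1, shareA_apply]
  rfl

/-- As for `A`, except that the common denominator is not cancelled; its inverse value at each `α s`
is a constant of the program. -/
theorem costLE_shareB {μ q : ℕ} (f : Fin ℓ × Fin Kc → F) (α : Fin S → F)
    (hμ : ∀ k ≤ q + 3, PolyMulCost F k μ) (hX : 0 < X') (hK : 0 < Kc)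
    (hp : 0 < p) (hm : 0 < m) (hn : 0 < n) (hS : S ≤ 2 ^ q) (hx : p * m * n * Kc + X' ≤ S)
    (h2 : 2 * (p * m * n * Kc) ≤ S) (hf : ∀ x s, f x ≠ α s) :
    CostLE (ℓ * (kap / p * (mu / n)) * (10 * (2 ^ q * (q + 1) * ((μ + 1) * (q + 4)))))
      (fun (x : (Fin (ℓ * Kc) × Fin kap × Fin mu) ⊕
          (Fin ℓ × Fin X' × Fin (kap / p) × Fin (mu / n)) → F)
        (o : (_s : Fin S) × (Fin ℓ × Fin (kap / p) × Fin (mu / n))) =>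
        shareB p m n f (α o.1) (fun l => Matrix.of fun i j => x (.inl (l, i, j)))
          (fun l v => Matrix.of fun i j => x (.inr (l, v, i, j))) o.2.1 o.2.2.1 o.2.2.2) := by
  have hpm : p * m * 1 ≤ p * m * n := Nat.mul_le_mul_left _ hn
  have hpm' : p * 1 ≤ p * m := Nat.mul_le_mul_left _ hm
  have h1 : ∀ y : Fin ℓ × Fin (kap / p) × Fin (mu / n),
      CostLE (10 * (2 ^ q * (q + 1) * ((μ + 1) * (q + 4))))
        fun (x : (Fin (ℓ * Kc) × Fin kap × Fin mu) ⊕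
          (Fin ℓ × Fin X' × Fin (kap / p) × Fin (mu / n)) → F) (s : Fin S) =>
        (∏ k, (f (y.1, k) - α s) ^ (p * m * n))⁻¹ *
        (shareNumerator (fun k => f (y.1, k)) (p * m * n) (fun k => entryPolyB p m n
          (Matrix.of fun a b => x (.inl (finProdFinEquiv (y.1, k), a, b))) y.2.1 y.2.2)
          (noisePoly fun v => x (.inr (y.1, v, y.2.1, y.2.2)))).eval (α s) := by
    intro y
    have e1 := fun k => costLE_entryPolyB (F := F) (n := n) hp hm (fun a b =>
      (.inl (finProdFinEquiv (y.1, k), a, b) : (Fin (ℓ * Kc) × Fin kap × Fin mu) ⊕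
        (Fin ℓ × Fin X' × Fin (kap / p) × Fin (mu / n)))) y.2.1 y.2.2
    have e2 := costLE_noisePoly (F := F) fun v => (.inr (y.1, v, y.2.1, y.2.2) :
      (Fin (ℓ * Kc) × Fin kap × Fin mu) ⊕ (Fin ℓ × Fin X' × Fin (kap / p) × Fin (mu / n)))
    exact costLE_shareNumerator (x₀ := X') hμ hS
      (Nat.mul_pos (Nat.mul_pos hp hm) hn) hK hx h2 (fun k => f (y.1, k)) e1
      (fun k x => (natDegree_entryPolyB_le _ _ _).trans_lt (by omega)) e2
      (fun x => natDegree_noisePoly_lt hX _) α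
      fun s => (∏ k, (f (y.1, k) - α s) ^ (p * m * n))⁻¹
  have h := costLE_family h1
  rw [Finset.sum_const, Finset.card_univ, Fintype.card_prod, Fintype.card_prod, Fintype.card_fin,
    Fintype.card_fin, Fintype.card_fin, smul_eq_mul] at h
  refine (h.reindex fun o : (_s : Fin S) × (Fin ℓ × Fin (kap / p) × Fin (mu / n)) =>
    (o.2, o.1)).congr fun x o => ?_
  rw [eval_shareNumerator _ _ _ fun k => hf (o.2.1, k) o.1, inv_mul_cancel_left₀, shareB_apply]
  · rfl
  · exact Finset.prod_ne_zero_iff.2 fun k _ => pow_ne_zero _ (sub_ne_zero.2 (hf (o.2.1, k) o.1))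

theorem costLE_sum_mul_add {ι a b c d : Type*} [Fintype a] [Fintype b] [Fintype c]
    [Fintype d] (σ : c → a → d → ι) (τ : c → d → b → ι) (ρ : a → b → ι) :
    CostLE (Fintype.card a * Fintype.card b * (2 * (Fintype.card c * Fintype.card d) + 1))
      fun (x : ι → F) (e : a × b) =>
        ∑ l, ∑ t, x (σ l e.1 t) * x (τ l t e.2) + x (ρ e.1 e.2) := by
  have h := CostLE.sum_of_support (F := F) (o := a × b) (Finset.univ : Finset (c × d))
    (fun y _ => costLE_mul (F := F) (o := a × b)
      (fun e => σ y.1 e.1 y.2) (fun e => τ y.1 y.2 e.2)) Finset.univ (by simp)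
  have h' := h.add_of_support (costLE_reindex fun e => ρ e.1 e.2) Finset.univ (by simp)
  refine (h'.mono ?_).congr fun x e => ?_
  · simp only [Finset.sum_const, Finset.card_univ, Fintype.card_prod, smul_eq_mul]
    apply le_of_eq
    ring
  · rw [Fintype.sum_prod_type]

variable (f : Fin ℓ × Fin Kc → F) (α : Fin S → F) (g : Fin S)
  (dec : ∀ T : Finset (Fin S), (T → Fin (lam / m) × Fin (mu / n) → F) →
    (Fin (ℓ * Kc) → Matrix (Fin lam) (Fin mu) F))

theorem encodesAWithin {μ : ℕ} {C : ℝ} (hS3 : 3 ≤ S) (hμ0 : 0 < μ)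
    (hμ : ∀ k ≤ Nat.clog 2 S + 3, PolyMulCost F k μ)
    (hC : (μ : ℝ) * Real.log S ^ 2 ≤ C * softLogSq F S) (hX : 0 < X') (hK : 0 < Kc)
    (hp : 0 < p) (hm : 0 < m) (hn : 0 < n) (hmd : m ∣ lam) (hpd : p ∣ kap)
    (hx : p * m * n * Kc + X' ≤ S)
    (h2 : 2 * (p * m * n * Kc) ≤ S) (hf : ∀ x s, f x ≠ α s) :
    (gcsaNA X' ℓ Kc p m n lam kap mu f α g dec).EncodesAWithin
      (1000 * C * (lam * kap * S * softLogSq F S / (Kc * p * m))) := by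
  refine (costLE_shareA (ℓ := ℓ) (lam := lam) (kap := kap) f α hμ hX hK hp hm hn (Nat.le_pow_clog one_lt_two S) hx h2
    hf).computableWithin ?_
  have h := quasilinear_le hS3 hμ0
  obtain ⟨a, rfl⟩ := hmd
  obtain ⟨b, rfl⟩ := hpd
  rw [Nat.mul_div_cancel_left _ hm, Nat.mul_div_cancel_left _ hp]
  rw [Nat.cast_mul, Nat.cast_mul 10]
  have h3 : ((2 ^ Nat.clog 2 S * (Nat.clog 2 S + 1) * ((μ + 1) * (Nat.clog 2 S + 4)) : ℕ) : ℝ) ≤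
      100 * (S * (C * softLogSq F S)) := h.trans (by gcongr)
  calc _ ≤ ((ℓ * (a * b) : ℕ) : ℝ) * ((10 : ℕ) * (100 * (S * (C * softLogSq F S)))) := by gcongr
    _ = _ := by
      have h1 : (Kc : ℝ) ≠ 0 := by positivity
      have h2 : (p : ℝ) ≠ 0 := by positivity
      have h3 : (m : ℝ) ≠ 0 := by positivity
      push_cast
      field_simp
      ring

theorem encodesBWithin {μ : ℕ} {C : ℝ} (hS3 : 3 ≤ S) (hμ0 : 0 < μ)
    (hμ : ∀ k ≤ Nat.clog 2 S + 3, PolyMulCost F k μ)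
    (hC : (μ : ℝ) * Real.log S ^ 2 ≤ C * softLogSq F S) (hX : 0 < X') (hK : 0 < Kc)
    (hp : 0 < p) (hm : 0 < m) (hn : 0 < n) (hpd : p ∣ kap) (hnd : n ∣ mu)
    (hx : p * m * n * Kc + X' ≤ S)
    (h2 : 2 * (p * m * n * Kc) ≤ S) (hf : ∀ x s, f x ≠ α s) :
    (gcsaNA X' ℓ Kc p m n lam kap mu f α g dec).EncodesBWithin
      (1000 * C * (kap * mu * S * softLogSq F S / (Kc * p * n))) := by
  refine (costLE_shareB (ℓ := ℓ) (mu := mu) (kap := kap) f α hμ hX hK hp hm hn (Nat.le_pow_clog one_lt_two S) hx h2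
    hf).computableWithin ?_
  have h := quasilinear_le hS3 hμ0
  obtain ⟨a, rfl⟩ := hnd
  obtain ⟨b, rfl⟩ := hpd
  rw [Nat.mul_div_cancel_left _ hn, Nat.mul_div_cancel_left _ hp]
  rw [Nat.cast_mul, Nat.cast_mul 10]
  have h3 : ((2 ^ Nat.clog 2 S * (Nat.clog 2 S + 1) * ((μ + 1) * (Nat.clog 2 S + 4)) : ℕ) : ℝ) ≤
      100 * (S * (C * softLogSq F S)) := h.trans (by gcongr)
  calc _ ≤ ((ℓ * (b * a) : ℕ) : ℝ) * ((10 : ℕ) * (100 * (S * (C * softLogSq F S)))) := by gcongr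
    _ = _ := by
      have h1 : (Kc : ℝ) ≠ 0 := by positivity
      have h2 : (p : ℝ) ≠ 0 := by positivity
      have h3 : (n : ℝ) ≠ 0 := by positivity
      push_cast
      field_simp
      ring

theorem answersWithin {C : ℝ} (hC : 3 ≤ C) (hℓ : 0 < ℓ) (hK : 0 < Kc) (hp : 0 < p) (hm : 0 < m)
    (hn : 0 < n) (hkap : 0 < kap) (hmd : m ∣ lam) (hpd : p ∣ kap) (hnd : n ∣ mu) :
    (gcsaNA X' ℓ Kc p m n lam kap mu f α g dec).AnswersWithin
      (C * (lam * kap * mu / (Kc * p * m * n))) := by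
  intro s
  refine (costLE_sum_mul_add (F := F) (ι := (Fin ℓ × Fin (lam / m) × Fin (kap / p)) ⊕
      (Fin ℓ × Fin (kap / p) × Fin (mu / n)) ⊕
      ((s' : Fin S) × {_e : Fin (lam / m) × Fin (mu / n) // s' = g}))
    (fun l i t => .inl (l, i, t)) (fun l t j => .inr (.inl (l, t, j)))
    fun i j => .inr (.inr ⟨g, (i, j), rfl⟩)).computableWithin ?_
  simp only [Fintype.card_fin]
  obtain ⟨a, rfl⟩ := hmd
  obtain ⟨b, rfl⟩ := hpd
  obtain ⟨c, rfl⟩ := hnd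
  have hb : 0 < b := Nat.pos_of_mul_pos_left hkap
  rw [Nat.mul_div_cancel_left _ hm, Nat.mul_div_cancel_left _ hp, Nat.mul_div_cancel_left _ hn]
  have h1 : a * c * (2 * (ℓ * b) + 1) ≤ a * c * (3 * (ℓ * b)) :=
    Nat.mul_le_mul_left _ (by have := Nat.mul_pos hℓ hb; omega)
  calc ((a * c * (2 * (ℓ * b) + 1) : ℕ) : ℝ) ≤ ((a * c * (3 * (ℓ * b)) : ℕ) : ℝ) := by
        exact_mod_cast h1
    _ = 3 * (a * c * (ℓ * b) : ℝ) := by push_cast; ring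
    _ ≤ C * (a * c * (ℓ * b) : ℝ) := by gcongr
    _ = _ := by
      have h1 : (Kc : ℝ) ≠ 0 := by positivity
      have h2 : (p : ℝ) ≠ 0 := by positivity
      have h3 : (m : ℝ) ≠ 0 := by positivity
      have h4 : (n : ℝ) ≠ 0 := by positivity
      push_cast
      field_simp

end GCSA

/-! ### Complexity of decoding. -/

section Decoding

open Polynomial

variable {F : Type*} [Field F] {ι κ : Type*} [Fintype ι] [DecidableEq ι] [Fintype κ]

/-- The scaling factors are constants, one multiplication per value. Then `costLE_sum_mul_prod`
applies with blocks of length `2 ^ 0`, the form `polyOf 1` used in `scaledInterpolation`. -/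
theorem costLE_scaledInterpolation {μ W q : ℕ} (hμ : ∀ k ≤ W, PolyMulCost F k μ) (hq : q ≤ W)
    (hι : Fintype.card ι ≤ 2 ^ q) (f : κ → F) (α : ι → F) (r : ℕ) :
    CostLE (Fintype.card ι + 2 ^ q * q * ((μ + 1) * (W + 1)))
      fun (y : ι → F) e => (scaledInterpolation f α r y).coeff e := by
  have h1 := ((costLE_reindex (F := F) (id : ι → ι)).const_mul_of_support
    (fun s => (∏ k, (f k - α s) ^ r) * (∏ s' ∈ Finset.univ.erase s, (α s - α s'))⁻¹)
    Finset.univ (by simp)).reindex (Prod.fst : ι × ℕ → ι)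
  have h2 := (costLE_sum_mul_prod hμ (fun s => X - C (α s)) 0 q (by omega) Finset.univ
    (by rwa [Finset.card_univ]) fun s _ => (natDegree_X_sub_C _).le).comp h1
  rw [zero_add, zero_add, Finset.card_univ] at h2
  exact h2

theorem costLE_localExpansion [DecidableEq κ] {μ q r : ℕ}
    (hμ : ∀ k ≤ q + 3, PolyMulCost F k μ)
    (hι : Fintype.card ι ≤ 2 ^ q) (hr : 0 < r)
    (hκ : 0 < Fintype.card κ) (hκι : r * Fintype.card κ ≤ Fintype.card ι)
    (f : κ → F) (α : ι → F) {G : κ → F[X]} (hG : ∀ k, (G k).natDegree ≤ r) :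
    CostLE (22 * (2 ^ q * (q + 1) * ((μ + 1) * (q + 4))))
      fun (y : ι → F) (o : κ × ℕ) => (localExpansion f α r (G o.1) y o.1).coeff o.2 := by
  set K := (μ + 1) * (q + 4) with hK
  set w := Nat.clog 2 r with hw
  have hrw : r ≤ 2 ^ w := Nat.le_pow_clog one_lt_two r
  have hwr : 2 ^ w ≤ 2 * r := two_pow_clog_le hr
  have hrι : r ≤ Fintype.card ι := (Nat.le_mul_of_pos_right r hκ).trans hκι
  have hwq : w ≤ q := by
    rw [hw]
    exact Nat.clog_le_of_le_pow (hrι.trans hι)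
  -- One level beyond `q` makes up for rounding `r` to a power of two, so that `2 ^ j` still exceeds
  -- or equals the number of moduli.
  obtain ⟨j, hj⟩ : ∃ j, w + j = q + 1 := ⟨q + 1 - w, by omega⟩
  have hκj : Fintype.card κ ≤ 2 ^ j := by
    have h1 : 2 * r * Fintype.card κ ≤ 2 * r * 2 ^ j := by
      calc 2 * r * Fintype.card κ = 2 * (r * Fintype.card κ) := by ring
        _ ≤ 2 * 2 ^ q := Nat.mul_le_mul_left _ (hκι.trans hι)
        _ = 2 ^ w * 2 ^ j := by rw [← pow_add, hj]; ring
        _ ≤ 2 * r * 2 ^ j := Nat.mul_le_mul_right _ hwr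
    exact Nat.le_of_mul_le_mul_left h1 (by omega)
  have h1 := costLE_scaledInterpolation hμ (by omega) hι f α r
  have h2 := (costLE_multi_modByMonic hμ (fun k => (X - C (f k)) ^ r) w j (by omega) Finset.univ
    (by rwa [Finset.card_univ]) (fun k _ => by rwa [natDegree_pow, natDegree_X_sub_C, mul_one])
    fun k _ => (monic_X_sub_C _).pow r).comp h1
  have hrem : ∀ (P : F[X]) (k : κ), (P %ₘ (X - C (f k)) ^ r).natDegree < 2 ^ w := by
    intro P k
    refine lt_of_lt_of_le (natDegree_modByMonic_lt P ((monic_X_sub_C (f k)).pow r) fun h => ?_) ?_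
    · have := congrArg natDegree h
      rw [natDegree_pow, natDegree_X_sub_C, mul_one, natDegree_one] at this
      omega
    · rwa [natDegree_pow, natDegree_X_sub_C, mul_one]
  have hdeg : ∀ y : ι → F, polyOf (2 ^ (w + j)) (scaledInterpolation f α r y).coeff =
      scaledInterpolation f α r y := fun y => polyOf_coeff_self
    ((degree_scaledInterpolation_lt f α r y).trans_le (by
      rw [hj, pow_succ]
      exact_mod_cast (by omega)))
  have h2' := h2.congr (H := fun y (o : κ × ℕ) =>
      (scaledInterpolation f α r y %ₘ (X - C (f o.1)) ^ r).coeff o.2) fun y o => by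
    rw [if_pos (Finset.mem_univ _), hdeg y]
  have h3 : ∀ k, CostLE (2 ^ w * w * K + μ * 2 ^ w * (w + 1))
      fun (z : κ × ℕ → F) e =>
        (((polyOf (2 ^ w) fun i => z (k, i)).comp (C (f k) - X)) * G k).coeff e := by
    intro k
    have h := (costLE_comp_linear hμ (C (f k) - X) (natDegree_C_sub_X_le _) w (by omega)).comp
      (costLE_reindex (F := F) (fun i => (k, i)))
    rw [zero_add] at h
    refine costLE_mul_fixed (hμ w (by omega)) h (fun x => ?_) ((hG k).trans hrw)
    exact (natDegree_comp_C_sub_X_le _ _).trans_lt (natDegree_polyOf_two_pow_lt w _)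
  have h4 := (costLE_family h3).comp h2'
  rw [Finset.sum_const, Finset.card_univ, smul_eq_mul] at h4
  refine (h4.mono ?_).congr fun y o => ?_
  · have hK1 : μ + 1 ≤ K := Nat.le_mul_of_pos_right _ (by omega)
    have e1 : 2 ^ q * 1 * 1 ≤ 2 ^ q * (q + 1) * K := by
      gcongr <;> omega
    have e2 : 2 ^ q * q * K ≤ 2 ^ q * (q + 1) * K := by gcongr; omega
    have e3 : 2 ^ (w + j) * (j + 1) * (4 * K) ≤ 16 * (2 ^ q * (q + 1) * K) := by
      calc 2 ^ (w + j) * (j + 1) * (4 * K) ≤ 2 ^ (q + 1) * (2 * (q + 1)) * (4 * K) := by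
            rw [hj]
            gcongr
            omega
        _ = 16 * (2 ^ q * (q + 1) * K) := by ring
    have e4 : Fintype.card κ * (2 ^ w * w * K + μ * 2 ^ w * (w + 1)) ≤
        4 * (2 ^ q * (q + 1) * K) := by
      calc Fintype.card κ * (2 ^ w * w * K + μ * 2 ^ w * (w + 1))
          ≤ 2 ^ j * (2 ^ w * (q + 1) * K + K * 2 ^ w * (q + 1)) := by
            gcongr <;> omega
        _ = 2 * (2 ^ (w + j) * (q + 1) * K) := by ring
        _ = 4 * (2 ^ q * (q + 1) * K) := by rw [hj]; ring
    have e5 : (μ + 1) * (q + 3 + 1) = K := rfl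
    rw [e5]
    generalize 2 ^ q * (q + 1) * K = Y at *
    omega
  · have : (polyOf (2 ^ w) fun i => (scaledInterpolation f α r y %ₘ (X - C (f o.1)) ^ r).coeff i) =
      scaledInterpolation f α r y %ₘ (X - C (f o.1)) ^ r :=
      polyOf_coeff_of_natDegree_lt (hrem _ _)
    rw [localExpansion, this]

end Decoding

namespace GCSA

open Polynomial

variable {F : Type u} [Field F] {S X' ℓ Kc p m n lam kap mu : ℕ}

theorem costLE_decoder {μ R : ℕ} (hμ : ∀ k ≤ Nat.clog 2 R + 3, PolyMulCost F k μ)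
    (hℓ : 0 < ℓ) (hK : 0 < Kc)
    (hp : 0 < p) (hm : 0 < m) (hn : 0 < n) (hmd : m ∣ lam) (hnd : n ∣ mu)
    (hR : p * m * n * (ℓ * Kc) ≤ R) (f : Fin ℓ × Fin Kc → F) (α : Fin S → F)
    {G : Fin ℓ × Fin Kc → F[X]} (hG : ∀ x, (G x).natDegree ≤ p * m * n) {T : Finset (Fin S)}
    (hT : T.card = R) :
    CostLE (lam / m * (mu / n) * (22 * (2 ^ Nat.clog 2 R * (Nat.clog 2 R + 1) *
        ((μ + 1) * (Nat.clog 2 R + 4)))))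
      fun (x : ((_s : T) × (Fin (lam / m) × Fin (mu / n))) → F)
        (o : Fin (ℓ * Kc) × Fin lam × Fin mu) =>
        decoder (p := p) hmd hnd f α G T (fun s i => x ⟨s, i⟩) o.1 o.2.1 o.2.2 := by
  have hr : 0 < p * m * n := Nat.mul_pos (Nat.mul_pos hp hm) hn
  have hc : Fintype.card T = R := by rw [Fintype.card_coe, hT]
  have hκ : Fintype.card (Fin ℓ × Fin Kc) = ℓ * Kc := by simp
  have h1 := costLE_localExpansion (ι := T) (κ := Fin ℓ × Fin Kc) (r := p * m * n) hμ
    (by rw [hc]; exact Nat.le_pow_clog one_lt_two R) hr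
    (by rw [hκ]; exact Nat.mul_pos hℓ hK) (by rw [hκ, hc]; exact hR) f (fun s : T => α s) hG
  have h2 : ∀ e : Fin (lam / m) × Fin (mu / n), CostLE (22 * (2 ^ Nat.clog 2 R *
      (Nat.clog 2 R + 1) * ((μ + 1) * (Nat.clog 2 R + 4))))
      fun (x : ((_s : T) × (Fin (lam / m) × Fin (mu / n))) → F) (o : (Fin ℓ × Fin Kc) × ℕ) =>
        (localExpansion f (fun s : T => α s) (p * m * n) (G o.1) (fun s => x ⟨s, e⟩) o.1).coeff
          o.2 := by
    intro e
    have := h1.comp (costLE_reindex (F := F) fun s : T =>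
      (⟨s, e⟩ : (_s : T) × (Fin (lam / m) × Fin (mu / n))))
    rwa [zero_add] at this
  have h3 := costLE_family h2
  rw [Finset.sum_const, Finset.card_univ, Fintype.card_prod, Fintype.card_fin, Fintype.card_fin,
    smul_eq_mul] at h3
  exact h3.reindex fun o : Fin (ℓ * Kc) × Fin lam × Fin mu =>
    ((((blockEquiv hmd).symm o.2.1).2, ((blockEquiv hnd).symm o.2.2).2),
      (finProdFinEquiv.symm o.1, desiredExponent (p := p) hmd hnd o.2.1 o.2.2))

theorem decodesWithin {μ R c : ℕ} {C : ℝ} (g : Fin S) (hR3 : 3 ≤ R) (hμ0 : 0 < μ)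
    (hμ : ∀ k ≤ Nat.clog 2 R + 3, PolyMulCost F k μ)
    (hC : (μ : ℝ) * Real.log R ^ 2 ≤ C * softLogSq F R)
    (hℓ : 0 < ℓ) (hK : 0 < Kc)
    (hp : 0 < p) (hm : 0 < m) (hn : 0 < n) (hmd : m ∣ lam) (hnd : n ∣ mu)
    (hR : R = p * m * n * (ℓ + 1) * Kc + 2 * X' - 1)
    (hc : X' ≤ c * (p * m * n * (ℓ * Kc))) (hX : 0 < X') (f : Fin ℓ × Fin Kc → F) (α : Fin S → F)
    {G : Fin ℓ × Fin Kc → F[X]} (hG : ∀ x, (G x).natDegree ≤ p * m * n) :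
    (gcsaNA X' ℓ Kc p m n lam kap mu f α g
      (decoders (p := p) R hmd hnd f α G)).DecodesWithin R
        (2200 * C * (2 + 2 * c) * (lam * mu * p * softLogSq F R)) := by
  intro T hT
  have he : p * m * n * (ℓ + 1) * Kc = p * m * n * (ℓ * Kc) + p * m * n * Kc := by ring
  have hR1 : p * m * n * (ℓ * Kc) ≤ R := by omega
  -- The bound `Kc ≤ ℓ * Kc` handles the extra group, and `hc` handles `2 * X'`. This is where the
  -- decoding constant depends on `c`.
  have hR2 : R ≤ (2 + 2 * c) * (p * m * n * (ℓ * Kc)) := by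
    have h1 : p * m * n * (1 * Kc) ≤ p * m * n * (ℓ * Kc) := by gcongr; omega
    rw [one_mul] at h1
    have h2 : (2 + 2 * c) * (p * m * n * (ℓ * Kc)) =
      2 * (p * m * n * (ℓ * Kc)) + 2 * (c * (p * m * n * (ℓ * Kc))) := by ring
    omega
  have h := costLE_decoder hμ hℓ hK hp hm hn hmd hnd hR1 f α hG hT
  have hdec : decoders (p := p) R hmd hnd f α G T = decoder (p := p) hmd hnd f α G T := by
    funext y
    exact congrFun (if_pos hT) y
  have h' := h.computableWithin (c := ((ℓ * Kc : ℕ) : ℝ) *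
    (2200 * C * (2 + 2 * c) * (lam * mu * p * softLogSq F R))) ?_
  · rw [← hdec] at h'
    exact h'
  have hq := quasilinear_le hR3 hμ0
  have hC0 : 0 ≤ C * softLogSq F R := le_trans (by positivity) hC
  obtain ⟨a, rfl⟩ := hmd
  obtain ⟨b, rfl⟩ := hnd
  rw [Nat.mul_div_cancel_left _ hm, Nat.mul_div_cancel_left _ hn]
  have h3 : ((2 ^ Nat.clog 2 R * (Nat.clog 2 R + 1) * ((μ + 1) * (Nat.clog 2 R + 4)) : ℕ) : ℝ) ≤
      100 * (R * (C * softLogSq F R)) := hq.trans (by gcongr)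
  have h4 : (R : ℝ) ≤ (2 + 2 * c) * (p * m * n * (ℓ * Kc)) := by exact_mod_cast hR2
  rw [Nat.cast_mul, Nat.cast_mul 22]
  calc _ ≤ ((a * b : ℕ) : ℝ) * ((22 : ℕ) * (100 * (((2 + 2 * c) * (p * m * n * (ℓ * Kc))) *
        (C * softLogSq F R)))) := by
        gcongr
        exact h3.trans (by gcongr)
    _ = _ := by
      push_cast
      ring

end GCSA

/-! ### Assembly of the theorem. -/

theorem ComputableWithin.mono {F ι o : Type*} [Field F] {N M : ℝ} {G : (ι → F) → (o → F)}
    (h : ComputableWithin N G) (hNM : N ≤ M) : ComputableWithin M G := by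
  obtain ⟨prog, out, hp, hG⟩ := h
  exact ⟨prog, out, hp.trans hNM, hG⟩

theorem theorem1 :
    ∃ (C : ℝ) (Cd : ℕ → ℝ), ∀ (F : Type u) [Field F] [Fintype F]
      (S X ℓ Kc p m n lam kap mu R : ℕ),
      0 < X → 0 < ℓ → 0 < Kc → 0 < p → 0 < m → 0 < n → 0 < lam → 0 < kap → 0 < mu →
      m ∣ lam → p ∣ kap → n ∣ mu → S + ℓ * Kc ≤ Fintype.card F →
      R = p * m * n * (ℓ + 1) * Kc + 2 * X - 1 → R ≤ S →
      (∃ (f : Fin ℓ × Fin Kc → F) (α : Fin S → F), Function.Injective (Sum.elim f α)) ∧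
      ∀ (f : Fin ℓ × Fin Kc → F) (α : Fin S → F) (g : Fin S),
        Function.Injective (Sum.elim f α) →
        ∃ dec : ∀ T : Finset (Fin S), (T → Fin (lam / m) × Fin (mu / n) → F) →
            (Fin (ℓ * Kc) → Matrix (Fin lam) (Fin mu) F),
          (gcsaNA X ℓ Kc p m n lam kap mu f α g dec).IsSMBMMCode X ∧
          (gcsaNA X ℓ Kc p m n lam kap mu f α g dec).IsRecoveryThreshold R ∧
          (gcsaNA X ℓ Kc p m n lam kap mu f α g dec).uploadCostA = (S : ℚ) / (Kc * p * m) ∧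
          (gcsaNA X ℓ Kc p m n lam kap mu f α g dec).uploadCostB = (S : ℚ) / (Kc * p * n) ∧
          (gcsaNA X ℓ Kc p m n lam kap mu f α g dec).serverCommCost =
            ((S : ℚ) - 1) / (ℓ * Kc * m * n) ∧
          (gcsaNA X ℓ Kc p m n lam kap mu f α g dec).downloadCost R =
            (R : ℚ) / (ℓ * Kc * m * n) ∧
          (gcsaNA X ℓ Kc p m n lam kap mu f α g dec).EncodesAWithin
            (C * (lam * kap * S * softLogSq F S / (Kc * p * m))) ∧
          (gcsaNA X ℓ Kc p m n lam kap mu f α g dec).EncodesBWithin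
            (C * (kap * mu * S * softLogSq F S / (Kc * p * n))) ∧
          (gcsaNA X ℓ Kc p m n lam kap mu f α g dec).AnswersWithin
            (C * (lam * kap * mu / (Kc * p * m * n))) ∧
          ∀ c : ℕ, X ≤ c * (p * m * n * (ℓ * Kc)) →
            (gcsaNA X ℓ Kc p m n lam kap mu f α g dec).DecodesWithin R
              (Cd c * (lam * mu * p * softLogSq F R)) := by
  obtain ⟨C, hC0, hC⟩ := exists_polyMulCost.{u}
  -- The factors are `1000 = 10 * 100` and `2200 = 22 * 100`: the counts in `costLE_shareNumerator`
  -- and `costLE_localExpansion` times the `100` of `quasilinear_le`. The `3` is for the answers,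
  -- where one addition is added to multiplications and additions of equal number.
  refine ⟨max 3 (1000 * C), fun c => 2200 * C * (2 + 2 * c), ?_⟩
  intro F _ _ S X ℓ Kc p m n lam kap mu R hX hℓ hK hp hm hn hlam hkap hmu hmd hpd hnd hF hR hRS
  refine ⟨GCSA.exists_points hF, fun f α g hinj => ?_⟩
  have hf : Function.Injective f := hinj.comp Sum.inl_injective
  have hα : Function.Injective α := hinj.comp Sum.inr_injective
  have hfα : ∀ x s, f x ≠ α s := fun x s h => Sum.inl_ne_inr (hinj h)
  choose G hGdeg hG using GCSA.exists_correction (p := p) (m := m) (n := n) hf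
  have hr : 0 < p * m * n := Nat.mul_pos (Nat.mul_pos hp hm) hn
  have hrK : 0 < p * m * n * Kc := Nat.mul_pos hr hK
  have h1 : p * m * n * Kc * 1 ≤ p * m * n * Kc * ℓ := Nat.mul_le_mul_left _ hℓ
  have h2 : p * m * n * (ℓ + 1) * Kc = p * m * n * Kc * ℓ + p * m * n * Kc := by ring
  have hR3 : 3 ≤ R := by omega
  have hS3 : 3 ≤ S := hR3.trans hRS
  obtain ⟨μ, hμ0, hμ, hμC⟩ := hC F S hS3
  obtain ⟨μ', hμ0', hμ', hμC'⟩ := hC F R hR3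
  -- Nonnegativity is read off from the bound `hμC`, whose left side is nonnegative.
  have hsoft : 0 ≤ softLogSq F S := by
    have : 0 ≤ C * softLogSq F S := le_trans (by positivity) hμC
    exact nonneg_of_mul_nonneg_right this hC0
  have hscale : ∀ y : ℝ, 0 ≤ y → ((ℓ * Kc : ℕ) : ℝ) * (1000 * C * y) ≤
      ((ℓ * Kc : ℕ) : ℝ) * (max 3 (1000 * C) * y) := fun y hy => by
    gcongr
    exact le_max_right _ _
  refine ⟨GCSA.decoders (p := p) R hmd hnd f α G,
    GCSA.isSMBMMCode hX hK hp hm hn hmd hpd hnd hα hfα g hR hRS hG,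
    GCSA.isRecoveryThreshold hX hℓ hK hp hm hn hlam hkap hmu hmd hpd hnd hα hfα g hR hRS hG,
    GCSA.uploadCostA_eq f α g _ hℓ hlam hkap hmd hpd,
    GCSA.uploadCostB_eq f α g _ hℓ hkap hmu hpd hnd,
    GCSA.serverCommCost_eq f α g _ hlam hmu hmd hnd,
    GCSA.downloadCost_eq f α g _ hRS hlam hmu hmd hnd,
    (GCSA.encodesAWithin f α g _ hS3 hμ0 hμ hμC hX hK hp hm hn hmd hpd (by omega) (by omega)
      hfα).mono (hscale _ (by positivity)),
    (GCSA.encodesBWithin f α g _ hS3 hμ0 hμ hμC hX hK hp hm hn hpd hnd (by omega) (by omega)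
      hfα).mono (hscale _ (by positivity)),
    GCSA.answersWithin f α g _ (le_max_left _ _) hℓ hK hp hm hn hkap hmd hpd hnd, fun c hc =>
    GCSA.decodesWithin g hR3 hμ0' hμ' hμC' hℓ hK hp hm hn hmd hnd hR hc hX f α hGdeg⟩
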